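/- Let $k\ge 1$. A $k$-partite (unnormalized) pure state is a vector $|\psi\rangle\in\mathcal H_1\otimes\cdots\otimes\mathcal H_k$ with finite-dimensional Hilbert spaces $\mathcal H_i$. An LOCC channel is a finite composition of maps $\rho\mapsto\sum_{j\in J}\big((K_j)_i\otimes|g(j)\rangle\langle f(j)|\big)\rho\big((K_j)_i\otimes|g(j)\rangle\langle f(j)|\big)^*$ between spaces $\mathcal B(\mathcal H_1)\otimes\cdots\otimes\mathcal B(\mathcal H_k)\otimes\mathrm{Diag}(\mathbb C^{\mathcal X})$ with finite classical registers $\mathcal X$; here $J$ is finite, $f,g$ map $J$ to the old and the new register, $K_j$ acts on the $i$-th system only (whose space may change), and $\sum_j K_j^*K_j\otimes|f(j)\rangle\langle f(j)|\le I$. Write $|\psi\rangle\xrightarrow{\mathrm{LOCC}}|\varphi\rangle$ if some LOCC channel maps $|\psi\rangle\langle\psi|$ to $|\varphi\rangle\langle\varphi|$ (with one-point registers). Call $|\psi\rangle,|\varphi\rangle$ locally unitarily equivalent if there are partial isometries $U_j$ with $|\varphi\rangle=(U_1\otimes\cdots\otimes U_k)|\psi\rangle$ and $|\psi\rangle=(U_1^*\otimes\cdots\otimes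 U_k^*)|\varphi\rangle$. The equivalence classes form a commutative semiring $\mathcal S_k$ under $\oplus$ and $\otimes$, with zero the class of $0$ and unit the class of $|0\ldots0\rangle$. The asymptotic LOCC spectrum $\Delta(\mathcal S_k)$ is the set of semiring homomorphisms $f:\mathcal S_k\to\mathbb R_{\ge0}$ such that $f(|\varphi\rangle)\le f(|\psi\rangle)$ whenever $|\psi\rangle\xrightarrow{\mathrm{LOCC}}|\varphi\rangle$. Put $\alpha(f)=\log f(\sqrt2\,|0\ldots0\rangle)$, with $\log=\log_2$. For unit vectors $|\psi\rangle,|\varphi\rangle$ and $r\ge0$, let $E^*(r,\psi,\varphi)\in[0,\infty]$ be the supremum of all real $\tau\ge0$ for which there is a real sequence $e_n=o(n)$ such that, for all sufficiently large $n$, $$2^{nr/2+e_n}|\psi\rangle^{\otimes n}\xrightarrow{\mathrm{LOCC}}|\varphi\rangle^{\otimes\lfloor\tau n\rfloor},$$ i.e. $n$ copies of $|\psi\rangle$ are converted exactly into $\lfloor\tau n\rfloor$ copies of $|\varphi\rangle$ with success probability $2^{-nr+o(n)}$. Then, for all $k$-partite unit vectors $|\psi\rangle,|\varphi\rangle$ ($|\psi\rangle$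 need not be globally entangled) and all $r\ge 0$, $$\begin{aligned}E^*(r,\psi,\varphi)&=\sup\big\{\tau\ge0\;:\;\forall f\in\Delta(\mathcal S_k),\ f(2^{r/2}|\psi\rangle)\ge f(|\varphi\rangle)^\tau\big\}\\&=\sup\big\{\tau\ge0\;:\;\forall f\in\Delta(\mathcal S_k),\ r\,\alpha(f)+\log f(|\psi\rangle)\ge\tau\log f(|\varphi\rangle)\big\}\\&=\inf_{f}\frac{r\,\alpha(f)+\log f(|\psi\rangle)}{\log f(|\varphi\rangle)},\end{aligned}$$ where the infimum is taken in $[0,\infty]$ over those $f\in\Delta(\mathcal S_k)$ with $\log f(|\varphi\rangle)\ne0$ (it is $\infty$ if there are none). -/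

import Mathlib

open Filter Asymptotics Matrix
open scoped NNReal Kronecker ComplexOrder

noncomputable section

namespace LOCC

/-! ### Local operators -/

/-- The product operator `U₁ ⊗ ⋯ ⊗ U_k`, in product bases. -/
def prodOp {k : ℕ} {α β : Fin k → Type} (U : ∀ i, Matrix (β i) (α i) ℂ) :
    Matrix (∀ i, β i) (∀ i, α i) ℂ :=
  fun y x => ∏ i, U i (y i) (x i)

/-- The operator `(K)_i = I ⊗ ⋯ ⊗ K ⊗ ⋯ ⊗ I` with `K : H_i → H'_i` acting on the system of
party `i`. It is used only for dimensions `d`, `d'` that agree at every party other than `i`. -/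
def siteOp {k : ℕ} {d d' : Fin k → ℕ} (i : Fin k) (K : Matrix (Fin (d' i)) (Fin (d i)) ℂ) :
    Matrix (∀ j, Fin (d' j)) (∀ j, Fin (d j)) ℂ :=
  open Classical in
  fun y x => if ∀ j, j ≠ i → (y j : ℕ) = (x j : ℕ) then K (y i) (x i) else 0

/-- `U` is a partial isometry. -/
def IsPartialIsometry {m n : Type} [Fintype m] [Fintype n] (U : Matrix m n ℂ) : Prop :=
  U * Uᴴ * U = U

/-- The linear map sending the basis vector `|x⟩` to `|e x⟩`. -/
def emb {α β : Type} (e : α → β) : Matrix β α ℂ :=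
  open Classical in fun y x => if y = e x then 1 else 0

/-! ### Pure states -/

/-- Coordinates of a vector of `H₁ ⊗ ⋯ ⊗ H_k`, where `H_i = ℂ^(d i)`, in the product of the
standard orthonormal bases. -/
abbrev Vec {k : ℕ} (d : Fin k → ℕ) : Type := (∀ i, Fin (d i)) → ℂ

/-- Local unitary equivalence of vectors. -/
def VecEquiv {k : ℕ} {d d' : Fin k → ℕ} (v : Vec d) (w : Vec d') : Prop :=
  ∃ U : ∀ j, Matrix (Fin (d' j)) (Fin (d j)) ℂ,
    (∀ j, IsPartialIsometry (U j)) ∧ w = prodOp U *ᵥ v ∧ v = prodOp (fun j => (U j)ᴴ) *ᵥ w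

/-- The direct sum of vectors, in `(H₁ ⊕ H'₁) ⊗ ⋯ ⊗ (H_k ⊕ H'_k)`: the sum of their images under
the `k`-fold products of the two inclusions. -/
def dsumVec {k : ℕ} {d d' : Fin k → ℕ} (v : Vec d) (w : Vec d') : Vec (fun i => d i + d' i) :=
  prodOp (fun i => emb (Fin.castAdd (d' i))) *ᵥ v + prodOp (fun i => emb (Fin.natAdd (d i))) *ᵥ w

/-- The tensor product of vectors, in `(H₁ ⊗ H'₁) ⊗ ⋯ ⊗ (H_k ⊗ H'_k)`. -/
def tensorVec {k : ℕ} {d d' : Fin k → ℕ} (v : Vec d) (w : Vec d') : Vec (fun i => d i * d' i) :=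
  fun x => v (fun i => (finProdFinEquiv.symm (x i)).1) *
    w (fun i => (finProdFinEquiv.symm (x i)).2)

/-- An unnormalized `k`-partite pure state. -/
structure PureState (k : ℕ) where
  dim : Fin k → ℕ
  vec : Vec dim

namespace PureState

variable {k : ℕ}

/-- The squared norm `⟨ψ|ψ⟩`. -/
def normSq (ψ : PureState k) : ℝ := ∑ x, ‖ψ.vec x‖ ^ 2

/-- The multiple `c|ψ⟩`. -/
def scale (c : ℝ) (ψ : PureState k) : PureState k := ⟨ψ.dim, fun x => (c : ℂ) * ψ.vec x⟩

/-- The zero vector of `ℂ ⊗ ⋯ ⊗ ℂ`. -/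
def zero (k : ℕ) : PureState k := ⟨fun _ => 1, fun _ => 0⟩

/-- The vector `|0…0⟩` of `ℂ ⊗ ⋯ ⊗ ℂ`. -/
def one (k : ℕ) : PureState k := ⟨fun _ => 1, fun _ => 1⟩

/-- The direct sum `|ψ⟩ ⊕ |φ⟩`. -/
def dsum (ψ φ : PureState k) : PureState k := ⟨fun i => ψ.dim i + φ.dim i, dsumVec ψ.vec φ.vec⟩

/-- The tensor product `|ψ⟩ ⊗ |φ⟩`, again a `k`-partite state. -/
def tensor (ψ φ : PureState k) : PureState k :=
  ⟨fun i => ψ.dim i * φ.dim i, tensorVec ψ.vec φ.vec⟩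

/-- The tensor power `|ψ⟩^{⊗ n}`, again a `k`-partite state. -/
def tpow (ψ : PureState k) : ℕ → PureState k
  | 0 => one k
  | n + 1 => (ψ.tpow n).tensor ψ

/-- Local unitary equivalence. -/
def LUEquiv (φ ψ : PureState k) : Prop := VecEquiv φ.vec ψ.vec

end PureState

/-! ### LOCC channels -/

/-- A `k`-partite state space `B(H₁) ⊗ ⋯ ⊗ B(H_k) ⊗ Diag(ℂ^X)` with a finite classical
register `X`. -/
structure StateSpace (k : ℕ) where
  dim : Fin k → ℕ
  reg : Type
  [fin : Fintype reg]

attribute [instance] StateSpace.fin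

variable {k : ℕ}

/-- The elements `∑ x, ρ x ⊗ |x⟩⟨x|` of `B(H₁) ⊗ ⋯ ⊗ B(H_k) ⊗ Diag(ℂ^X)`, given by their
diagonal blocks `ρ x`. -/
abbrev StateSpace.Op (A : StateSpace k) : Type :=
  A.reg → Matrix (∀ i, Fin (A.dim i)) (∀ i, Fin (A.dim i)) ℂ

/-- One-step LOCC channels
`ρ ↦ ∑ j, ((K_j)_i ⊗ |g j⟩⟨f j|) ρ ((K_j)_i ⊗ |g j⟩⟨f j|)*`, where party `i` applies Kraus
operators with `∑ j, K_j* K_j ⊗ |f j⟩⟨f j| ≤ I`. Both formulas are written out in blocks of the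
registers. -/
def IsOneStep {A B : StateSpace k} (Λ : A.Op → B.Op) : Prop :=
  open Classical in
  ∃ (i : Fin k) (J : Type) (_ : Fintype J) (f : J → A.reg) (g : J → B.reg)
    (K : J → Matrix (Fin (B.dim i)) (Fin (A.dim i)) ℂ),
    (∀ j, j ≠ i → B.dim j = A.dim j) ∧
    (∀ x : A.reg, (1 - ∑ j with f j = x, (K j)ᴴ * K j).PosSemidef) ∧
    ∀ (ρ : A.Op) (y : B.reg),
      Λ ρ y = ∑ j with g j = y, siteOp i (K j) * ρ (f j) * (siteOp i (K j))ᴴ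

/-- LOCC channels: compositions of finitely many one-step LOCC channels. -/
inductive IsLOCC {A : StateSpace k} : ∀ {B : StateSpace k}, (A.Op → B.Op) → Prop
  | refl : IsLOCC (fun ρ : A.Op => ρ)
  | step {B C : StateSpace k} {Λ : A.Op → B.Op} {Λ' : B.Op → C.Op} :
      IsLOCC Λ → IsOneStep Λ' → IsLOCC (fun ρ => Λ' (Λ ρ))

namespace PureState

/-- The state space of a pure state, with a one-point register. -/
abbrev space (ψ : PureState k) : StateSpace k := ⟨ψ.dim, Unit⟩

/-- The pure state `|ψ⟩⟨ψ|`. -/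
def density (ψ : PureState k) : ψ.space.Op := fun _ => vecMulVec ψ.vec (star ψ.vec)

/-- `|ψ⟩ → |φ⟩` under LOCC. -/
def Converts (ψ φ : PureState k) : Prop :=
  ∃ Λ : ψ.space.Op → φ.space.Op, IsLOCC Λ ∧ Λ ψ.density = φ.density

end PureState

/-! ### Facts needed for the semiring structure -/

section Facts

variable {α β γ : Fin k → Type}

theorem prodOp_mul [∀ i, Fintype (β i)] (U : ∀ i, Matrix (γ i) (β i) ℂ)
    (V : ∀ i, Matrix (β i) (α i) ℂ) :
    prodOp U * prodOp V = prodOp (fun i => U i * V i) := by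
  classical
  ext y x
  simp only [prodOp, Matrix.mul_apply, ← Finset.prod_mul_distrib]
  rw [Finset.prod_univ_sum, Fintype.piFinset_univ]

theorem prodOp_one [∀ i, DecidableEq (α i)] :
    prodOp (fun i => (1 : Matrix (α i) (α i) ℂ)) = 1 := by
  ext y x
  simp only [prodOp, Matrix.one_apply]
  by_cases h : y = x
  · simp [h]
  · rw [if_neg h]
    obtain ⟨i, hi⟩ := Function.ne_iff.mp h
    exact Finset.prod_eq_zero (Finset.mem_univ i) (if_neg hi)

theorem emb_mul_emb {α β γ : Type} [Fintype β] (f : β → γ) (e : α → β) :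
    emb f * emb e = emb (fun x => f (e x)) := by
  classical
  ext y x
  simp [emb, Matrix.mul_apply]

theorem emb_conjTranspose_mul_emb {α β γ : Type} [Fintype γ] (f : β → γ) (e : α → γ) :
    (emb f)ᴴ * emb e = Matrix.of (fun y x => open Classical in if f y = e x then 1 else 0) := by
  classical
  ext y x
  simp [emb, Matrix.mul_apply, Matrix.conjTranspose_apply, eq_comm]

theorem emb_isometry {α β : Type} [DecidableEq α] [Fintype β] {e : α → β}
    (he : Function.Injective e) : (emb e)ᴴ * emb e = 1 := by
  rw [emb_conjTranspose_mul_emb]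
  ext y x
  simp [Matrix.one_apply, he.eq_iff]

theorem emb_orthogonal {α β γ : Type} [Fintype γ] {f : β → γ} {e : α → γ}
    (h : ∀ y x, f y ≠ e x) : (emb f)ᴴ * emb e = 0 := by
  rw [emb_conjTranspose_mul_emb]
  ext y x
  simp [h]

theorem castAdd_ne_natAdd {a b : ℕ} (y : Fin a) (x : Fin b) :
    Fin.castAdd b y ≠ Fin.natAdd a x := by
  intro h
  have h1 := congrArg Fin.val h
  simp at h1
  have := y.isLt
  omega

theorem prodOp_emb_equiv [∀ i, Fintype (α i)] (e : ∀ i, α i ≃ β i)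
    (v : (∀ i, α i) → ℂ) (y : ∀ i, β i) :
    (prodOp (fun i => emb (e i)) *ᵥ v) y = v (fun i => (e i).symm (y i)) := by
  classical
  simp only [Matrix.mulVec, dotProduct, prodOp, emb]
  rw [Finset.sum_eq_single (fun i => (e i).symm (y i))]
  · simp
  · intro x _ hx
    obtain ⟨i, hi⟩ := Function.ne_iff.mp hx
    rw [Finset.prod_eq_zero (Finset.mem_univ i), zero_mul]
    rw [if_neg]
    intro h
    exact hi (by rw [h, Equiv.symm_apply_apply])
  · simp

/-- The operator `U ⊗ V` on `ℂ^(m * n) = ℂ^m ⊗ ℂ^n`. -/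
def kron {m n m' n' : ℕ} (U : Matrix (Fin m') (Fin m) ℂ) (V : Matrix (Fin n') (Fin n) ℂ) :
    Matrix (Fin (m' * n')) (Fin (m * n)) ℂ :=
  (U ⊗ₖ V).submatrix finProdFinEquiv.symm finProdFinEquiv.symm

theorem kron_mul {m n m' n' m'' n'' : ℕ} (U : Matrix (Fin m'') (Fin m') ℂ)
    (V : Matrix (Fin n'') (Fin n') ℂ) (U' : Matrix (Fin m') (Fin m) ℂ)
    (V' : Matrix (Fin n') (Fin n) ℂ) :
    kron U V * kron U' V' = kron (U * U') (V * V') := by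
  rw [kron, kron, kron, Matrix.submatrix_mul_equiv, Matrix.mul_kronecker_mul]

theorem kron_conjTranspose {m n m' n' : ℕ} (U : Matrix (Fin m') (Fin m) ℂ)
    (V : Matrix (Fin n') (Fin n) ℂ) : (kron U V)ᴴ = kron Uᴴ Vᴴ := by
  rw [kron, kron, Matrix.conjTranspose_submatrix, Matrix.conjTranspose_kronecker]

theorem kron_emb {m n m' n' : ℕ} (e : Fin m → Fin m') (f : Fin n → Fin n') :
    kron (emb e) (emb f) = emb (fun x => finProdFinEquiv
      (e (finProdFinEquiv.symm x).1, f (finProdFinEquiv.symm x).2)) := by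
  classical
  ext y x
  obtain ⟨⟨y1, y2⟩, rfl⟩ := finProdFinEquiv.surjective y
  obtain ⟨⟨x1, x2⟩, rfl⟩ := finProdFinEquiv.surjective x
  simp only [kron, emb, Matrix.submatrix_apply, Equiv.symm_apply_apply,
    Matrix.kroneckerMap_apply, EmbeddingLike.apply_eq_iff_eq, Prod.mk.injEq]
  split_ifs <;> simp_all

theorem emb_id {α : Type} [DecidableEq α] : emb (fun x : α => x) = 1 := by
  ext y x
  simp [emb, Matrix.one_apply]

theorem prodOp_kron {d d' e e' : Fin k → ℕ} (U : ∀ i, Matrix (Fin (e i)) (Fin (d i)) ℂ)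
    (V : ∀ i, Matrix (Fin (e' i)) (Fin (d' i)) ℂ)
    (v : (∀ i, Fin (d i)) → ℂ) (w : (∀ i, Fin (d' i)) → ℂ) :
    prodOp (fun i => kron (U i) (V i)) *ᵥ tensorVec v w =
      tensorVec (prodOp U *ᵥ v) (prodOp V *ᵥ w) := by
  ext y
  simp only [Matrix.mulVec, dotProduct, tensorVec, Finset.sum_mul_sum, ← Fintype.sum_prod_type']
  refine Fintype.sum_equiv
    { toFun := fun x => (fun i => (finProdFinEquiv.symm (x i)).1,
        fun i => (finProdFinEquiv.symm (x i)).2)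
      invFun := fun p i => finProdFinEquiv (p.1 i, p.2 i)
      left_inv := fun x => by funext i; exact finProdFinEquiv.apply_symm_apply (x i)
      right_inv := fun p => by simp } _ _ ?_
  intro x
  simp only [prodOp, kron, Matrix.submatrix_apply, Matrix.kroneckerMap_apply, Equiv.coe_fn_mk,
    Finset.prod_mul_distrib]
  ring

theorem tensorVec_add_right {d d' : Fin k → ℕ} (v : (∀ i, Fin (d i)) → ℂ)
    (w w' : (∀ i, Fin (d' i)) → ℂ) : tensorVec v (w + w') = tensorVec v w + tensorVec v w' := by
  ext x
  simp [tensorVec, mul_add]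

variable {d d' d'' : Fin k → ℕ}

theorem vecEquiv_of_emb {v : Vec d} {w : Vec d'} (e : ∀ i, Fin (d i) → Fin (d' i))
    (he : ∀ i, Function.Injective (e i)) (h : w = prodOp (fun i => emb (e i)) *ᵥ v) :
    VecEquiv v w := by
  refine ⟨fun i => emb (e i), fun i => ?_, h, ?_⟩
  · unfold IsPartialIsometry
    rw [Matrix.mul_assoc, emb_isometry (he i), Matrix.mul_one]
  · rw [h, Matrix.mulVec_mulVec, prodOp_mul]
    simp only [emb_isometry (he _)]
    rw [prodOp_one, Matrix.one_mulVec]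

theorem vecEquiv_of_equiv {v : Vec d} {w : Vec d'} (e : ∀ i, Fin (d i) ≃ Fin (d' i))
    (h : ∀ y, w y = v (fun i => (e i).symm (y i))) : VecEquiv v w :=
  vecEquiv_of_emb (fun i => e i) (fun i => (e i).injective)
    (by ext y; rw [h, prodOp_emb_equiv])

theorem dsumVec_comm (v : Vec d) (w : Vec d') : VecEquiv (dsumVec v w) (dsumVec w v) := by
  refine vecEquiv_of_emb (fun _ => finAddFlip) (fun _ => finAddFlip.injective) ?_
  simp only [dsumVec, Matrix.mulVec_add, Matrix.mulVec_mulVec, prodOp_mul, emb_mul_emb,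
    finAddFlip_apply_castAdd, finAddFlip_apply_natAdd]
  rw [add_comm]

theorem dsumVec_assoc (u : Vec d) (v : Vec d') (w : Vec d'') :
    VecEquiv (dsumVec (dsumVec u v) w) (dsumVec u (dsumVec v w)) := by
  refine vecEquiv_of_emb (fun _ => Fin.cast (add_assoc _ _ _))
    (fun _ => Fin.cast_injective _) ?_
  have h1 : ∀ (a b c : ℕ) (x : Fin a), Fin.cast (add_assoc a b c)
      (Fin.castAdd c (Fin.castAdd b x)) = Fin.castAdd (b + c) x := fun a b c x => rfl
  have h2 : ∀ (a b c : ℕ) (x : Fin b), Fin.cast (add_assoc a b c)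
      (Fin.castAdd c (Fin.natAdd a x)) = Fin.natAdd a (Fin.castAdd c x) := fun a b c x => rfl
  have h3 : ∀ (a b c : ℕ) (x : Fin c), Fin.cast (add_assoc a b c)
      (Fin.natAdd (a + b) x) = Fin.natAdd a (Fin.natAdd b x) := fun a b c x => by
    ext; simp [Nat.add_assoc]
  simp only [dsumVec, Matrix.mulVec_add, Matrix.mulVec_mulVec, prodOp_mul, emb_mul_emb, h1, h2, h3]
  rw [add_assoc]

theorem dsumVec_zero (v : Vec d) : VecEquiv v (dsumVec v (0 : Vec d')) := by
  refine vecEquiv_of_emb (fun _ => Fin.castAdd _) (fun _ => Fin.castAdd_injective _ _) ?_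
  simp only [dsumVec, Matrix.mulVec_zero, add_zero]

theorem dsumVec_congr {v : Vec d} {v' : Vec d'} (w : Vec d'') (h : VecEquiv v v') :
    VecEquiv (dsumVec v w) (dsumVec v' w) := by
  obtain ⟨U, hU, h1, h2⟩ := h
  let L : ∀ i, Matrix (Fin (d i + d'' i)) (Fin (d i)) ℂ := fun i => emb (Fin.castAdd (d'' i))
  let R : ∀ i, Matrix (Fin (d i + d'' i)) (Fin (d'' i)) ℂ := fun i => emb (Fin.natAdd (d i))
  let L' : ∀ i, Matrix (Fin (d' i + d'' i)) (Fin (d' i)) ℂ := fun i => emb (Fin.castAdd (d'' i))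
  let R' : ∀ i, Matrix (Fin (d' i + d'' i)) (Fin (d'' i)) ℂ := fun i => emb (Fin.natAdd (d' i))
  have hLL : ∀ i, (L i)ᴴ * L i = 1 := fun i => emb_isometry (Fin.castAdd_injective _ _)
  have hRR : ∀ i, (R i)ᴴ * R i = 1 := fun i => emb_isometry (Fin.natAdd_injective _ _)
  have hLR : ∀ i, (L i)ᴴ * R i = 0 := fun i => emb_orthogonal castAdd_ne_natAdd
  have hRL : ∀ i, (R i)ᴴ * L i = 0 :=
    fun i => emb_orthogonal (fun y x => (castAdd_ne_natAdd x y).symm)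
  have hLL' : ∀ i, (L' i)ᴴ * L' i = 1 := fun i => emb_isometry (Fin.castAdd_injective _ _)
  have hRR' : ∀ i, (R' i)ᴴ * R' i = 1 := fun i => emb_isometry (Fin.natAdd_injective _ _)
  have hLR' : ∀ i, (L' i)ᴴ * R' i = 0 := fun i => emb_orthogonal castAdd_ne_natAdd
  have hRL' : ∀ i, (R' i)ᴴ * L' i = 0 :=
    fun i => emb_orthogonal (fun y x => (castAdd_ne_natAdd x y).symm)
  let W : ∀ i, Matrix (Fin (d' i + d'' i)) (Fin (d i + d'' i)) ℂ :=
    fun i => L' i * U i * (L i)ᴴ + R' i * (R i)ᴴ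
  have hWL : ∀ i, W i * L i = L' i * U i := fun i => by
    simp only [W, Matrix.add_mul, Matrix.mul_assoc, hLL, hRL, Matrix.mul_one, Matrix.mul_zero,
      add_zero]
  have hWR : ∀ i, W i * R i = R' i := fun i => by
    simp only [W, Matrix.add_mul, Matrix.mul_assoc, hLR, hRR, Matrix.mul_one, Matrix.mul_zero,
      zero_add]
  have hW : ∀ i, (W i)ᴴ = L i * (U i)ᴴ * (L' i)ᴴ + R i * (R' i)ᴴ := fun i => by
    simp [W, Matrix.conjTranspose_add, Matrix.conjTranspose_mul, Matrix.mul_assoc]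
  have hWL' : ∀ i, (W i)ᴴ * L' i = L i * (U i)ᴴ := fun i => by
    simp only [hW, Matrix.add_mul, Matrix.mul_assoc, hLL', hRL', Matrix.mul_one, Matrix.mul_zero,
      add_zero]
  have hWR' : ∀ i, (W i)ᴴ * R' i = R i := fun i => by
    simp only [hW, Matrix.add_mul, Matrix.mul_assoc, hLR', hRR', Matrix.mul_one, Matrix.mul_zero,
      zero_add]
  refine ⟨W, fun i => ?_, ?_, ?_⟩
  · have h3 : W i * (W i)ᴴ * W i = W i * ((W i)ᴴ * L' i) * U i * (L i)ᴴ
        + W i * ((W i)ᴴ * R' i) * (R i)ᴴ := by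
      conv_lhs => rw [show W i * (W i)ᴴ * W i
        = W i * (W i)ᴴ * (L' i * U i * (L i)ᴴ + R' i * (R i)ᴴ) from rfl]
      simp only [Matrix.mul_add, Matrix.mul_assoc]
    have h4 : U i * (U i)ᴴ * U i = U i := hU i
    unfold IsPartialIsometry
    rw [h3, hWL', hWR', hWR, ← Matrix.mul_assoc, hWL]
    conv_lhs => rw [Matrix.mul_assoc (L' i) (U i), Matrix.mul_assoc (L' i) (U i * (U i)ᴴ), h4]
  · change prodOp L' *ᵥ v' + prodOp R' *ᵥ w
      = prodOp W *ᵥ (prodOp L *ᵥ v + prodOp R *ᵥ w)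
    rw [Matrix.mulVec_add, Matrix.mulVec_mulVec, Matrix.mulVec_mulVec, prodOp_mul, prodOp_mul,
      h1, Matrix.mulVec_mulVec, prodOp_mul]
    simp only [hWL, hWR]
  · change prodOp L *ᵥ v + prodOp R *ᵥ w
      = prodOp (fun i => (W i)ᴴ) *ᵥ (prodOp L' *ᵥ v' + prodOp R' *ᵥ w)
    rw [Matrix.mulVec_add, Matrix.mulVec_mulVec, Matrix.mulVec_mulVec, prodOp_mul, prodOp_mul]
    simp only [hWL', hWR']
    conv_lhs => rw [h2, Matrix.mulVec_mulVec, prodOp_mul]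

theorem tensorVec_congr {v : Vec d} {v' : Vec d'} (w : Vec d'') (h : VecEquiv v v') :
    VecEquiv (tensorVec v w) (tensorVec v' w) := by
  obtain ⟨U, hU, h1, h2⟩ := h
  refine ⟨fun i => kron (U i) (1 : Matrix (Fin (d'' i)) (Fin (d'' i)) ℂ), fun i => ?_, ?_, ?_⟩
  · have h4 : U i * (U i)ᴴ * U i = U i := hU i
    unfold IsPartialIsometry
    rw [kron_conjTranspose, kron_mul, kron_mul, h4]
    simp
  · rw [prodOp_kron, prodOp_one, Matrix.one_mulVec, ← h1]
  · simp only [kron_conjTranspose, Matrix.conjTranspose_one]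
    rw [prodOp_kron, prodOp_one, Matrix.one_mulVec, ← h2]

theorem tensorVec_comm (v : Vec d) (w : Vec d') : VecEquiv (tensorVec v w) (tensorVec w v) := by
  refine vecEquiv_of_equiv (fun _ => finProdFinEquiv.symm.trans
    ((Equiv.prodComm _ _).trans finProdFinEquiv)) (fun y => ?_)
  simp only [tensorVec, Equiv.symm_trans_apply, Equiv.symm_symm, Equiv.prodComm_symm,
    Equiv.prodComm_apply, Equiv.symm_apply_apply, Prod.fst_swap, Prod.snd_swap]
  rw [mul_comm]

theorem tensorVec_assoc (u : Vec d) (v : Vec d') (w : Vec d'') :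
    VecEquiv (tensorVec (tensorVec u v) w) (tensorVec u (tensorVec v w)) := by
  refine vecEquiv_of_equiv (fun _ => finProdFinEquiv.symm.trans
    (((finProdFinEquiv.symm.prodCongr (Equiv.refl _)).trans
      ((Equiv.prodAssoc _ _ _).trans ((Equiv.refl _).prodCongr finProdFinEquiv))).trans
        finProdFinEquiv)) (fun y => ?_)
  simp only [tensorVec, Equiv.symm_trans_apply, Equiv.symm_symm, Equiv.prodCongr_symm,
    Equiv.refl_symm, Equiv.prodCongr_apply, Equiv.symm_apply_apply, Prod.map_fst, Prod.map_snd,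
    Equiv.prodAssoc_symm_apply, Equiv.refl_apply, mul_assoc, Prod.map_apply]

theorem one_tensorVec (v : Vec d) :
    VecEquiv (tensorVec (fun _ => 1 : Vec (fun _ : Fin k => 1)) v) v := by
  refine vecEquiv_of_equiv (fun i => finProdFinEquiv.symm.trans
    (Equiv.uniqueProd (Fin (d i)) (Fin 1))) (fun y => ?_)
  simp only [tensorVec, Equiv.symm_trans_apply, Equiv.symm_symm, Equiv.symm_apply_apply,
    Equiv.uniqueProd_symm_apply, one_mul]

theorem vecEquiv_zero : VecEquiv (0 : Vec d) (0 : Vec d') := by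
  refine ⟨fun _ => 0, fun _ => ?_, ?_, ?_⟩
  · simp [IsPartialIsometry]
  · rw [Matrix.mulVec_zero]
  · rw [Matrix.mulVec_zero]

theorem tensorVec_dsumVec (u : Vec d) (v : Vec d') (w : Vec d'') :
    VecEquiv (tensorVec u (dsumVec v w)) (dsumVec (tensorVec u v) (tensorVec u w)) := by
  have e : ∀ a b c : ℕ, ∃ e : Fin (a * (b + c)) ≃ Fin (a * b + a * c),
      (∀ x y, e (finProdFinEquiv (x, Fin.castAdd c y)) =
        Fin.castAdd (a * c) (finProdFinEquiv (x, y))) ∧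
      (∀ x y, e (finProdFinEquiv (x, Fin.natAdd b y)) =
        Fin.natAdd (a * b) (finProdFinEquiv (x, y))) := by
    intro a b c
    refine ⟨finProdFinEquiv.symm.trans ((((Equiv.refl _).prodCongr finSumFinEquiv.symm).trans
      ((Equiv.prodSumDistrib _ _ _).trans (finProdFinEquiv.sumCongr finProdFinEquiv))).trans
        finSumFinEquiv), fun x y => ?_, fun x y => ?_⟩
    · simp [-finProdFinEquiv_apply_val]
    · simp [-finProdFinEquiv_apply_val]
  choose e he he' using e
  refine vecEquiv_of_emb (fun i => e (d i) (d' i) (d'' i)) (fun i => (e _ _ _).injective) ?_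
  have key : ∀ (b c : Fin k → ℕ) (f : ∀ i, Fin (b i) → Fin (c i)) (v : Vec b),
      tensorVec u (prodOp (fun i => emb (f i)) *ᵥ v) =
        prodOp (fun i => emb (fun x => finProdFinEquiv ((finProdFinEquiv.symm x).1,
          f i (finProdFinEquiv.symm x).2))) *ᵥ tensorVec u v := by
    intro b c f v
    have h1 := prodOp_kron (fun i => (1 : Matrix (Fin (d i)) (Fin (d i)) ℂ))
      (fun i => emb (f i)) u v
    rw [prodOp_one, Matrix.one_mulVec] at h1
    rw [← h1]
    simp only [← emb_id, kron_emb]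
  rw [dsumVec, dsumVec, tensorVec_add_right, Matrix.mulVec_add, key, key, Matrix.mulVec_mulVec,
    Matrix.mulVec_mulVec, prodOp_mul, prodOp_mul]
  simp only [emb_mul_emb, he, he', Prod.mk.eta, Equiv.apply_symm_apply]

end Facts

/-! ### The semiring of states and the asymptotic LOCC spectrum -/

/-- The set `𝒮_k` of local unitary equivalence classes of unnormalized `k`-partite pure states. -/
def S (k : ℕ) : Type := Quot (PureState.LUEquiv (k := k))

/-- The class `[|ψ⟩]`. -/
def cls (ψ : PureState k) : S k := Quot.mk _ ψ

namespace S

open PureState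

theorem sound {d d' : Fin k → ℕ} {v : Vec d} {w : Vec d'} (h : VecEquiv v w) :
    cls ⟨d, v⟩ = cls ⟨d', w⟩ := Quot.sound h

theorem ind {p : S k → Prop} (h : ∀ ψ, p (cls ψ)) (a : S k) : p a := Quot.ind h a

/-- Addition induced by `⊕`. -/
def add : S k → S k → S k :=
  Quot.lift₂ (fun ψ φ => cls (ψ.dsum φ))
    (fun ψ φ φ' h => (sound (dsumVec_comm ψ.vec φ.vec)).trans
      ((sound (dsumVec_congr ψ.vec h)).trans (sound (dsumVec_comm φ'.vec ψ.vec))))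
    (fun _ _ φ h => sound (dsumVec_congr φ.vec h))

/-- Multiplication induced by `⊗`. -/
def mul : S k → S k → S k :=
  Quot.lift₂ (fun ψ φ => cls (ψ.tensor φ))
    (fun ψ φ φ' h => (sound (tensorVec_comm ψ.vec φ.vec)).trans
      ((sound (tensorVec_congr ψ.vec h)).trans (sound (tensorVec_comm φ'.vec ψ.vec))))
    (fun _ _ φ h => sound (tensorVec_congr φ.vec h))

theorem add_comm' (a b : S k) : add a b = add b a := by
  induction a using ind with | h ψ => induction b using ind with | h φ =>
  exact sound (dsumVec_comm ψ.vec φ.vec)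

theorem mul_comm' (a b : S k) : mul a b = mul b a := by
  induction a using ind with | h ψ => induction b using ind with | h φ =>
  exact sound (tensorVec_comm ψ.vec φ.vec)

theorem add_assoc' (a b c : S k) : add (add a b) c = add a (add b c) := by
  induction a using ind with | h ψ => induction b using ind with | h φ =>
  induction c using ind with | h χ =>
  exact sound (dsumVec_assoc ψ.vec φ.vec χ.vec)

theorem mul_assoc' (a b c : S k) : mul (mul a b) c = mul a (mul b c) := by
  induction a using ind with | h ψ => induction b using ind with | h φ =>
  induction c using ind with | h χ =>
  exact sound (tensorVec_assoc ψ.vec φ.vec χ.vec)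

theorem add_zero' (a : S k) : add a (cls (zero k)) = a := by
  induction a using ind with | h ψ => exact (sound (dsumVec_zero ψ.vec)).symm

theorem one_mul' (a : S k) : mul (cls (one k)) a = a := by
  induction a using ind with | h ψ => exact sound (one_tensorVec ψ.vec)

theorem zero_mul' (a : S k) : mul (cls (zero k)) a = cls (zero k) := by
  induction a using ind with | h ψ =>
    have h : tensorVec (zero k).vec ψ.vec = 0 := by
      ext x
      exact zero_mul _
    have h' : VecEquiv (tensorVec (zero k).vec ψ.vec) (zero k).vec := by
      rw [h]; exact vecEquiv_zero
    exact sound h'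

theorem mul_add' (a b c : S k) : mul a (add b c) = add (mul a b) (mul a c) := by
  induction a using ind with | h ψ => induction b using ind with | h φ =>
  induction c using ind with | h χ =>
  exact sound (tensorVec_dsumVec ψ.vec φ.vec χ.vec)

instance : Zero (S k) := ⟨cls (zero k)⟩

instance : One (S k) := ⟨cls (one k)⟩

instance : Add (S k) := ⟨add⟩

instance : Mul (S k) := ⟨mul⟩

instance : CommSemiring (S k) where
  add_assoc := add_assoc'
  zero_add a := (add_comm' _ _).trans (add_zero' a)
  add_zero := add_zero'
  add_comm := add_comm'
  nsmul := nsmulRec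
  left_distrib := mul_add'
  right_distrib a b c := (mul_comm' _ _).trans
    ((mul_add' c a b).trans (congrArg₂ add (mul_comm' c a) (mul_comm' c b)))
  zero_mul := zero_mul'
  mul_zero a := (mul_comm' _ _).trans (zero_mul' a)
  mul_assoc := mul_assoc'
  one_mul := one_mul'
  mul_one a := (mul_comm' _ _).trans (one_mul' a)
  mul_comm := mul_comm'

end S

/-- The asymptotic LOCC spectrum `Δ(𝒮_k)`: the semiring homomorphisms `f : 𝒮_k → ℝ⁺` that are
order preserving, i.e. `f(|φ⟩) ≤ f(|ψ⟩)` whenever `|ψ⟩ → |φ⟩` under LOCC. -/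
def Spectrum (k : ℕ) : Set (S k →+* ℝ≥0) :=
  {f | ∀ ψ φ : PureState k, ψ.Converts φ → f (cls φ) ≤ f (cls ψ)}

/-- The value `f(|ψ⟩)`, as a real number. -/
def Spectrum.eval (f : Spectrum k) (ψ : PureState k) : ℝ := ((f : S k →+* ℝ≥0) (cls ψ) : ℝ)

/-- `α(f) = log f(√2 |0…0⟩)`. -/
def Spectrum.alpha (f : Spectrum k) : ℝ :=
  Real.logb 2 (Spectrum.eval f ((PureState.one k).scale (Real.sqrt 2)))

/-- The rate `τ` is achievable with converse error exponent `r`: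
`2^{nr/2 + o(n)} |ψ⟩^{⊗ n} → |φ⟩^{⊗ ⌊τ n⌋}` under LOCC for all sufficiently large `n`. For unit
vectors this is conversion of `n` copies into `⌊τ n⌋` copies with success probability
`2^{-nr + o(n)}`. -/
def Achievable (r : ℝ) (ψ φ : PureState k) (τ : ℝ) : Prop :=
  ∃ e : ℕ → ℝ, e =o[atTop] (fun n : ℕ => (n : ℝ)) ∧
    ∀ᶠ n : ℕ in atTop,
      ((ψ.tpow n).scale ((2 : ℝ) ^ ((n : ℝ) * r / 2 + e n))).Converts (φ.tpow ⌊τ * n⌋₊)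

/-- The supremum in `[0, ∞]` of the nonnegative reals that satisfy `P`. -/
def supRate (P : ℝ → Prop) : EReal := sSup ((fun τ : ℝ => (τ : EReal)) '' {τ | 0 ≤ τ ∧ P τ})

/-- The optimal extraction rate `E*(r, ψ, φ)`. -/
def extractionRate (r : ℝ) (ψ φ : PureState k) : EReal := supRate (Achievable r ψ φ)

end LOCC

end

noncomputable section

set_option linter.unusedSectionVars false

/-! Write a ≤ b on 𝒮_k when b is converted to a by LOCC. The upper bound on the rate is the easy
half (`Achievable.le_of_spectrum`): a spectral point f is monotone and multiplicative, and
f(2^x|0…0⟩) = 2^(2α(f)x) by `Spectrum.logb_eval_sc`, so one applies f to the conversion, takes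
logarithms, divides by n and passes to the limit.

The converse rests on Strassen's duality. The preorder ≤ satisfies Strassen's axioms
(`S.isStrassen`): the natural number n is the class of the unnormalized GHZ state with n levels
(`natCast_eq_cls`), norms cannot increase, every vector is a local image of a large GHZ state, and
every nonzero vector yields a nonzero multiple of |0…0⟩. Compatibility with ⊕ and ⊗ is proved for
trees of local measurements (`Reach`, `Conv`) rather than for channels; the two notions of
conversion agree, because a pure output forces every branch of a channel to end in a multiple of the
target. A maximal Strassen preorder is total, and a total one defines a monotone homomorphism to the
nonnegative reals by rational approximation. Hence f(a) ≤ f(b) for all f implies a^n ≤ C·4^n·b^n for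
all n (`IsStrassen.pow_le_of_forall_hom`).

The factor C·4^n is not free: it is a GHZ state shared by all parties. It is paid for with further
copies of ψ. If a = φ^⌊τm⌋ and b = 2^(mr/2)ψ^m, a block of m copies of ψ needs only a bounded number
of additional GHZ pairs of levels, so the relative cost vanishes as m grows. When ψ is globally
entangled, GHZ states can be extracted from it. In general the parties fall into classes such that ψ
is a product across each class and its complement, while GHZ states of each class are obtainable
from ψ (`S.exists_isPartition`). A comparison of Schmidt ranks shows that φ must respect the same
classes (`S.split_of_pow_le`). A GHZ state shared by several classes is then useless beyond its
parts: it can be replaced by one GHZ state per class at the price of a scalar linear in the number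
of levels (`S.le_ghz_mul_ghz`, based on `exists_balanced_factorization`). These GHZ states come from
ψ (`S.le_of_le_ghz_mul`), the scalar goes into 2^(o(n)), and the blocks are assembled in
`S.eventually_pow_le`. -/

/-! ### Strassen preorders on commutative semirings -/

/-- A preorder on a commutative semiring that is compatible with the operations, faithful on the
natural numbers, and for which the natural numbers are cofinal. -/
structure IsStrassen {S : Type*} [CommSemiring S] (R : S → S → Prop) : Prop where
  refl : ∀ a, R a a
  trans : ∀ {a b c}, R a b → R b c → R a c
  add_right : ∀ {a b} (c), R a b → R (a + c) (b + c)
  mul_right : ∀ {a b} (c), R a b → R (a * c) (b * c)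
  zero_le : ∀ a, R 0 a
  nat_le : ∀ {m n : ℕ}, R m n → m ≤ n
  le_nat : ∀ a, ∃ n : ℕ, R a n
  one_le : ∀ a, a ≠ 0 → ∃ n : ℕ, R 1 (n * a)

namespace IsStrassen

variable {S : Type*} [CommSemiring S] {R : S → S → Prop} (h : IsStrassen R)

include h

theorem add {a b c d : S} (h1 : R a b) (h2 : R c d) : R (a + c) (b + d) := by
  refine h.trans (h.add_right c h1) ?_
  rw [add_comm b c, add_comm b d]
  exact h.add_right b h2

theorem mul {a b c d : S} (h1 : R a b) (h2 : R c d) : R (a * c) (b * d) := by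
  refine h.trans (h.mul_right c h1) ?_
  rw [mul_comm b c, mul_comm b d]
  exact h.mul_right b h2

theorem mul_left {a b : S} (c : S) (h1 : R a b) : R (c * a) (c * b) := h.mul (h.refl c) h1

theorem pow {a b : S} (h1 : R a b) (n : ℕ) : R (a ^ n) (b ^ n) := by
  induction n with
  | zero => simpa using h.refl 1
  | succ n ih => rw [pow_succ, pow_succ]; exact h.mul ih h1

theorem le_add_right (a b : S) : R a (a + b) := by
  simpa using h.add (h.refl a) (h.zero_le b)

theorem le_add_left (a b : S) : R a (b + a) := by
  simpa using h.add (h.zero_le b) (h.refl a)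

theorem natCast_mono {m n : ℕ} (hmn : m ≤ n) : R m n := by
  obtain ⟨k, rfl⟩ := Nat.exists_eq_add_of_le hmn
  rw [Nat.cast_add]
  exact h.le_add_right _ _

/-- A factor `c` common to both sides disappears asymptotically. -/
theorem pow_le_of_mul_le {a b c : S} (hc : c ≠ 0) (hab : R (c * a) (c * b)) :
    ∃ C : ℕ, ∀ n : ℕ, R (a ^ n) (C * b ^ n) := by
  -- The factor `c` is carried along unchanged through all powers. It is then removed once, using
  -- bounds 1 ≤ m·c and c ≤ k, so the price m·k does not depend on n.
  have key : ∀ n : ℕ, R (c * a ^ n) (c * b ^ n) := by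
    intro n
    induction n with
    | zero => simpa using h.refl c
    | succ n ih =>
      have h1 : R (c * a ^ n * a) (c * b ^ n * a) := h.mul_right a ih
      have h2 : R (c * a * b ^ n) (c * b * b ^ n) := h.mul_right _ hab
      have e1 : c * a ^ (n + 1) = c * a ^ n * a := by ring
      have e2 : c * b ^ n * a = c * a * b ^ n := by ring
      have e3 : c * b ^ (n + 1) = c * b * b ^ n := by ring
      rw [e1, e3]
      exact h.trans h1 (e2 ▸ h2)
  obtain ⟨m, hm⟩ := h.one_le c hc
  obtain ⟨k, hk⟩ := h.le_nat c
  refine ⟨m * k, fun n => ?_⟩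
  have h1 : R (1 * a ^ n) (m * c * a ^ n) := h.mul_right _ hm
  have h2 : R (m * (c * a ^ n)) (m * (c * b ^ n)) := h.mul_left _ (key n)
  have h3 : R (m * b ^ n * c) (m * b ^ n * k) := h.mul_left _ hk
  have e1 : (m : S) * c * a ^ n = m * (c * a ^ n) := by ring
  have e2 : (m : S) * (c * b ^ n) = m * b ^ n * c := by ring
  have e3 : ((m * k : ℕ) : S) * b ^ n = m * b ^ n * k := by push_cast; ring
  rw [one_mul, e1] at h1
  rw [e2] at h2
  rw [e3]
  exact h.trans h1 (h.trans h2 h3)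

/-- The relation obtained from `R` by forcing `b ≤ a`. -/
theorem extend {a b : S}
    (hnat : ∀ (m : ℕ) (s : S), ¬ R (m + 1 + s * a) (m + s * b)) :
    IsStrassen (fun x y => ∃ s, R (x + s * a) (y + s * b)) where
  refl x := ⟨0, by simpa using h.refl x⟩
  trans := by
    rintro x y z ⟨s, hs⟩ ⟨t, ht⟩
    refine ⟨s + t, ?_⟩
    have h1 := h.add_right (t * a) hs
    have h2 := h.add_right (s * b) ht
    have e1 : x + (s + t) * a = x + s * a + t * a := by ring
    have e2 : y + s * b + t * a = y + t * a + s * b := by ring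
    have e3 : z + (s + t) * b = z + t * b + s * b := by ring
    rw [e1, e3]
    exact h.trans h1 (e2 ▸ h2)
  add_right := by
    rintro x y c ⟨s, hs⟩
    refine ⟨s, ?_⟩
    rw [add_right_comm x, add_right_comm y]
    exact h.add_right c hs
  mul_right := by
    rintro x y c ⟨s, hs⟩
    refine ⟨s * c, ?_⟩
    have e1 : x * c + s * c * a = (x + s * a) * c := by ring
    have e2 : y * c + s * c * b = (y + s * b) * c := by ring
    rw [e1, e2]
    exact h.mul_right c hs
  zero_le x := ⟨0, by simpa using h.zero_le x⟩
  -- This is the only axiom that the extension can violate. If n < m were related the wrong way,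
  -- then n + 1 + s·a ≤ m + s·a ≤ n + s·b, which `hnat` excludes.
  nat_le := by
    rintro m n ⟨s, hs⟩
    by_contra! hlt
    refine hnat n s (h.trans (h.add_right _ ?_) hs)
    have := h.natCast_mono (Nat.succ_le_of_lt hlt)
    rwa [Nat.cast_succ] at this
  le_nat x := (h.le_nat x).imp fun n hn => ⟨0, by simpa using hn⟩
  one_le x hx := (h.one_le x hx).imp fun n hn => ⟨0, by simpa using hn⟩

theorem exists_maximal : ∃ Q : S → S → Prop, R ≤ Q ∧ Maximal IsStrassen Q := by
  refine zorn_le_nonempty₀ {Q : S → S → Prop | IsStrassen Q} ?_ R h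
  intro c hc hchain Q₀ hQ₀
  have hS : ∀ Q ∈ c, IsStrassen Q := fun Q hQ => hc hQ
  have dir : ∀ Q ∈ c, ∀ Q' ∈ c, ∃ P ∈ c, Q ≤ P ∧ Q' ≤ P := fun Q hQ Q' hQ' => by
    rcases hchain.total hQ hQ' with h1 | h1
    · exact ⟨Q', hQ', h1, le_rfl⟩
    · exact ⟨Q, hQ, le_rfl, h1⟩
  refine ⟨fun x y => ∃ Q ∈ c, Q x y, ?_, fun Q hQ x y hxy => ⟨Q, hQ, hxy⟩⟩
  have h0 := hS Q₀ hQ₀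
  exact
    { refl := fun x => ⟨Q₀, hQ₀, h0.refl x⟩
      trans := by
        rintro x y z ⟨Q, hQ, h1⟩ ⟨Q', hQ', h2⟩
        obtain ⟨P, hP, h3, h4⟩ := dir Q hQ Q' hQ'
        exact ⟨P, hP, (hS P hP).trans (h3 _ _ h1) (h4 _ _ h2)⟩
      add_right := fun z ⟨Q, hQ, h1⟩ => ⟨Q, hQ, (hS Q hQ).add_right z h1⟩
      mul_right := fun z ⟨Q, hQ, h1⟩ => ⟨Q, hQ, (hS Q hQ).mul_right z h1⟩
      zero_le := fun x => ⟨Q₀, hQ₀, h0.zero_le x⟩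
      nat_le := fun ⟨Q, hQ, h1⟩ => (hS Q hQ).nat_le h1
      le_nat := fun x => (h0.le_nat x).imp fun n hn => ⟨Q₀, hQ₀, hn⟩
      one_le := fun x hx => (h0.one_le x hx).imp fun n hn => ⟨Q₀, hQ₀, hn⟩ }

theorem ne_zero_of_succ_le {a b s : S} {m : ℕ} (hs : R (m + 1 + s * a) (m + s * b)) :
    s ≠ 0 := by
  rintro rfl
  simp only [zero_mul, add_zero] at hs
  have := h.nat_le (m := m + 1) (n := m) (by simpa using hs)
  omega

/-- An Archimedean argument: a multiple M·s exceeds 1, so z + s ≤ z would give M·z + 1 ≤ M·z and, by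
iteration, N ≤ M·z for every N, although M·z lies below some natural number. -/
theorem not_add_le {z s : S} (hs : s ≠ 0) : ¬ R (z + s) z := by
  intro hz
  obtain ⟨M, hM⟩ := h.one_le s hs
  obtain ⟨L, hL⟩ := h.le_nat (M * z)
  have h1 : R (M * z + 1) (M * z) := by
    refine h.trans (h.add (h.refl _) hM) ?_
    rw [← mul_add]
    exact h.mul_left _ hz
  have h2 : ∀ N : ℕ, R (M * z + N) (M * z) := by
    intro N
    induction N with
    | zero => simpa using h.refl _
    | succ N ih =>
      have h3 := h.add_right 1 ih
      rw [add_assoc, ← Nat.cast_succ] at h3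
      exact h.trans h3 h1
  have h3 := h.nat_le (h.trans (h.le_add_left _ _) (h.trans (h2 (L + 1)) hL))
  omega

-- If y ≤ x fails, maximality means that forcing y ≤ x breaks faithfulness on the naturals, which
-- `extend` expresses by an inequality m + 1 + s·x ≤ m + s·y. For incomparable a and b there are two
-- such inequalities, with coefficients s and t. Multiplied crosswise by t and s and added, they
-- have the same term t·s·(a + b) on both sides, and what is left contradicts `not_add_le`.
omit h in
theorem total_of_maximal {Q : S → S → Prop} (hQ : Maximal IsStrassen Q) (a b : S) :
    Q a b ∨ Q b a := by
  have hq : IsStrassen Q := hQ.1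
  have key : ∀ x y : S, ¬ Q y x → ∃ (m : ℕ) (s : S), Q (m + 1 + s * x) (m + s * y) := by
    intro x y hyx
    by_contra! hno
    have h1 := hq.extend hno
    have h2 := hQ.2 h1 (fun u v huv => ⟨0, by simpa using huv⟩)
    exact hyx (h2 _ _ ⟨1, by rw [one_mul, one_mul, add_comm]; exact hq.refl _⟩)
  by_contra! hcon
  obtain ⟨m, s, h1⟩ := key a b hcon.2
  obtain ⟨n, t, h2⟩ := key b a hcon.1
  have hs := hq.ne_zero_of_succ_le h1
  have h3 := hq.add (hq.mul_left t h1) (hq.mul_left s h2)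
  refine hq.not_add_le (z := t * m + s * n + t * s * (a + b)) (s := s + t) ?_ ?_
  · intro h0
    obtain ⟨M, hM⟩ := hq.one_le s hs
    have h4 : Q ((1 : ℕ) : S) ((0 : ℕ) : S) := by
      rw [Nat.cast_one, Nat.cast_zero]
      refine hq.trans hM ?_
      refine hq.trans (hq.le_add_right _ (M * t)) ?_
      rw [← mul_add, h0, mul_zero]
      exact hq.refl 0
    exact absurd (hq.nat_le h4) (by norm_num)
  · have e1 : t * m + s * n + t * s * (a + b) + (s + t)
        = t * (m + 1 + s * a) + s * (n + 1 + t * b) := by ring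
    have e2 : t * m + s * n + t * s * (a + b) = t * (m + s * b) + s * (n + t * a) := by ring
    rw [e1]
    nth_rewrite 1 [e2]
    exact h3

end IsStrassen

/-! ### The homomorphism of a total Strassen preorder -/

namespace IsStrassen

variable {S : Type*} [CommSemiring S]

/-- The rational upper bounds of an element. -/
def upperSet (R : S → S → Prop) (x : S) : Set ℝ :=
  {q | ∃ u v : ℕ, 0 < v ∧ R (v * x) u ∧ q = u / v}

/-- The value of an element: the infimum of its rational upper bounds. -/
def value (R : S → S → Prop) (x : S) : ℝ := sInf (upperSet R x)

variable {R : S → S → Prop} (h : IsStrassen R)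

theorem upperSet_bddBelow (x : S) : BddBelow (upperSet R x) :=
  ⟨0, by rintro _ ⟨u, v, -, -, rfl⟩; positivity⟩

include h

theorem upperSet_nonempty (x : S) : (upperSet R x).Nonempty := by
  obtain ⟨n, hn⟩ := h.le_nat x
  exact ⟨_, n, 1, one_pos, by simpa using hn, rfl⟩

omit h in
theorem value_le {x : S} {u v : ℕ} (hv : 0 < v) (hx : R (v * x) u) : value R x ≤ u / v :=
  csInf_le (upperSet_bddBelow x) ⟨u, v, hv, hx, rfl⟩

theorem le_value {x : S} {u v : ℕ} (hv : 0 < v) (hx : R u (v * x)) : (u : ℝ) / v ≤ value R x := by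
  refine le_csInf (h.upperSet_nonempty x) ?_
  rintro _ ⟨u', v', hv', hx', rfl⟩
  have h1 : R ((v' * u : ℕ) : S) ((v * u' : ℕ) : S) := by
    push_cast
    refine h.trans (h.mul_left _ hx) ?_
    rw [mul_left_comm]
    exact h.mul_left _ hx'
  have h2 : ((v' * u : ℕ) : ℝ) ≤ ((v * u' : ℕ) : ℝ) := Nat.cast_le.mpr (h.nat_le h1)
  push_cast at h2
  rw [div_le_div_iff₀ (by positivity) (by positivity)]
  linarith

theorem value_nonneg (x : S) : 0 ≤ value R x := by
  have := h.le_value (x := x) (u := 0) (v := 1) one_pos (by simpa using h.zero_le _)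
  simpa using this

theorem value_natCast (n : ℕ) : value R (n : S) = n := by
  refine le_antisymm ?_ ?_
  · simpa using value_le (x := (n : S)) (u := n) (v := 1) one_pos (by simpa using h.refl _)
  · simpa using h.le_value (x := (n : S)) (u := n) (v := 1) one_pos (by simpa using h.refl _)

theorem value_mono {x y : S} (hxy : R x y) : value R x ≤ value R y := by
  refine le_csInf (h.upperSet_nonempty y) ?_
  rintro _ ⟨u, v, hv, hy, rfl⟩
  exact value_le hv (h.trans (h.mul_left _ hxy) hy)

/-- An element is approximated by rational numbers from both sides. -/
theorem exists_approx (htot : ∀ a b, R a b ∨ R b a) (x : S) {ε : ℝ} (hε : 0 < ε) :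
    ∃ u v : ℕ, 0 < v ∧ R u (v * x) ∧ R (v * x) (u + 1) ∧ 1 / (v : ℝ) ≤ ε := by
  classical
  obtain ⟨v, hv⟩ := exists_nat_gt (1 / ε)
  have hv0 : 0 < v := by
    have : (0 : ℝ) < v := lt_trans (by positivity) hv
    exact_mod_cast this
  obtain ⟨n, hn⟩ := h.le_nat (v * x)
  have hex : ∃ u : ℕ, R (v * x) (u + 1) :=
    ⟨n, h.trans hn (h.le_add_right _ _)⟩
  refine ⟨Nat.find hex, v, hv0, ?_, Nat.find_spec hex, ?_⟩
  · rcases Nat.eq_zero_or_pos (Nat.find hex) with h0 | h0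
    · rw [h0, Nat.cast_zero]; exact h.zero_le _
    · obtain ⟨w, hw⟩ := Nat.exists_eq_succ_of_ne_zero h0.ne'
      have := Nat.find_min hex (m := w) (by omega)
      rw [hw, Nat.cast_succ]
      exact (htot _ _).resolve_left this
  · rw [div_le_iff₀ (by exact_mod_cast hv0)]
    rw [div_lt_iff₀ hε] at hv
    linarith

/-- Totality brackets each summand between consecutive fractions u/v and (u + 1)/v. Over the common
denominator the brackets add, so the defect is at most the sum of the two mesh widths. -/
theorem value_add (htot : ∀ a b, R a b ∨ R b a) (x y : S) :
    value R (x + y) = value R x + value R y := by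
  have key : ∀ ε : ℝ, 0 < ε → |value R (x + y) - (value R x + value R y)| ≤ 2 * ε := by
    intro ε hε
    obtain ⟨u, v, hv, h1, h2, h3⟩ := h.exists_approx htot x hε
    obtain ⟨u', v', hv', h1', h2', h3'⟩ := h.exists_approx htot y hε
    have hvR : (0 : ℝ) < v := by exact_mod_cast hv
    have hvR' : (0 : ℝ) < v' := by exact_mod_cast hv'
    have a1 := h.le_value hv h1
    have a2 := value_le (u := u + 1) hv (by push_cast; exact h2)
    have b1 := h.le_value hv' h1'
    have b2 := value_le (u := u' + 1) hv' (by push_cast; exact h2')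
    have c1 : ((v' * u + v * u' : ℕ) : ℝ) / (v * v' : ℕ) ≤ value R (x + y) := by
      refine h.le_value (Nat.mul_pos hv hv') ?_
      have e : ((v * v' : ℕ) : S) * (x + y) = v' * (v * x) + v * (v' * y) := by push_cast; ring
      rw [e]; push_cast
      exact h.add (h.mul_left _ h1) (h.mul_left _ h1')
    have c2 : value R (x + y) ≤ ((v' * (u + 1) + v * (u' + 1) : ℕ) : ℝ) / (v * v' : ℕ) := by
      refine value_le (Nat.mul_pos hv hv') ?_
      have e : ((v * v' : ℕ) : S) * (x + y) = v' * (v * x) + v * (v' * y) := by push_cast; ring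
      rw [e]; push_cast
      exact h.add (h.mul_left _ h2) (h.mul_left _ h2')
    have e1 : ((v' * u + v * u' : ℕ) : ℝ) / (v * v' : ℕ) = u / v + u' / v' := by
      push_cast; field_simp
    have e2 : ((v' * (u + 1) + v * (u' + 1) : ℕ) : ℝ) / (v * v' : ℕ)
        = u / v + u' / v' + 1 / v + 1 / v' := by
      push_cast; field_simp; ring
    push_cast at a2 b2
    rw [e1] at c1
    rw [e2] at c2
    rw [add_div] at a2 b2
    rw [abs_le]
    constructor <;> linarith
  refine sub_eq_zero.mp (abs_nonpos_iff.mp (le_of_forall_pos_le_add fun ε hε => ?_))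
  have := key (ε / 2) (by positivity)
  linarith

theorem value_mul (htot : ∀ a b, R a b ∨ R b a) (x y : S) :
    value R (x * y) = value R x * value R y := by
  set p := value R x with hp
  set q := value R y with hq
  have hp0 : 0 ≤ p := h.value_nonneg x
  have hq0 : 0 ≤ q := h.value_nonneg y
  have key : ∀ ε : ℝ, 0 < ε → ε ≤ 1 → |value R (x * y) - p * q| ≤ (p + q + 2) * ε := by
    intro ε hε hε1
    obtain ⟨u, v, hv, h1, h2, h3⟩ := h.exists_approx htot x hε
    obtain ⟨u', v', hv', h1', h2', h3'⟩ := h.exists_approx htot y hε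
    have hvR : (0 : ℝ) < v := by exact_mod_cast hv
    have hvR' : (0 : ℝ) < v' := by exact_mod_cast hv'
    have a1 := h.le_value hv h1
    have a2 := value_le (u := u + 1) hv (by push_cast; exact h2)
    have b1 := h.le_value hv' h1'
    have b2 := value_le (u := u' + 1) hv' (by push_cast; exact h2')
    have e : ((v * v' : ℕ) : S) * (x * y) = (v * x) * (v' * y) := by push_cast; ring
    have c1 : ((u * u' : ℕ) : ℝ) / (v * v' : ℕ) ≤ value R (x * y) := by
      refine h.le_value (Nat.mul_pos hv hv') ?_
      rw [e]; push_cast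
      exact h.mul h1 h1'
    have c2 : value R (x * y) ≤ (((u + 1) * (u' + 1) : ℕ) : ℝ) / (v * v' : ℕ) := by
      refine value_le (Nat.mul_pos hv hv') ?_
      rw [e]; push_cast
      exact h.mul h2 h2'
    have e1 : ((u * u' : ℕ) : ℝ) / (v * v' : ℕ) = (u / v) * (u' / v') := by
      push_cast; field_simp
    have e2 : (((u + 1) * (u' + 1) : ℕ) : ℝ) / (v * v' : ℕ)
        = (u / v + 1 / v) * (u' / v' + 1 / v') := by
      push_cast; field_simp
    push_cast at a2 b2
    rw [e1] at c1
    rw [e2] at c2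
    rw [add_div] at a2 b2
    have p1 : p - ε ≤ u / v := by linarith
    have p2 : (u : ℝ) / v + 1 / v ≤ p + ε := by linarith
    have q1 : q - ε ≤ u' / v' := by linarith
    have q2 : (u' : ℝ) / v' + 1 / v' ≤ q + ε := by linarith
    have hu0 : (0 : ℝ) ≤ u / v := by positivity
    have hu0' : (0 : ℝ) ≤ u' / v' := by positivity
    have up : (u / v + 1 / v : ℝ) * (u' / v' + 1 / v') ≤ (p + ε) * (q + ε) :=
      mul_le_mul p2 q2 (by positivity) (by positivity)
    -- Multiplying the lower bounds p - ε and q - ε is legitimate only if both are nonnegative;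
    -- otherwise p·q is itself at most (p + q)·ε.
    have lo : p * q - (p + q) * ε ≤ (u / v : ℝ) * (u' / v') := by
      by_cases hpe : p ≤ ε
      · have : p * q ≤ ε * q := mul_le_mul_of_nonneg_right hpe hq0
        nlinarith [mul_nonneg hu0 hu0', mul_nonneg hp0 hε.le]
      · by_cases hqe : q ≤ ε
        · have : p * q ≤ p * ε := mul_le_mul_of_nonneg_left hqe hp0
          nlinarith [mul_nonneg hu0 hu0', mul_nonneg hq0 hε.le]
        · push Not at hpe hqe
          have := mul_le_mul p1 q1 (by linarith) hu0
          nlinarith [sq_nonneg ε]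
    have hε2 : ε * ε ≤ ε := by nlinarith
    rw [abs_le]
    constructor
    · nlinarith
    · nlinarith
  refine sub_eq_zero.mp (abs_nonpos_iff.mp (le_of_forall_pos_le_add fun ε hε => ?_))
  have hpos : 0 < p + q + 2 := by linarith
  have := key (min 1 (ε / (p + q + 2))) (lt_min one_pos (by positivity)) (min_le_left _ _)
  refine this.trans ?_
  rw [zero_add]
  calc (p + q + 2) * min 1 (ε / (p + q + 2)) ≤ (p + q + 2) * (ε / (p + q + 2)) :=
        mul_le_mul_of_nonneg_left (min_le_right _ _) hpos.le
    _ = ε := by field_simp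

/-- The monotone homomorphism of a total Strassen preorder. -/
def toHom (htot : ∀ a b, R a b ∨ R b a) : S →+* ℝ≥0 where
  toFun x := ⟨value R x, h.value_nonneg x⟩
  map_one' := NNReal.eq (by
    show value R 1 = 1
    simpa using h.value_natCast 1)
  map_zero' := NNReal.eq (by
    show value R 0 = 0
    simpa using h.value_natCast 0)
  map_add' x y := by ext; exact h.value_add htot x y
  map_mul' x y := by ext; exact h.value_mul htot x y

/-- If no monotone homomorphism separates `b` from `a`, then `a ≤ b` asymptotically, up to a
factor of `4` in each power. -/
theorem pow_le_of_forall_hom {a b : S} (hb : b ≠ 0)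
    (hf : ∀ f : S →+* ℝ≥0, (∀ x y, R x y → f x ≤ f y) → f a ≤ f b) :
    ∃ C : ℕ, ∀ n : ℕ, R (a ^ n) (C * 4 ^ n * b ^ n) := by
  -- If 2b ≤ a could be forced, a maximal extension would yield a monotone homomorphism f with 2f(b)
  -- ≤ f(a) ≤ f(b). This is impossible because 1 ≤ M·b makes f(b) positive; the factor 2 supplies
  -- the strictness.
  have h1 : ¬ ∀ (m : ℕ) (s : S), ¬ R (m + 1 + s * a) (m + s * (2 * b)) := by
    intro hno
    obtain ⟨Q, hQ, hmax⟩ := (h.extend hno).exists_maximal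
    have htot := total_of_maximal hmax
    have hq : IsStrassen Q := hmax.1
    have hRQ : ∀ x y, R x y → Q x y := fun x y hxy => hQ _ _ ⟨0, by simpa using hxy⟩
    have h2 := hf (hq.toHom htot) (fun x y hxy => hq.value_mono (hRQ x y hxy))
    have h3 : Q (2 * b) a :=
      hQ _ _ ⟨1, by rw [one_mul, one_mul, add_comm]; exact h.refl _⟩
    have h4 : hq.toHom htot (2 * b) ≤ hq.toHom htot a := hq.value_mono h3
    rw [map_mul, map_ofNat] at h4
    obtain ⟨M, hM⟩ := hq.one_le b hb
    have h5 : hq.toHom htot 1 ≤ hq.toHom htot (M * b) := hq.value_mono hM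
    rw [map_one, map_mul, map_natCast] at h5
    have h6 : 0 < hq.toHom htot b := by
      by_contra! h0
      rw [nonpos_iff_eq_zero.mp h0, mul_zero] at h5
      exact absurd h5 (by norm_num)
    have h7 := h4.trans h2
    have h8 : hq.toHom htot b < 2 * hq.toHom htot b := lt_mul_of_one_lt_left h6 (by norm_num)
    exact absurd h7 (not_le.mpr h8)
  push Not at h1
  obtain ⟨m, s, hs⟩ := h1
  have hs0 := h.ne_zero_of_succ_le hs
  have h2 : R (m + s * a) (m + s * (2 * b)) := by
    refine h.trans ?_ hs
    have e : (m : S) + 1 + s * a = m + s * a + 1 := by ring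
    rw [e]
    exact h.le_add_right _ _
  have h3 : ∀ N : ℕ, R (m + N * (s * a)) (m + N * (s * (2 * b))) := by
    intro N
    induction N with
    | zero => simpa using h.refl _
    | succ N ih =>
      have e1 : (m : S) + (N + 1 : ℕ) * (s * a) = m + N * (s * a) + s * a := by push_cast; ring
      have e2 : (m : S) + N * (s * (2 * b)) + s * a = m + s * a + N * (s * (2 * b)) := by ring
      have e3 : (m : S) + (N + 1 : ℕ) * (s * (2 * b))
          = m + s * (2 * b) + N * (s * (2 * b)) := by push_cast; ring
      have h4 := h.add_right (s * a) ih
      rw [e2] at h4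
      rw [e1, e3]
      exact h.trans h4 (h.add_right _ h2)
  obtain ⟨p, hp⟩ := h.one_le s hs0
  obtain ⟨q, hq⟩ := h.one_le b hb
  set K : ℕ := m * p * q + 1 with hK
  -- After K iterations the additive constant m is dominated by the main term, which costs a second
  -- factor 2 and turns 2b into 4b. The summand 1 in `K` keeps K·s nonzero even when m = 0, as is
  -- needed to remove the common factor K·s.
  have h4 : R m (K * (s * (2 * b))) := by
    have h5 : R (1 * 1) (p * s * (q * b)) := h.mul hp hq
    have h6 := h.mul_left (m : S) h5
    rw [mul_one, mul_one] at h6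
    refine h.trans h6 ?_
    have e : (K : S) * (s * (2 * b))
        = m * (p * s * (q * b)) + (m * (p * s * (q * b)) + 2 * (s * b)) := by
      rw [hK]; push_cast; ring
    rw [e]
    exact h.le_add_right _ _
  have h5 : R (K * s * a) (K * s * (4 * b)) := by
    have h6 := h.trans (h.le_add_left (K * (s * a)) m) (h.trans (h3 K) (h.add_right _ h4))
    have e1 : (K : S) * s * a = K * (s * a) := by ring
    have e2 : (K : S) * s * (4 * b) = K * (s * (2 * b)) + K * (s * (2 * b)) := by ring
    rw [e1, e2]
    exact h6
  have hKs : (K : S) * s ≠ 0 := by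
    intro h0
    have h6 : R ((1 : ℕ) : S) ((0 : ℕ) : S) := by
      rw [Nat.cast_one, Nat.cast_zero]
      refine h.trans hp (h.trans (h.le_add_right _ (p * (m * p * q) * s)) ?_)
      have e : (p : S) * s + p * (m * p * q) * s = p * (K * s) := by rw [hK]; push_cast; ring
      rw [e, h0, mul_zero]
      exact h.refl 0
    exact absurd (h.nat_le h6) (by norm_num)
  obtain ⟨C, hC⟩ := h.pow_le_of_mul_le hKs h5
  refine ⟨C, fun n => ?_⟩
  have := hC n
  rwa [mul_pow, ← mul_assoc] at this

end IsStrassen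

namespace LOCC

variable {k : ℕ}

/-! ### Norms and contractions -/

/-- The squared Euclidean norm. -/
def nsq {α : Type} [Fintype α] (v : α → ℂ) : ℝ := ∑ x, ‖v x‖ ^ 2

section Contractions

variable {α β γ δ : Type} [Fintype α] [Fintype β] [Fintype γ] [Fintype δ]

theorem nsq_nonneg (v : α → ℂ) : 0 ≤ nsq v := Finset.sum_nonneg fun _ _ => by positivity

theorem nsq_smul (c : ℂ) (v : α → ℂ) : nsq (c • v) = ‖c‖ ^ 2 * nsq v := by
  simp [nsq, mul_pow, Finset.mul_sum]

theorem nsq_eq_zero {v : α → ℂ} (h : nsq v = 0) : v = 0 := by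
  funext x
  have := (Finset.sum_eq_zero_iff_of_nonneg fun x _ => by positivity).mp h x (Finset.mem_univ x)
  simpa using this

theorem star_dotProduct_self (v : α → ℂ) : star v ⬝ᵥ v = (nsq v : ℂ) := by
  simp only [nsq, dotProduct, Pi.star_apply, RCLike.star_def, Complex.ofReal_sum]
  refine Finset.sum_congr rfl fun x _ => ?_
  rw [Complex.conj_mul']
  push_cast
  rfl

theorem nsq_mulVec (K : Matrix β α ℂ) (v : α → ℂ) :
    ((nsq (K *ᵥ v) : ℝ) : ℂ) = star v ⬝ᵥ ((Kᴴ * K) *ᵥ v) := by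
  rw [← star_dotProduct_self, Matrix.star_mulVec, ← Matrix.dotProduct_mulVec,
    Matrix.mulVec_mulVec]

theorem nsq_comp_equiv (e : α ≃ β) (v : β → ℂ) : nsq (v ∘ e) = nsq v :=
  Equiv.sum_comp e fun x => ‖v x‖ ^ 2

theorem nsq_sum (v : α ⊕ β → ℂ) : nsq v = nsq (v ∘ Sum.inl) + nsq (v ∘ Sum.inr) := by
  simp [nsq]

theorem nsq_prod (v : α × β → ℂ) : nsq v = ∑ b, nsq (fun a => v (a, b)) := by
  simp only [nsq]
  rw [Fintype.sum_prod_type, Finset.sum_comm]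

/-- Kraus operators with `∑ j, K_j* K_j ≤ I`. -/
def IsKraus {J : Type} [Fintype J] (K : J → Matrix β α ℂ) : Prop :=
  ∀ v, ∑ j, nsq (K j *ᵥ v) ≤ nsq v

/-- Operators of norm at most one. -/
def IsContr (K : Matrix β α ℂ) : Prop := ∀ v, nsq (K *ᵥ v) ≤ nsq v

theorem isKraus_unit {K : Matrix β α ℂ} : IsKraus (fun _ : Unit => K) ↔ IsContr K := by
  simp [IsKraus, IsContr]

theorem IsKraus.posSemidef [DecidableEq α] {J : Type} [Fintype J] {K : J → Matrix β α ℂ}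
    (h : IsKraus K) :
    (1 - ∑ j, (K j)ᴴ * K j).PosSemidef := by
  refine Matrix.PosSemidef.of_dotProduct_mulVec_nonneg ?_ fun v => ?_
  · simp only [Matrix.IsHermitian, Matrix.conjTranspose_sub, Matrix.conjTranspose_one,
      Matrix.conjTranspose_sum, Matrix.conjTranspose_mul, Matrix.conjTranspose_conjTranspose]
  · rw [Matrix.sub_mulVec, Matrix.one_mulVec, dotProduct_sub, Matrix.sum_mulVec, dotProduct_sum,
      star_dotProduct_self]
    simp only [← nsq_mulVec]
    rw [← Complex.ofReal_sum, ← Complex.ofReal_sub]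
    exact_mod_cast sub_nonneg.mpr (h v)

theorem isKraus_of_posSemidef [DecidableEq α] {J : Type} [Fintype J] {K : J → Matrix β α ℂ}
    (h : (1 - ∑ j, (K j)ᴴ * K j).PosSemidef) : IsKraus K := by
  intro v
  have h1 := h.dotProduct_mulVec_nonneg v
  rw [Matrix.sub_mulVec, Matrix.one_mulVec, dotProduct_sub, Matrix.sum_mulVec, dotProduct_sum,
      star_dotProduct_self] at h1
  simp only [← nsq_mulVec] at h1
  rw [← Complex.ofReal_sum, ← Complex.ofReal_sub] at h1
  exact sub_nonneg.mp (by exact_mod_cast h1)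

theorem IsContr.mul {K : Matrix γ β ℂ} {L : Matrix β α ℂ} (hK : IsContr K) (hL : IsContr L) :
    IsContr (K * L) := fun v => by
  rw [← Matrix.mulVec_mulVec]
  exact (hK _).trans (hL v)

theorem IsContr.smul {K : Matrix β α ℂ} (hK : IsContr K) {c : ℂ} (hc : ‖c‖ ≤ 1) :
    IsContr (c • K) := fun v => by
  rw [Matrix.smul_mulVec, nsq_smul]
  have : ‖c‖ ^ 2 ≤ 1 := pow_le_one₀ (norm_nonneg _) hc
  nlinarith [hK v, nsq_nonneg (K *ᵥ v)]

theorem isContr_one [DecidableEq α] : IsContr (1 : Matrix α α ℂ) := fun v => by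
  rw [Matrix.one_mulVec]

theorem isContr_zero : IsContr (0 : Matrix β α ℂ) := fun v => by
  rw [Matrix.zero_mulVec]
  simpa [nsq] using nsq_nonneg v

theorem isContr_of_isometry [DecidableEq α] {K : Matrix β α ℂ} (h : Kᴴ * K = 1) :
    IsContr K := fun v => by
  have := nsq_mulVec K v
  rw [h, Matrix.one_mulVec, star_dotProduct_self] at this
  exact (Complex.ofReal_injective this).le

theorem isContr_emb {e : α → β} (he : Function.Injective e) : IsContr (emb e) := by
  classical
  exact isContr_of_isometry (emb_isometry he)

theorem emb_conjTranspose_mulVec (e : α → β) (v : β → ℂ) : (emb e)ᴴ *ᵥ v = v ∘ e := by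
  classical
  ext x
  simp [emb, Matrix.mulVec, dotProduct, Matrix.conjTranspose_apply]

theorem isContr_emb_conjTranspose {e : α → β} (he : Function.Injective e) :
    IsContr (emb e)ᴴ := fun v => by
  classical
  rw [emb_conjTranspose_mulVec]
  simp only [nsq, Function.comp_apply]
  rw [← Finset.sum_image (f := fun y => ‖v y‖ ^ 2) (g := e) (s := Finset.univ)
    (fun a _ b _ hab => he hab)]
  exact Finset.sum_le_sum_of_subset_of_nonneg (Finset.subset_univ _)
    fun _ _ _ => by positivity

/-- With P = U*U a projection, the loss |v|² - |Uv|² equals |(1 - P)v|². -/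
theorem IsPartialIsometry.isContr {U : Matrix β α ℂ} (h : IsPartialIsometry U) :
    IsContr U := fun v => by
  classical
  have hP : (1 - Uᴴ * U)ᴴ * (1 - Uᴴ * U) = 1 - Uᴴ * U := by
    rw [Matrix.conjTranspose_sub, Matrix.conjTranspose_one, Matrix.conjTranspose_mul,
      Matrix.conjTranspose_conjTranspose, Matrix.sub_mul, Matrix.mul_sub, Matrix.mul_sub,
      Matrix.one_mul, Matrix.mul_one, Matrix.one_mul]
    have h2 : Uᴴ * U * (Uᴴ * U) = Uᴴ * U := by
      simp only [Matrix.mul_assoc]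
      rw [show U * (Uᴴ * U) = U by rw [← Matrix.mul_assoc]; exact h]
    rw [h2, sub_self, sub_zero]
  have h1 := nsq_mulVec (1 - Uᴴ * U) v
  have e : star v ⬝ᵥ ((1 - Uᴴ * U) *ᵥ v) = ((nsq v - nsq (U *ᵥ v) : ℝ) : ℂ) := by
    rw [Matrix.sub_mulVec, Matrix.one_mulVec, dotProduct_sub, star_dotProduct_self,
      ← nsq_mulVec, ← Complex.ofReal_sub]
  rw [hP, e] at h1
  have h2 := Complex.ofReal_injective h1
  have := nsq_nonneg ((1 - Uᴴ * U) *ᵥ v)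
  linarith

theorem IsPartialIsometry.conjTranspose {U : Matrix β α ℂ} (h : IsPartialIsometry U) :
    IsPartialIsometry Uᴴ := by
  have := congrArg Matrix.conjTranspose h
  unfold IsPartialIsometry
  simpa [Matrix.mul_assoc] using this

theorem fromBlocks_mulVec_diag (K : Matrix β α ℂ) (L : Matrix δ γ ℂ) (v : α ⊕ γ → ℂ) :
    nsq (Matrix.fromBlocks K 0 0 L *ᵥ v) =
      nsq (K *ᵥ (v ∘ Sum.inl)) + nsq (L *ᵥ (v ∘ Sum.inr)) := by
  rw [Matrix.fromBlocks_mulVec, nsq_sum]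
  simp only [Matrix.zero_mulVec, add_zero, zero_add, Sum.elim_comp_inl, Sum.elim_comp_inr]

theorem IsKraus.fromBlocks {J : Type} [Fintype J] {K : J → Matrix β α ℂ}
    {L : J → Matrix δ γ ℂ} (hK : IsKraus K) (hL : IsKraus L) :
    IsKraus (fun j => Matrix.fromBlocks (K j) 0 0 (L j)) := fun v => by
  simp only [fromBlocks_mulVec_diag, Finset.sum_add_distrib]
  rw [nsq_sum v]
  exact add_le_add (hK _) (hL _)

theorem IsContr.fromBlocks {K : Matrix β α ℂ} {L : Matrix δ γ ℂ} (hK : IsContr K)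
    (hL : IsContr L) : IsContr (Matrix.fromBlocks K 0 0 L) := by
  rw [← isKraus_unit] at *
  exact hK.fromBlocks hL

theorem kronecker_one_mulVec [DecidableEq γ] (K : Matrix β α ℂ) (v : α × γ → ℂ) (y : β) (c : γ) :
    ((K ⊗ₖ (1 : Matrix γ γ ℂ)) *ᵥ v) (y, c) = (K *ᵥ fun a => v (a, c)) y := by
  simp [Matrix.mulVec, dotProduct, Fintype.sum_prod_type, Matrix.one_apply]

theorem IsKraus.kronecker_one [DecidableEq γ] {J : Type} [Fintype J] {K : J → Matrix β α ℂ}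
    (hK : IsKraus K) : IsKraus (fun j => K j ⊗ₖ (1 : Matrix γ γ ℂ)) := fun v => by
  simp only [nsq_prod]
  rw [Finset.sum_comm]
  refine Finset.sum_le_sum fun c _ => ?_
  have := hK (fun a => v (a, c))
  simpa only [kronecker_one_mulVec] using this

theorem IsContr.kronecker_one [DecidableEq γ] {K : Matrix β α ℂ}
    (hK : IsContr K) : IsContr (K ⊗ₖ (1 : Matrix γ γ ℂ)) := by
  rw [← isKraus_unit] at *
  exact hK.kronecker_one

end Contractions

/-! ### Product operators -/

section Products

variable {ι κ μ ν : Fin k → Type} [∀ i, Fintype (ι i)] [∀ i, Fintype (κ i)]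
  [∀ i, Fintype (μ i)] [∀ i, Fintype (ν i)]

/-- The factors of the operator acting as `K` on the system of party `i`. -/
def site (i : Fin k) (K : Matrix (ι i) (ι i) ℂ) : ∀ j, Matrix (ι j) (ι j) ℂ :=
  Function.update (fun _ => emb fun x => x) i K

theorem site_same (i : Fin k) (K : Matrix (ι i) (ι i) ℂ) : site i K i = K :=
  Function.update_self ..

theorem site_of_ne {i j : Fin k} (h : j ≠ i) (K : Matrix (ι i) (ι i) ℂ) :
    site i K j = emb fun x => x := Function.update_of_ne h ..

theorem prodOp_mulVec_mulVec (U : ∀ i, Matrix (μ i) (κ i) ℂ) (V : ∀ i, Matrix (κ i) (ι i) ℂ)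
    (v : (∀ i, ι i) → ℂ) :
    prodOp U *ᵥ (prodOp V *ᵥ v) = prodOp (fun i => U i * V i) *ᵥ v := by
  rw [Matrix.mulVec_mulVec, prodOp_mul]

theorem prodOp_emb_id_mulVec (v : (∀ i, ι i) → ℂ) :
    prodOp (fun i => emb fun x : ι i => x) *ᵥ v = v := by
  classical
  simp only [emb_id]
  rw [prodOp_one, Matrix.one_mulVec]

theorem prodOp_site_apply (i : Fin k) (K : Matrix (ι i) (ι i) ℂ) (v : (∀ i, ι i) → ℂ)
    (x : ∀ i, ι i) :
    (prodOp (site i K) *ᵥ v) x = ∑ t, K (x i) t * v (Function.update x i t) := by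
  classical
  simp only [Matrix.mulVec, dotProduct]
  symm
  refine Fintype.sum_of_injective (fun t => Function.update x i t)
    (Function.update_injective x i) _ _ ?_ ?_
  · intro y hy
    have : ∃ j, j ≠ i ∧ y j ≠ x j := by
      by_contra! hcon
      refine hy ⟨y i, ?_⟩
      funext j
      by_cases hj : j = i
      · subst hj; simp
      · simp [hj, hcon j hj]
    obtain ⟨j, hj, hne⟩ := this
    rw [prodOp, Finset.prod_eq_zero (Finset.mem_univ j), zero_mul]
    rw [site_of_ne hj]
    simp [emb, Ne.symm hne]
  · intro t
    congr 1
    rw [prodOp, Finset.prod_eq_single i]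
    · simp [site_same]
    · intro j _ hj
      rw [site_of_ne hj]
      simp [emb, hj]
    · simp

/-- Product operators are compositions of operators acting on a single system. -/
theorem prodOp_site_induction (U : ∀ i, Matrix (ι i) (ι i) ℂ) {P : ((∀ i, ι i) → ℂ) → Prop}
    (hP : ∀ i v, P v → P (prodOp (site i (U i)) *ᵥ v)) {v : (∀ i, ι i) → ℂ} (hv : P v) :
    P (prodOp U *ᵥ v) := by
  classical
  have key : ∀ F : Finset (Fin k),
      P (prodOp (fun j => if j ∈ F then U j else emb fun x => x) *ᵥ v) := by
    intro F
    induction F using Finset.induction_on with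
    | empty => simpa [prodOp_emb_id_mulVec] using hv
    | insert i F hi ih =>
      have h1 := hP i _ ih
      rw [prodOp_mulVec_mulVec] at h1
      convert h1 using 3
      funext j
      by_cases hj : j = i
      · subst hj
        simp [hi, site_same, emb_id]
      · simp [hj, site_of_ne hj, emb_id]
  simpa using key Finset.univ

/-- Fixing the indices of the other parties cuts a vector into slices whose squared norms add, and
on each slice the operators act as the Kraus family `K`. -/
theorem nsq_prodOp_site {J : Type} [Fintype J] (i : Fin k) {K : J → Matrix (ι i) (ι i) ℂ}
    (hK : IsKraus K) (v : (∀ i, ι i) → ℂ) :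
    ∑ j, nsq (prodOp (site i (K j)) *ᵥ v) ≤ nsq v := by
  classical
  have split : ∀ u : (∀ i, ι i) → ℂ, nsq u =
      ∑ z : (∀ j : {j // j ≠ i}, ι j), nsq (fun t => u ((Equiv.piSplitAt i ι).symm (t, z))) := by
    intro u
    rw [← nsq_comp_equiv (Equiv.piSplitAt i ι).symm, nsq_prod]
    rfl
  simp only [split]
  rw [Finset.sum_comm]
  refine Finset.sum_le_sum fun z _ => ?_
  refine le_trans (le_of_eq (Finset.sum_congr rfl fun j _ => ?_)) (hK _)
  congr 1
  funext t
  rw [prodOp_site_apply]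
  simp only [Matrix.mulVec, dotProduct]
  refine Finset.sum_congr rfl fun s _ => ?_
  congr 2
  · simp [Equiv.piSplitAt]
  · funext j
    by_cases hj : j = i
    · subst hj; simp [Equiv.piSplitAt]
    · simp [Equiv.piSplitAt, hj]

theorem IsContr.nsq_prodOp_site {i : Fin k} {K : Matrix (ι i) (ι i) ℂ} (hK : IsContr K)
    (v : (∀ i, ι i) → ℂ) : nsq (prodOp (site i K) *ᵥ v) ≤ nsq v := by
  have := LOCC.nsq_prodOp_site i (isKraus_unit.mpr hK) v
  simpa using this

/-- The operator on `H ⊕ H'` mapping `H` to `H'` by `U`. -/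
def shift {α β : Type} (U : Matrix β α ℂ) : Matrix (α ⊕ β) (α ⊕ β) ℂ :=
  Matrix.fromBlocks 0 0 U 0

theorem shift_mul_emb {α β : Type} [Fintype α] [Fintype β] (U : Matrix β α ℂ) :
    shift U * emb (Sum.inl : α → α ⊕ β) = emb (Sum.inr : β → α ⊕ β) * U := by
  classical
  ext (y | y) x <;> simp [shift, emb, Matrix.mul_apply]

theorem isContr_shift {α β : Type} [Fintype α] [Fintype β] {U : Matrix β α ℂ} (hU : IsContr U) :
    IsContr (shift U) := fun v => by
  rw [shift, Matrix.fromBlocks_mulVec, nsq_sum, nsq_sum v]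
  simp only [Matrix.zero_mulVec, add_zero, Sum.elim_comp_inl, Sum.elim_comp_inr]
  have := hU (v ∘ Sum.inl)
  have h0 : nsq (0 : α → ℂ) = 0 := by simp [nsq]
  rw [h0]
  linarith [nsq_nonneg (v ∘ Sum.inr)]

theorem prodOp_shift (U : ∀ i, Matrix (κ i) (ι i) ℂ) (v : (∀ i, ι i) → ℂ) :
    prodOp (fun i => shift (U i)) *ᵥ (prodOp (fun i => emb (Sum.inl : ι i → ι i ⊕ κ i)) *ᵥ v) =
      prodOp (fun i => emb (Sum.inr : κ i → ι i ⊕ κ i)) *ᵥ (prodOp U *ᵥ v) := by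
  rw [prodOp_mulVec_mulVec, prodOp_mulVec_mulVec]
  simp only [shift_mul_emb]

theorem prodOp_emb_apply {e : ∀ i, ι i → κ i} (he : ∀ i, Function.Injective (e i))
    (v : (∀ i, ι i) → ℂ) (x : ∀ i, ι i) :
    (prodOp (fun i => emb (e i)) *ᵥ v) (fun i => e i (x i)) = v x := by
  classical
  simp only [Matrix.mulVec, dotProduct, prodOp, emb]
  rw [Finset.sum_eq_single x]
  · simp
  · intro y _ hy
    obtain ⟨i, hi⟩ := Function.ne_iff.mp hy
    rw [Finset.prod_eq_zero (Finset.mem_univ i), zero_mul]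
    rw [if_neg]
    intro h
    exact hi (he i h).symm
  · simp

theorem prodOp_emb_apply_eq_zero {e : ∀ i, ι i → κ i} (v : (∀ i, ι i) → ℂ) {y : ∀ i, κ i}
    {i : Fin k} (hy : y i ∉ Set.range (e i)) :
    (prodOp (fun i => emb (e i)) *ᵥ v) y = 0 := by
  classical
  simp only [Matrix.mulVec, dotProduct, prodOp, emb]
  refine Finset.sum_eq_zero fun x _ => ?_
  rw [Finset.prod_eq_zero (Finset.mem_univ i), zero_mul]
  rw [if_neg]
  intro h
  exact hy ⟨x i, h.symm⟩

theorem nsq_prodOp_emb {e : ∀ i, ι i → κ i} (he : ∀ i, Function.Injective (e i))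
    (v : (∀ i, ι i) → ℂ) : nsq (prodOp (fun i => emb (e i)) *ᵥ v) = nsq v := by
  classical
  unfold nsq
  symm
  refine Fintype.sum_of_injective (fun x i => e i (x i)) ?_ _ _ ?_ ?_
  · intro x y hxy
    funext i
    exact he i (congrFun hxy i)
  · intro y hy
    have : ∃ i, y i ∉ Set.range (e i) := by
      by_contra! hcon
      choose x hx using hcon
      exact hy ⟨x, funext hx⟩
    obtain ⟨i, hi⟩ := this
    rw [prodOp_emb_apply_eq_zero v hi]
    simp
  · intro x
    rw [prodOp_emb_apply he]

/-- `prodOp_site_induction` treats one party at a time on fixed local spaces. Operators that change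
the space are therefore realized by `shift` on the sum of the old and the new space. -/
theorem nsq_prodOp_le {U : ∀ i, Matrix (κ i) (ι i) ℂ} (hU : ∀ i, IsContr (U i))
    (v : (∀ i, ι i) → ℂ) : nsq (prodOp U *ᵥ v) ≤ nsq v := by
  rw [← nsq_prodOp_emb (e := fun i => (Sum.inr : κ i → ι i ⊕ κ i)) (fun i => Sum.inr_injective),
    ← prodOp_shift]
  refine prodOp_site_induction (fun i => shift (U i)) (P := fun x => nsq x ≤ nsq v) ?_ ?_
  · intro i x hx
    exact ((isContr_shift (hU i)).nsq_prodOp_site x).trans hx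
  · rw [nsq_prodOp_emb (fun i => Sum.inl_injective)]

theorem prodOp_conj_emb (e : ∀ i, ι i → κ i) (v : (∀ i, κ i) → ℂ) (x : ∀ i, ι i) :
    (prodOp (fun i => (emb (e i))ᴴ) *ᵥ v) x = v (fun i => e i (x i)) := by
  classical
  simp only [Matrix.mulVec, dotProduct, prodOp, emb, Matrix.conjTranspose_apply]
  rw [Finset.sum_eq_single (fun i => e i (x i))]
  · simp
  · intro y _ hy
    obtain ⟨i, hi⟩ := Function.ne_iff.mp hy
    rw [Finset.prod_eq_zero (Finset.mem_univ i), zero_mul]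
    rw [if_neg hi, star_zero]
  · simp

theorem prodOp_site_smul_one (i : Fin k) (c : ℂ) (v : (∀ i, ι i) → ℂ) :
    prodOp (site i (c • emb fun x => x)) *ᵥ v = c • v := by
  classical
  ext x
  rw [prodOp_site_apply]
  simp [emb_id, Matrix.one_apply]

/-- The tensor product of vectors, with systems grouped by party. -/
def tens (v : (∀ i, ι i) → ℂ) (w : (∀ i, κ i) → ℂ) : (∀ i, ι i × κ i) → ℂ :=
  fun x => v (fun i => (x i).1) * w (fun i => (x i).2)

theorem prodOp_tens (U : ∀ i, Matrix (μ i) (ι i) ℂ) (V : ∀ i, Matrix (ν i) (κ i) ℂ)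
    (v : (∀ i, ι i) → ℂ) (w : (∀ i, κ i) → ℂ) :
    prodOp (fun i => U i ⊗ₖ V i) *ᵥ tens v w = tens (prodOp U *ᵥ v) (prodOp V *ᵥ w) := by
  ext y
  simp only [Matrix.mulVec, dotProduct, tens, Finset.sum_mul_sum, ← Fintype.sum_prod_type']
  refine Fintype.sum_equiv
    { toFun := fun x => (fun i => (x i).1, fun i => (x i).2)
      invFun := fun p i => (p.1 i, p.2 i)
      left_inv := fun x => rfl
      right_inv := fun p => rfl } _ _ ?_
  intro x
  simp only [prodOp, Matrix.kroneckerMap_apply, Equiv.coe_fn_mk, Finset.prod_mul_distrib]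
  ring

theorem prodOp_site_kronecker_one [∀ i, DecidableEq (κ i)] (i : Fin k)
    (K : Matrix (ι i) (ι i) ℂ) (v : (∀ i, ι i) → ℂ) (w : (∀ i, κ i) → ℂ) :
    prodOp (site (ι := fun i => ι i × κ i) i (K ⊗ₖ (1 : Matrix (κ i) (κ i) ℂ))) *ᵥ tens v w =
      tens (prodOp (site i K) *ᵥ v) w := by
  classical
  have h : site (ι := fun i => ι i × κ i) i (K ⊗ₖ (1 : Matrix (κ i) (κ i) ℂ)) =
      fun j => site i K j ⊗ₖ (1 : Matrix (κ j) (κ j) ℂ) := by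
    funext j
    by_cases hj : j = i
    · subst hj; simp only [site_same]
    · simp only [site_of_ne hj, emb_id, Matrix.one_kronecker_one]
  rw [h, prodOp_tens, prodOp_one, Matrix.one_mulVec]

/-- The direct sum of vectors. -/
def ds (v : (∀ i, ι i) → ℂ) (w : (∀ i, κ i) → ℂ) : (∀ i, ι i ⊕ κ i) → ℂ :=
  prodOp (fun i => emb (Sum.inl : ι i → ι i ⊕ κ i)) *ᵥ v +
    prodOp (fun i => emb (Sum.inr : κ i → ι i ⊕ κ i)) *ᵥ w

theorem fromBlocks_mul_emb_inl {α β γ δ : Type} [Fintype α] [Fintype β] [Fintype γ] [Fintype δ]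
    (K : Matrix β α ℂ) (L : Matrix δ γ ℂ) :
    Matrix.fromBlocks K 0 0 L * emb (Sum.inl : α → α ⊕ γ) = emb (Sum.inl : β → β ⊕ δ) * K := by
  classical
  ext (y | y) x <;> simp [emb, Matrix.mul_apply]

theorem fromBlocks_mul_emb_inr {α β γ δ : Type} [Fintype α] [Fintype β] [Fintype γ] [Fintype δ]
    (K : Matrix β α ℂ) (L : Matrix δ γ ℂ) :
    Matrix.fromBlocks K 0 0 L * emb (Sum.inr : γ → α ⊕ γ) = emb (Sum.inr : δ → β ⊕ δ) * L := by
  classical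
  ext (y | y) x <;> simp [emb, Matrix.mul_apply]

theorem prodOp_ds (U : ∀ i, Matrix (μ i) (ι i) ℂ) (V : ∀ i, Matrix (ν i) (κ i) ℂ)
    (v : (∀ i, ι i) → ℂ) (w : (∀ i, κ i) → ℂ) :
    prodOp (fun i => Matrix.fromBlocks (U i) 0 0 (V i)) *ᵥ ds v w =
      ds (prodOp U *ᵥ v) (prodOp V *ᵥ w) := by
  simp only [ds, Matrix.mulVec_add, prodOp_mulVec_mulVec, fromBlocks_mul_emb_inl,
    fromBlocks_mul_emb_inr]

theorem prodOp_site_fromBlocks (i : Fin k) (K : Matrix (ι i) (ι i) ℂ) (c : ℂ)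
    (v : (∀ i, ι i) → ℂ) (w : (∀ i, κ i) → ℂ) :
    prodOp (site (ι := fun i => ι i ⊕ κ i) i
        (Matrix.fromBlocks K 0 0 (c • emb fun x => x))) *ᵥ ds v w =
      ds (prodOp (site i K) *ᵥ v) (c • w) := by
  classical
  have h : site (ι := fun i => ι i ⊕ κ i) i (Matrix.fromBlocks K 0 0 (c • emb fun x => x)) =
      fun j => Matrix.fromBlocks (site i K j) 0 0
        (site (ι := κ) i (c • emb fun x => x) j) := by
    funext j
    by_cases hj : j = i
    · subst hj; simp only [site_same]
    · simp only [site_of_ne hj, emb_id, Matrix.fromBlocks_one]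
  rw [h, prodOp_ds, prodOp_site_smul_one]

end Products
end LOCC

namespace LOCC

variable {k : ℕ}

/-! ### Protocol trees -/

section Trees

variable {ι κ μ : Fin k → Type} [∀ i, Fintype (ι i)] [∀ i, Fintype (κ i)] [∀ i, Fintype (μ i)]

/-- `Reach w p v`: some tree of local measurements applied to `v` ends in multiples of `w` of
total squared weight `p`. -/
inductive Reach (w : (∀ i, κ i) → ℂ) : ℝ → ((∀ i, ι i) → ℂ) → Prop
  | leaf (U : ∀ i, Matrix (κ i) (ι i) ℂ) (hU : ∀ i, IsContr (U i)) (c : ℂ) (v : (∀ i, ι i) → ℂ)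
      (h : prodOp U *ᵥ v = c • w) : Reach w (‖c‖ ^ 2) v
  | step (i : Fin k) (J : Type) [Fintype J] (K : J → Matrix (ι i) (ι i) ℂ) (hK : IsKraus K)
      (p : J → ℝ) (v : (∀ i, ι i) → ℂ)
      (h : ∀ j, Reach w (p j) (prodOp (site i (K j)) *ᵥ v)) : Reach w (∑ j, p j) v

variable {w : (∀ i, κ i) → ℂ} {p : ℝ} {v : (∀ i, ι i) → ℂ}

theorem Reach.nonneg (h : Reach w p v) : 0 ≤ p := by
  induction h with
  | leaf => positivity
  | step i J K hK p v h ih => exact Finset.sum_nonneg fun j _ => ih j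

theorem Reach.mul_nsq_le (h : Reach w p v) : p * nsq w ≤ nsq v := by
  induction h with
  | leaf U hU c v h =>
    rw [← nsq_smul, ← h]
    exact nsq_prodOp_le hU v
  | step i J K hK p v h ih =>
    rw [Finset.sum_mul]
    exact (Finset.sum_le_sum fun j _ => ih j).trans (nsq_prodOp_site i hK v)

theorem Reach.smul (h : Reach w p v) (s : ℂ) : Reach w (‖s‖ ^ 2 * p) (s • v) := by
  induction h with
  | leaf U hU c v h =>
    rw [← mul_pow, ← norm_mul]
    exact Reach.leaf U hU _ _ (by rw [Matrix.mulVec_smul, h, smul_smul])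
  | step i J K hK p v h ih =>
    rw [Finset.mul_sum]
    exact Reach.step i J K hK _ _ fun j => by rw [Matrix.mulVec_smul]; exact ih j

theorem Reach.postcomp (h : Reach w p v) {U : ∀ i, Matrix (μ i) (κ i) ℂ}
    (hU : ∀ i, IsContr (U i)) : Reach (prodOp U *ᵥ w) p v := by
  induction h with
  | leaf V hV c v h =>
    exact Reach.leaf (fun i => U i * V i) (fun i => (hU i).mul (hV i)) c v (by
      rw [← prodOp_mulVec_mulVec, h, Matrix.mulVec_smul])
  | step i J K hK p v h ih => exact Reach.step i J K hK _ _ ih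

theorem Reach.tens (h : Reach w p v) (u : (∀ i, μ i) → ℂ) :
    Reach (tens w u) p (tens v u) := by
  classical
  induction h with
  | leaf U hU c v h =>
    refine Reach.leaf (fun i => U i ⊗ₖ (1 : Matrix (μ i) (μ i) ℂ))
      (fun i => (hU i).kronecker_one) c _ ?_
    rw [prodOp_tens, h, prodOp_one, Matrix.one_mulVec]
    ext x
    simp [LOCC.tens, mul_assoc]
  | step i J K hK p v h ih =>
    refine Reach.step i J (fun j => K j ⊗ₖ (1 : Matrix (μ i) (μ i) ℂ)) hK.kronecker_one _ _
      fun j => ?_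
    rw [prodOp_site_kronecker_one]
    exact ih j

/-- The summand `u` has to pass coherently through a protocol meant for `v`. At a branching, the
acting party scales it by √(p_j/P), the share of the branch in the total weight, so that its
amplitude is always the square root of the weight still below the node and agrees with |c| at a
leaf. -/
theorem Reach.ds (hk : 1 ≤ k) (h : Reach w p v) (u : (∀ i, μ i) → ℂ) :
    Reach (ds w u) p (ds v (((Real.sqrt p : ℝ) : ℂ) • u)) := by
  classical
  induction h with
  | leaf U hU c v h =>
    let i₀ : Fin k := ⟨0, hk⟩
    -- At a leaf the moduli already agree; one party, `i₀`, applies the phase of c to the second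
    -- summand. This needs at least one party.
    obtain ⟨θ, hθ, hc⟩ : ∃ θ : ℂ, ‖θ‖ ≤ 1 ∧ θ * ((‖c‖ : ℝ) : ℂ) = c := by
      by_cases hc0 : c = 0
      · exact ⟨0, by simp, by simp [hc0]⟩
      · refine ⟨c / ((‖c‖ : ℝ) : ℂ), ?_, ?_⟩
        · simp [hc0]
        · exact div_mul_cancel₀ _ (by simpa using hc0)
    refine Reach.leaf (fun i => Matrix.fromBlocks (U i) 0 0
      (site (ι := μ) i₀ (θ • emb fun x => x) i)) (fun i => (hU i).fromBlocks ?_) c _ ?_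
    · by_cases hi : i = i₀
      · subst hi
        rw [site_same, emb_id]
        exact isContr_one.smul hθ
      · rw [site_of_ne hi, emb_id]
        exact isContr_one
    · rw [prodOp_ds, h, prodOp_site_smul_one, smul_smul, Real.sqrt_sq (norm_nonneg c), hc]
      simp only [LOCC.ds, Matrix.mulVec_smul, smul_add]
  | step i J K hK p v h ih =>
    have hp : ∀ j, 0 ≤ p j := fun j => (h j).nonneg
    set P := ∑ j, p j with hP
    have hP0 : 0 ≤ P := Finset.sum_nonneg fun j _ => hp j
    let L : J → Matrix (μ i) (μ i) ℂ :=
      fun j => ((Real.sqrt (p j / P) : ℝ) : ℂ) • emb fun x => x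
    have hL : IsKraus L := by
      intro x
      have : ∀ j, nsq (L j *ᵥ x) = p j / P * nsq x := by
        intro j
        simp only [L, emb_id, Matrix.smul_mulVec, Matrix.one_mulVec]
        rw [nsq_smul, Complex.norm_real, Real.norm_eq_abs, sq_abs, Real.sq_sqrt]
        exact div_nonneg (hp j) hP0
      simp only [this]
      rw [← Finset.sum_mul, ← Finset.sum_div, ← hP]
      -- An inequality suffices, and it also covers P = 0, where the quotient is 0 by convention.
      have h1 : P / P ≤ 1 := div_self_le_one P
      nlinarith [nsq_nonneg x]
    refine Reach.step i J (fun j => Matrix.fromBlocks (K j) 0 0 (L j)) (hK.fromBlocks hL) _ _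
      fun j => ?_
    simp only [L]
    rw [prodOp_site_fromBlocks, smul_smul, ← Complex.ofReal_mul,
      ← Real.sqrt_mul (div_nonneg (hp j) hP0)]
    have : p j / P * P = p j := by
      by_cases h0 : P = 0
      · rw [h0, mul_zero]
        exact ((Finset.sum_eq_zero_iff_of_nonneg fun j _ => hp j).mp (hP ▸ h0) j
          (Finset.mem_univ j)).symm
      · exact div_mul_cancel₀ _ h0
    rw [this]
    exact ih j

/-- Conversion of vectors by a protocol tree, possibly after a change of the local dimensions. -/
def Conv {α β : Fin k → Type} [∀ i, Fintype (α i)] [∀ i, Fintype (β i)]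
    (v : (∀ i, α i) → ℂ) (w : (∀ i, β i) → ℂ) : Prop :=
  ∃ (ι : Fin k → Type) (_ : ∀ i, Fintype (ι i)) (W : ∀ i, Matrix (ι i) (α i) ℂ),
    (∀ i, IsContr (W i)) ∧ Reach w 1 (prodOp W *ᵥ v)

end Trees

/-! ### Protocol trees and channels -/

theorem IsLOCC.trans {A B C : StateSpace k} {Λ : A.Op → B.Op} {Λ' : B.Op → C.Op}
    (h : IsLOCC Λ) (h' : IsLOCC Λ') : IsLOCC (fun ρ => Λ' (Λ ρ)) := by
  induction h' with
  | refl => exact h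
  | step _ h2 ih => exact IsLOCC.step ih h2

theorem IsOneStep.isLOCC {A B : StateSpace k} {Λ : A.Op → B.Op} (h : IsOneStep Λ) :
    IsLOCC Λ := IsLOCC.step IsLOCC.refl h

/-- The identification of basis vectors with equal labels. -/
def labelOp (m n : ℕ) : Matrix (Fin m) (Fin n) ℂ :=
  open Classical in fun y x => if (y : ℕ) = (x : ℕ) then 1 else 0

theorem labelOp_self (n : ℕ) : labelOp n n = emb fun x => x := by
  ext y x
  simp [labelOp, emb, Fin.ext_iff]

theorem labelOp_mul {m n : ℕ} {α : Type} (h : m = n) (K : Matrix (Fin n) α ℂ) :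
    labelOp m n * K = fun y x => K (Fin.cast h y) x := by
  subst h
  rw [labelOp_self, emb_id, Matrix.one_mul]
  rfl

theorem labelOp_mul_labelOp_mul {m n : ℕ} {α : Type} (h : n = m) (K : Matrix (Fin m) α ℂ) :
    labelOp m n * (labelOp n m * K) = K := by
  subst h
  simp [labelOp_self, emb_id]

theorem mul_labelOp_mul_labelOp {m n : ℕ} {α : Type} (h : n = m) (K : Matrix α (Fin m) ℂ) :
    K * labelOp m n * labelOp n m = K := by
  subst h
  simp [labelOp_self, emb_id]

theorem siteOp_eq {d d' : Fin k → ℕ} (i : Fin k) (K : Matrix (Fin (d' i)) (Fin (d i)) ℂ) :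
    siteOp i K = prodOp (Function.update (fun j => labelOp (d' j) (d j)) i K) := by
  classical
  ext y x
  simp only [siteOp, prodOp]
  split_ifs with h
  · rw [Finset.prod_eq_single i]
    · simp
    · intro j _ hj
      simp [hj, labelOp, h j hj]
    · simp
  · push Not at h
    obtain ⟨j, hj, hne⟩ := h
    rw [Finset.prod_eq_zero (Finset.mem_univ j)]
    simp [hj, labelOp, hne]

theorem siteOp_eq_site {d : Fin k → ℕ} (i : Fin k) (K : Matrix (Fin (d i)) (Fin (d i)) ℂ) :
    siteOp i K = prodOp (site i K) := by
  rw [siteOp_eq]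
  simp only [labelOp_self, site]

theorem mul_vecMulVec_mul {α β : Type} [Fintype α] [Fintype β] (A : Matrix β α ℂ) (v : α → ℂ) :
    A * vecMulVec v (star v) * Aᴴ = vecMulVec (A *ᵥ v) (star (A *ᵥ v)) := by
  rw [Matrix.mul_vecMulVec, Matrix.vecMulVec_mul, Matrix.star_mulVec]

theorem isKraus_subtype {α β J X : Type} [Fintype α] [Fintype β] [Fintype J] [DecidableEq α]
    [DecidableEq X] (f : J → X) (K : J → Matrix β α ℂ) (x : X) :
    (1 - ∑ j with f j = x, (K j)ᴴ * K j).PosSemidef ↔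
      IsKraus (fun j : {j // f j = x} => K j) := by
  have e : ∑ j with f j = x, (K j)ᴴ * K j = ∑ j : {j // f j = x}, (K j)ᴴ * K j :=
    Finset.sum_subtype _ (by simp) _
  rw [e]
  exact ⟨isKraus_of_posSemidef, IsKraus.posSemidef⟩

theorem isKraus_fiber_id {α β X : Type} [Fintype α] [Fintype β] [Fintype X]
    [DecidableEq X] (K : X → Matrix β α ℂ) (x : X) {_ : Fintype {j // j = x}} :
    IsKraus (fun j : {j // j = x} => K j) ↔ IsContr (K x) := by
  simp only [IsKraus, IsContr]
  refine forall_congr' fun v => ?_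
  have : ∑ j : {j // j = x}, nsq (K j *ᵥ v) = nsq (K x *ᵥ v) := by
    rw [Fintype.sum_eq_single ⟨x, rfl⟩]
    intro y hy
    exact absurd (Subtype.ext y.2) hy
  rw [this]

theorem isOneStep_of_kraus {d d' : Fin k → ℕ} {X Y : Type} [Fintype X] [Fintype Y]
    [DecidableEq X] [DecidableEq Y] (i : Fin k) {J : Type} [Fintype J] (f : J → X) (g : J → Y)
    (K : J → Matrix (Fin (d' i)) (Fin (d i)) ℂ) (hd : ∀ j, j ≠ i → d' j = d j)
    (hK : ∀ x, IsKraus (fun j : {j // f j = x} => K j)) :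
    IsOneStep (A := ⟨d, X⟩) (B := ⟨d', Y⟩)
      (fun ρ y => ∑ j with g j = y, siteOp i (K j) * ρ (f j) * (siteOp i (K j))ᴴ) := by
  classical
  refine ⟨i, J, inferInstance, f, g, K, hd, fun x => ?_, fun ρ y => ?_⟩
  · convert (isKraus_subtype f K x).mpr ?_
    convert hK x
  · refine Finset.sum_congr ?_ fun _ _ => rfl
    ext j
    simp

theorem isContr_labelOp {n m : ℕ} (h : m = n) : IsContr (labelOp m n) := by
  subst h
  rw [labelOp_self, emb_id]
  exact isContr_one

/-- Product contractions, applied to every block, are LOCC channels. -/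
theorem exists_isLOCC_prodOp {d d' : Fin k → ℕ} (X : Type) [Fintype X]
    (U : ∀ j, Matrix (Fin (d' j)) (Fin (d j)) ℂ) (hU : ∀ j, IsContr (U j)) :
    ∃ Λ : StateSpace.Op ⟨d, X⟩ → StateSpace.Op ⟨d', X⟩, IsLOCC Λ ∧
      ∀ ρ x, Λ ρ x = prodOp U * ρ x * (prodOp U)ᴴ := by
  classical
  -- A one-step channel changes a single local space, so the induction runs over the set `F` of
  -- parties at which `U` may differ from the identification of equal dimensions.
  suffices H : ∀ F : Finset (Fin k), ∀ (d' : Fin k → ℕ)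
      (U : ∀ j, Matrix (Fin (d' j)) (Fin (d j)) ℂ), (∀ j, IsContr (U j)) →
      (∀ j, j ∉ F → d' j = d j ∧ U j = labelOp (d' j) (d j)) →
      ∃ Λ : StateSpace.Op ⟨d, X⟩ → StateSpace.Op ⟨d', X⟩, IsLOCC Λ ∧
        ∀ ρ x, Λ ρ x = prodOp U * ρ x * (prodOp U)ᴴ from
    H Finset.univ d' U hU (by simp)
  intro F
  induction F using Finset.induction_on with
  | empty =>
    intro d' U hU h
    obtain rfl : d' = d := funext fun j => (h j (by simp)).1
    have hU1 : prodOp U = 1 := by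
      rw [← prodOp_one]
      congr 1
      funext j
      rw [(h j (by simp)).2, labelOp_self, emb_id]
    exact ⟨fun ρ => ρ, IsLOCC.refl, fun ρ x => by rw [hU1]; simp⟩
  | insert i F hi ih =>
    intro d' U hU h
    -- The intermediate spaces: party `i` still has its old space, every other party already has the
    -- new one. The operators `labelOp` transport along these equalities of dimensions.
    let d₁ : Fin k → ℕ := Function.update d' i (d i)
    have hd₁ : ∀ j, j ≠ i → d₁ j = d' j := fun j hj => Function.update_of_ne hj ..
    have hd₁i : d₁ i = d i := Function.update_self ..
    let U₁ : ∀ j, Matrix (Fin (d₁ j)) (Fin (d j)) ℂ := fun j =>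
      if hj : j = i then labelOp (d₁ j) (d j) else labelOp (d₁ j) (d' j) * U j
    have hU₁i : U₁ i = labelOp (d₁ i) (d i) := dif_pos rfl
    have hU₁ : ∀ j, j ≠ i → U₁ j = labelOp (d₁ j) (d' j) * U j := fun j hj => dif_neg hj
    obtain ⟨Λ, hΛ, hΛ'⟩ := ih d₁ U₁ (fun j => by
      by_cases hj : j = i
      · subst hj
        rw [hU₁i]
        exact isContr_labelOp hd₁i
      · rw [hU₁ j hj]
        exact (isContr_labelOp (hd₁ j hj)).mul (hU j)) (fun j hjF => by
      by_cases hj : j = i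
      · subst hj
        exact ⟨hd₁i, hU₁i⟩
      · obtain ⟨h1, h2⟩ := h j (by simp [hj, hjF])
        refine ⟨(hd₁ j hj).trans h1, ?_⟩
        rw [hU₁ j hj, h2, labelOp_mul (hd₁ j hj)]
        rfl)
    let K : Matrix (Fin (d' i)) (Fin (d₁ i)) ℂ := U i * labelOp (d i) (d₁ i)
    have hK : IsContr K := (hU i).mul (isContr_labelOp hd₁i.symm)
    have hprod : siteOp i K * prodOp U₁ = prodOp U := by
      rw [siteOp_eq, prodOp_mul]
      congr 1
      funext j
      by_cases hj : j = i
      · subst hj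
        rw [Function.update_self, hU₁i]
        exact mul_labelOp_mul_labelOp hd₁i (U j)
      · rw [Function.update_of_ne hj, hU₁ j hj]
        exact labelOp_mul_labelOp_mul (hd₁ j hj) (U j)
    refine ⟨_, hΛ.step (isOneStep_of_kraus (d := d₁) (d' := d') (X := X) (Y := X) i
      (J := X) (fun x => x) (fun x => x) (fun _ => K) (fun j hj => (hd₁ j hj).symm) ?_), ?_⟩
    · intro x v
      simpa using hK v
    · intro ρ x
      simp only [Finset.sum_filter, Finset.sum_ite_eq', Finset.mem_univ, if_true]
      rw [hΛ', ← hprod, Matrix.conjTranspose_mul]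
      simp only [Matrix.mul_assoc]

/-! ### Realization of a protocol tree by a channel -/

section TreeToChannel

variable {ι κ : Fin k → Type} [∀ i, Fintype (ι i)] [∀ i, Fintype (κ i)]

theorem IsKraus.sandwich {α β γ δ J : Type} [Fintype α] [Fintype β] [Fintype γ] [Fintype δ]
    [Fintype J] {K : J → Matrix γ β ℂ} (hK : IsKraus K) {A : Matrix δ γ ℂ} (hA : IsContr A)
    {B : Matrix β α ℂ} (hB : IsContr B) : IsKraus (fun j => A * K j * B) := fun v => by
  simp only [← Matrix.mulVec_mulVec]
  exact (Finset.sum_le_sum fun j _ => hA _).trans ((hK _).trans (hB v))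

theorem site_sandwich {n : Fin k → ℕ} {a : ∀ i, ι i → Fin (n i)}
    (ha : ∀ i, Function.Injective (a i)) (i : Fin k) (K : Matrix (ι i) (ι i) ℂ)
    (v : (∀ i, ι i) → ℂ) :
    prodOp (site i (emb (a i) * K * (emb (a i))ᴴ)) *ᵥ (prodOp (fun i => emb (a i)) *ᵥ v) =
      prodOp (fun i => emb (a i)) *ᵥ (prodOp (site i K) *ᵥ v) := by
  classical
  rw [prodOp_mulVec_mulVec, prodOp_mulVec_mulVec]
  congr 2
  funext j
  by_cases hj : j = i
  · subst hj
    simp only [site_same]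
    rw [Matrix.mul_assoc, emb_isometry (ha j), Matrix.mul_one]
  · simp only [site_of_ne hj, emb_id, Matrix.mul_one, Matrix.one_mul]

/-- A protocol tree is carried out by an LOCC channel on the block `x₀` of a register. -/
theorem Reach.exists_isLOCC {w : (∀ i, κ i) → ℂ} {p : ℝ} {v : (∀ i, ι i) → ℂ}
    (h : Reach w p v) {n : Fin k → ℕ} {a : ∀ i, ι i → Fin (n i)} {b : ∀ i, κ i → Fin (n i)}
    (ha : ∀ i, Function.Injective (a i)) (hb : ∀ i, Function.Injective (b i)) :
    ∀ (X : Type) [Fintype X] [DecidableEq X] (x₀ : X),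
      ∃ Λ : StateSpace.Op ⟨n, X⟩ → StateSpace.Op ⟨n, X⟩, IsLOCC Λ ∧
        ∀ ρ, ρ x₀ = vecMulVec (prodOp (fun i => emb (a i)) *ᵥ v)
            (star (prodOp (fun i => emb (a i)) *ᵥ v)) →
          Λ ρ = Function.update ρ x₀ ((p : ℂ) • vecMulVec (prodOp (fun i => emb (b i)) *ᵥ w)
            (star (prodOp (fun i => emb (b i)) *ᵥ w))) := by
  classical
  induction h with
  | leaf U hU c v h =>
    intro X _ _ x₀
    set av := prodOp (fun i => emb (a i)) *ᵥ v with hav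
    -- The leaf operator is applied one party at a time, conditioned on the register showing `x₀`;
    -- all other blocks undergo the identity.
    have key := prodOp_site_induction (ι := fun i => Fin (n i))
      (fun i => emb (b i) * U i * (emb (a i))ᴴ) (v := av)
      (P := fun u => ∃ Λ : StateSpace.Op ⟨n, X⟩ → StateSpace.Op ⟨n, X⟩, IsLOCC Λ ∧
        ∀ ρ, ρ x₀ = vecMulVec av (star av) →
          Λ ρ = Function.update ρ x₀ (vecMulVec u (star u))) ?_
      ⟨fun ρ => ρ, IsLOCC.refl, fun ρ hρ => by rw [← hρ, Function.update_eq_self]⟩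
    · obtain ⟨Λ, hΛ, hΛ'⟩ := key
      refine ⟨Λ, hΛ, fun ρ hρ => ?_⟩
      rw [hΛ' ρ hρ]
      congr 1
      have e : prodOp (fun i => emb (b i) * U i * (emb (a i))ᴴ) *ᵥ av =
          c • (prodOp (fun i => emb (b i)) *ᵥ w) := by
        rw [hav, prodOp_mulVec_mulVec, ← Matrix.mulVec_smul, ← h, prodOp_mulVec_mulVec]
        congr 2
        funext i
        rw [Matrix.mul_assoc, emb_isometry (ha i), Matrix.mul_one]
      rw [e, star_smul, Matrix.smul_vecMulVec, Matrix.vecMulVec_smul, smul_smul]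
      congr 1
      rw [RCLike.star_def, Complex.mul_conj']
      push_cast
      rfl
    · rintro i u ⟨Λ, hΛ, hΛ'⟩
      have hV : IsContr (emb (b i) * U i * (emb (a i))ᴴ) :=
        ((isContr_emb (hb i)).mul (hU i)).mul (isContr_emb_conjTranspose (ha i))
      refine ⟨_, hΛ.step (isOneStep_of_kraus (d := n) (d' := n) (X := X) (Y := X) i
        (J := X) (fun x => x) (fun x => x)
        (fun x => if x = x₀ then emb (b i) * U i * (emb (a i))ᴴ else emb fun x => x)
        (fun j hj => rfl) ?_), ?_⟩
      · intro x
        refine (isKraus_fiber_id (fun x => if x = x₀ then emb (b i) * U i * (emb (a i))ᴴ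
          else emb fun x => x) x).mpr ?_
        by_cases hx : x = x₀
        · simpa [hx] using hV
        · simpa [hx, emb_id] using isContr_one
      · intro ρ hρ
        rw [hΛ' ρ hρ]
        funext x
        simp only [Finset.sum_filter, Finset.sum_ite_eq', Finset.mem_univ, if_true]
        by_cases hx : x = x₀
        · subst hx
          simp only [if_true, Function.update_self]
          rw [mul_vecMulVec_mul, siteOp_eq_site]
        · simp only [hx, if_false, ne_eq, not_false_eq_true, Function.update_of_ne]
          have : siteOp (d := n) (d' := n) i (emb fun x => x) = 1 := by
            rw [siteOp_eq_site]
            simp only [site, Function.update_eq_self, emb_id]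
            exact prodOp_one
          rw [this]
          simp
  | step i J K hK p v h ih =>
    intro X _ _ x₀
    have hone : siteOp (d := n) (d' := n) i (emb fun x => x) = 1 := by
      rw [siteOp_eq_site]
      simp only [site, Function.update_eq_self, emb_id]
      exact prodOp_one
    set W := vecMulVec (prodOp (fun i => emb (b i)) *ᵥ w)
      (star (prodOp (fun i => emb (b i)) *ᵥ w)) with hW
    let V : J → Matrix (∀ i, Fin (n i)) (∀ i, Fin (n i)) ℂ := fun j =>
      vecMulVec (prodOp (fun i => emb (a i)) *ᵥ (prodOp (site i (K j)) *ᵥ v))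
        (star (prodOp (fun i => emb (a i)) *ᵥ (prodOp (site i (K j)) *ᵥ v)))
    -- With the outcomes of the measurement stored as new register values `Sum.inr j`, the subtrees
    -- are executed one after another, each touching its own block only; `F` is the set of those
    -- already done.
    have hseq : ∀ F : Finset J,
        ∃ Λ : StateSpace.Op ⟨n, X ⊕ J⟩ → StateSpace.Op ⟨n, X ⊕ J⟩, IsLOCC Λ ∧
          ∀ ρ, (∀ j, ρ (Sum.inr j) = V j) → Λ ρ = Sum.elim (fun x => ρ (Sum.inl x))
            (fun j => if j ∈ F then (p j : ℂ) • W else V j) := by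
      intro F
      induction F using Finset.induction_on with
      | empty =>
        refine ⟨fun ρ => ρ, IsLOCC.refl, fun ρ hρ => ?_⟩
        funext x
        rcases x with x | j
        · rfl
        · simpa using hρ j
      | insert j F hj ihF =>
        obtain ⟨Λ, hΛ, hΛ'⟩ := ihF
        obtain ⟨Λ₁, hΛ₁, hΛ₁'⟩ := ih j (X ⊕ J) (Sum.inr j)
        refine ⟨_, hΛ.trans hΛ₁, fun ρ hρ => ?_⟩
        simp only
        rw [hΛ₁' (Λ ρ) (by rw [hΛ' ρ hρ]; simp [hj, V]), hΛ' ρ hρ]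
        funext x
        rcases x with x | j'
        · simp
        · by_cases hjj : j' = j
          · subst hjj; simp
          · have : (Sum.inr j' : X ⊕ J) ≠ Sum.inr j := fun h => hjj (Sum.inr_injective h)
            rw [Function.update_of_ne this]
            simp [hjj]
    obtain ⟨Λ, hΛ, hΛ'⟩ := hseq Finset.univ
    -- The measurement: the block `x₀` is distributed over the values `Sum.inr j`, and each other
    -- block keeps its label. The Kraus operator from `x₀` to its own old label is 0, so the block
    -- is not counted twice.
    have h1 : IsOneStep (A := ⟨n, X⟩) (B := ⟨n, X ⊕ J⟩) _ :=
      isOneStep_of_kraus (d := n) (d' := n) (X := X) (Y := X ⊕ J) i (J := X ⊕ J)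
        (Sum.elim (fun x => x) (fun _ => x₀)) (fun x => x)
        (Sum.elim (fun x => if x = x₀ then 0 else emb fun x => x)
          (fun j => emb (a i) * K j * (emb (a i))ᴴ)) (fun j hj => rfl) ?_
    swap
    · intro x
      rw [← isKraus_subtype]
      by_cases hx : x = x₀
      · subst hx
        have hK' := (hK.sandwich (isContr_emb (ha i))
          (isContr_emb_conjTranspose (ha i))).posSemidef
        convert hK' using 2
        rw [Finset.sum_filter, Fintype.sum_sum_type]
        simp only [Sum.elim_inl, Sum.elim_inr, if_true]
        rw [Finset.sum_eq_zero, zero_add]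
        intro y _
        split_ifs <;> simp
      · have e : ∑ j with Sum.elim (fun x => x) (fun _ : J => x₀) j = x,
            (Sum.elim (fun x => if x = x₀ then 0 else emb fun x => x)
              (fun j => emb (a i) * K j * (emb (a i))ᴴ) j)ᴴ *
            (Sum.elim (fun x => if x = x₀ then 0 else emb fun x => x)
              (fun j => emb (a i) * K j * (emb (a i))ᴴ) j :
                Matrix (Fin (n i)) (Fin (n i)) ℂ) = 1 := by
          rw [Finset.sum_filter, Fintype.sum_sum_type]
          simp only [Sum.elim_inl, Sum.elim_inr]
          rw [Finset.sum_eq_single x]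
          · simp [hx, emb_id, Ne.symm hx]
          · intro y _ hy
            simp [hy]
          · simp
        rw [e, sub_self]
        exact Matrix.PosSemidef.zero
    -- Forgetting the outcome merges the blocks `Sum.inr j` into `x₀`; as all of them carry
    -- multiples of the same operator, their weights add.
    have h2 : IsOneStep (A := ⟨n, X ⊕ J⟩) (B := ⟨n, X⟩) _ :=
      isOneStep_of_kraus (d := n) (d' := n) (X := X ⊕ J) (Y := X) i (J := X ⊕ J)
        (fun x => x) (Sum.elim (fun x => x) (fun _ => x₀)) (fun _ => emb fun x => x)
        (fun j hj => rfl) ?_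
    swap
    · intro x u
      simp [emb_id]
    refine ⟨_, (h1.isLOCC.trans hΛ).trans h2.isLOCC, fun ρ hρ => ?_⟩
    simp only
    rw [hΛ']
    · simp only [hone, Matrix.one_mul, Matrix.conjTranspose_one, Matrix.mul_one]
      funext x
      rw [Finset.sum_filter, Fintype.sum_sum_type]
      simp only [Sum.elim_inl, Sum.elim_inr, Finset.mem_univ, if_true, Finset.sum_filter,
        Finset.sum_ite_eq']
      by_cases hx : x = x₀
      · subst hx
        rw [Function.update_self]
        have e0 : siteOp (d := n) (d' := n) i
            (0 : Matrix (Fin (n i)) (Fin (n i)) ℂ) = 0 := by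
          ext y x
          simp [siteOp]
        simp only [if_true]
        rw [e0]
        simp only [Matrix.zero_mul, zero_add, Complex.ofReal_sum, Finset.sum_smul]
      · rw [Function.update_of_ne hx]
        simp [hx, Ne.symm hx, hone]
    · intro j
      simp only [Finset.sum_filter, Finset.sum_ite_eq', Finset.mem_univ, if_true, Sum.elim_inr]
      rw [hρ, mul_vecMulVec_mul, siteOp_eq_site, site_sandwich ha]

end TreeToChannel
end LOCC

namespace LOCC

variable {k : ℕ}

/-! ### Equivalence of conversions by channels and by protocol trees -/

theorem Conv.converts {ψ φ : PureState k} (h : Conv ψ.vec φ.vec) : ψ.Converts φ := by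
  classical
  obtain ⟨ι, _, W, hW, hr⟩ := h
  -- Local spaces large enough to hold the working space of the tree and the target side by side, so
  -- that the channel of the tree runs in fixed dimensions.
  let n : Fin k → ℕ := fun i => Fintype.card (ι i) + φ.dim i
  let a : ∀ i, ι i → Fin (n i) := fun i x => Fin.castAdd _ (Fintype.equivFin (ι i) x)
  let b : ∀ i, Fin (φ.dim i) → Fin (n i) := fun i x => Fin.natAdd _ x
  have ha : ∀ i, Function.Injective (a i) := fun i =>
    (Fin.castAdd_injective _ _).comp (Fintype.equivFin (ι i)).injective
  have hb : ∀ i, Function.Injective (b i) := fun i => Fin.natAdd_injective _ _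
  obtain ⟨Λ₁, h1, h1'⟩ := exists_isLOCC_prodOp (d := ψ.dim) (d' := n) Unit
    (fun i => emb (a i) * W i) (fun i => (isContr_emb (ha i)).mul (hW i))
  obtain ⟨Λ₂, h2, h2'⟩ := hr.exists_isLOCC ha hb Unit ()
  obtain ⟨Λ₃, h3, h3'⟩ := exists_isLOCC_prodOp (d := n) (d' := φ.dim) Unit
    (fun i => (emb (b i))ᴴ) (fun i => isContr_emb_conjTranspose (hb i))
  refine ⟨_, (h1.trans h2).trans h3, ?_⟩
  funext x
  rw [h3', h2' _ (by
    rw [h1']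
    simp only [PureState.density]
    rw [mul_vecMulVec_mul, prodOp_mulVec_mulVec])]
  cases x
  simp only [Function.update_self, Complex.ofReal_one, one_smul]
  rw [mul_vecMulVec_mul, prodOp_mulVec_mulVec]
  simp only [emb_isometry (hb _), prodOp_one, Matrix.one_mulVec]
  rfl

/-! ### From channels to protocol trees -/

/-- Extension of a vector by zero to local dimensions `N`. -/
def zext {d : Fin k → ℕ} {N : ℕ} (h : ∀ i, d i ≤ N) (v : Vec d) : (Fin k → Fin N) → ℂ :=
  prodOp (fun i => emb (Fin.castLE (h i))) *ᵥ v

theorem castLE_mul_labelOp {a b N : ℕ} (hab : a = b) (ha : a ≤ N) (hb : b ≤ N) :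
    emb (Fin.castLE ha) * labelOp a b = emb (Fin.castLE hb) := by
  subst hab
  rw [labelOp_self, emb_id, Matrix.mul_one]

theorem zext_siteOp {d d' : Fin k → ℕ} {N : ℕ} (h : ∀ i, d i ≤ N) (h' : ∀ i, d' i ≤ N)
    (i : Fin k) (hd : ∀ j, j ≠ i → d' j = d j) (K : Matrix (Fin (d' i)) (Fin (d i)) ℂ)
    (v : Vec d) :
    zext h' (siteOp i K *ᵥ v) =
      prodOp (site (ι := fun _ => Fin N) i
        (emb (Fin.castLE (h' i)) * K * (emb (Fin.castLE (h i)))ᴴ)) *ᵥ zext h v := by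
  classical
  rw [zext, zext, siteOp_eq, prodOp_mulVec_mulVec, prodOp_mulVec_mulVec]
  congr 2
  funext j
  by_cases hj : j = i
  · subst hj
    rw [site_same, Function.update_self, Matrix.mul_assoc,
      emb_isometry (Fin.castLE_injective _), Matrix.mul_one]
  · rw [site_of_ne hj, Function.update_of_ne hj, castLE_mul_labelOp (hd j hj) (h' j) (h j),
      emb_id, Matrix.one_mul]

/-- The image of a pure state under an LOCC channel is a mixture of pure states that are the
leaves of a protocol tree. -/
theorem IsLOCC.exists_decomposition {A B : StateSpace k} {Λ : A.Op → B.Op} (h : IsLOCC Λ) :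
    ∃ N₀ : ℕ, ∀ N, N₀ ≤ N → ∀ (hA : ∀ i, A.dim i ≤ N) (hB : ∀ i, B.dim i ≤ N) (ρ : A.Op)
      (x : A.reg) (v : Vec A.dim), ρ x = vecMulVec v (star v) → (∀ y, y ≠ x → ρ y = 0) →
      ∃ (J : Type) (_ : Fintype J) (g : J → B.reg) (L : J → Vec B.dim),
        (∀ y, Λ ρ y = open Classical in
          ∑ j with g j = y, vecMulVec (L j) (star (L j))) ∧
        ∀ (κ : Fin k → Type) [∀ i, Fintype (κ i)] (w : (∀ i, κ i) → ℂ) (p : J → ℝ),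
          (∀ j, Reach w (p j) (zext hB (L j))) → Reach w (∑ j, p j) (zext hA v) := by
  classical
  induction h with
  | refl =>
    refine ⟨0, fun N _ hA hB ρ x v hx hy => ⟨Unit, inferInstance, fun _ => x, fun _ => v,
      fun y => ?_, fun κ _ w p h => by simpa using h ()⟩⟩
    by_cases hxy : y = x
    · subst hxy; simp [hx]
    · simp [hy y hxy, Ne.symm hxy]
  | step h1 h2 ih =>
    rename_i B C Λ Λ'
    obtain ⟨N₀, hN₀⟩ := ih
    obtain ⟨i, J', _, f, g', K, hd, hK, hΛ'⟩ := h2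
    -- A tree works in one fixed family of local spaces, whereas a channel may pass through larger
    -- ones. The threshold makes room for every intermediate space.
    refine ⟨max N₀ (Finset.univ.sup B.dim), fun N hN hA hC ρ x v hx hy => ?_⟩
    have hB : ∀ i, B.dim i ≤ N := fun i =>
      (Finset.le_sup (f := B.dim) (Finset.mem_univ i)).trans ((le_max_right _ _).trans hN)
    obtain ⟨J, _, g, L, hL1, hL2⟩ := hN₀ N ((le_max_left _ _).trans hN) hA hB ρ x v hx hy
    -- The new leaves are pairs of an old leaf and a Kraus operator that reads the register value of
    -- that leaf; in the tree, each old leaf grows one measurement node.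
    refine ⟨Σ j : J, {j' : J' // f j' = g j}, inferInstance, fun q => g' q.2,
      fun q => siteOp i (K q.2) *ᵥ L q.1, fun y => ?_, fun κ _ w p h => ?_⟩
    · simp only
      rw [hΛ', Finset.sum_filter, Finset.sum_filter, Fintype.sum_sigma]
      have e : ∀ j : J, (∑ j' : {j' : J' // f j' = g j}, if g' j' = y then
            vecMulVec (siteOp i (K j') *ᵥ L j) (star (siteOp i (K j') *ᵥ L j)) else 0) =
          ∑ j' : J', if f j' = g j then (if g' j' = y then
            vecMulVec (siteOp i (K j') *ᵥ L j) (star (siteOp i (K j') *ᵥ L j)) else 0)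
              else 0 := by
        intro j
        refine Eq.trans ?_ (Finset.sum_filter _ _)
        exact (Finset.sum_subtype (p := fun j' => f j' = g j) _ (fun j' => by simp)
          (fun j' => if g' j' = y then vecMulVec (siteOp i (K j') *ᵥ L j)
            (star (siteOp i (K j') *ᵥ L j)) else 0)).symm
      rw [Finset.sum_congr rfl fun j _ => e j, Finset.sum_comm]
      refine Finset.sum_congr rfl fun j' _ => ?_
      by_cases hy' : g' j' = y
      · simp only [hy', if_true]
        rw [hL1, Matrix.mul_sum, Matrix.sum_mul, Finset.sum_filter]
        refine Finset.sum_congr rfl fun j _ => ?_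
        by_cases hj : g j = f j'
        · simp only [hj, if_true]
          rw [mul_vecMulVec_mul]
        · rw [if_neg hj, if_neg (Ne.symm hj)]
      · simp [hy']
    · rw [Fintype.sum_sigma]
      refine hL2 κ w _ fun j => ?_
      refine Reach.step (ι := fun _ => Fin N) i _
        (fun j' : {j' : J' // f j' = g j} =>
          emb (Fin.castLE (hC i)) * K j' * (emb (Fin.castLE (hB i)))ᴴ) ?_ _ _ fun j' => ?_
      · refine IsKraus.sandwich (K := fun j' : {j' : J' // f j' = g j} => K j') ?_
          (isContr_emb (Fin.castLE_injective _))
          (isContr_emb_conjTranspose (Fin.castLE_injective _))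
        refine (isKraus_subtype f K (g j)).mp ?_
        convert hK (g j)
      · rw [← zext_siteOp hB hC i hd]
        exact h ⟨j, j'⟩

/-- Pure states are extreme: expanding the sum over j of |w(x₀)L_j(x) - w(x)L_j(x₀)|² expresses it
through entries of the rank-one matrix ww*, where it cancels. So every L_j is proportional to w. -/
theorem eq_smul_of_sum_vecMulVec {α J : Type} [Fintype J] {L : J → α → ℂ} {w : α → ℂ}
    (h : ∑ j, vecMulVec (L j) (star (L j)) = vecMulVec w (star w)) {x₀ : α} (hx₀ : w x₀ ≠ 0) :
    (∀ j, L j = (L j x₀ / w x₀) • w) ∧ ∑ j, ‖L j x₀ / w x₀‖ ^ 2 = 1 := by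
  have hM : ∀ x y, ∑ j, L j x * star (L j y) = w x * star (w y) := fun x y => by
    have := congrFun (congrFun h x) y
    simpa [Matrix.sum_apply, vecMulVec_apply] using this
  have hn : ∀ z : ℂ, ((‖z‖ ^ 2 : ℝ) : ℂ) = z * star z := fun z => by
    rw [RCLike.star_def, Complex.mul_conj']
    push_cast
    rfl
  have key : ∀ x, ∑ j, ‖w x₀ * L j x - w x * L j x₀‖ ^ 2 = 0 := by
    intro x
    apply Complex.ofReal_injective
    rw [Complex.ofReal_sum, Complex.ofReal_zero]
    have e : ∀ j, ((‖w x₀ * L j x - w x * L j x₀‖ ^ 2 : ℝ) : ℂ) =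
        w x₀ * star (w x₀) * (L j x * star (L j x)) - w x₀ * star (w x) * (L j x * star (L j x₀))
          - w x * star (w x₀) * (L j x₀ * star (L j x))
          + w x * star (w x) * (L j x₀ * star (L j x₀)) := by
      intro j
      rw [hn]
      simp only [star_sub, star_mul']
      ring
    simp only [e]
    rw [Finset.sum_add_distrib, Finset.sum_sub_distrib, Finset.sum_sub_distrib]
    simp only [← Finset.mul_sum, hM]
    ring
  constructor
  · intro j
    funext x
    have h1 := (Finset.sum_eq_zero_iff_of_nonneg fun j _ => by positivity).mp (key x) j
      (Finset.mem_univ j)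
    have h2 : w x₀ * L j x - w x * L j x₀ = 0 := by simpa using h1
    rw [Pi.smul_apply, smul_eq_mul]
    field_simp
    linear_combination h2
  · have h1 := hM x₀ x₀
    simp only [← hn, ← Complex.ofReal_sum] at h1
    have h2 := Complex.ofReal_injective h1
    simp only [norm_div, div_pow]
    rw [← Finset.sum_div, h2]
    exact div_self (by simpa using hx₀)

/-- The coefficient of the zero target at a leaf is arbitrary, so it can be chosen as √p. A party is
needed for a product of zero operators to vanish. -/
theorem reach_zero (hk : 1 ≤ k) {ι κ : Fin k → Type} [∀ i, Fintype (ι i)] [∀ i, Fintype (κ i)]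
    {p : ℝ} (hp : 0 ≤ p) (v : (∀ i, ι i) → ℂ) : Reach (0 : (∀ i, κ i) → ℂ) p v := by
  have h : prodOp (fun i => (0 : Matrix (κ i) (ι i) ℂ)) = 0 := by
    ext y x
    exact Finset.prod_eq_zero (Finset.mem_univ ⟨0, hk⟩) rfl
  have := Reach.leaf (w := (0 : (∀ i, κ i) → ℂ)) (fun i => (0 : Matrix (κ i) (ι i) ℂ))
    (fun i => isContr_zero) ((Real.sqrt p : ℝ) : ℂ) v (by rw [h]; simp)
  rwa [Complex.norm_real, Real.norm_eq_abs, sq_abs, Real.sq_sqrt hp] at this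

/-- The leaves of the decomposed channel add up to a rank-one density, so each leaf is a multiple of
the target and the squared coefficients sum to 1. The target 0 has no nonzero entry to compare with
and is treated separately. -/
theorem PureState.Converts.conv (hk : 1 ≤ k) {ψ φ : PureState k} (h : ψ.Converts φ) :
    Conv ψ.vec φ.vec := by
  classical
  obtain ⟨Λ, hΛ, hΛφ⟩ := h
  obtain ⟨N₀, hN₀⟩ := hΛ.exists_decomposition
  set N := max N₀ (max (Finset.univ.sup ψ.dim) (Finset.univ.sup φ.dim)) with hN
  have hA : ∀ i, ψ.dim i ≤ N := fun i =>
    (Finset.le_sup (f := ψ.dim) (Finset.mem_univ i)).trans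
      ((le_max_left _ _).trans (le_max_right _ _))
  have hB : ∀ i, φ.dim i ≤ N := fun i =>
    (Finset.le_sup (f := φ.dim) (Finset.mem_univ i)).trans
      ((le_max_right _ _).trans (le_max_right _ _))
  refine ⟨fun _ => Fin N, inferInstance, fun i => emb (Fin.castLE (hA i)),
    fun i => isContr_emb (Fin.castLE_injective _), ?_⟩
  by_cases hφ : φ.vec = 0
  · rw [hφ]
    exact reach_zero hk zero_le_one _
  obtain ⟨x₀, hx₀⟩ := Function.ne_iff.mp hφ
  obtain ⟨J, _, g, L, h1, h2⟩ := hN₀ N (le_max_left _ _) hA hB ψ.density () ψ.vec rfl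
    (fun y hy => absurd rfl hy)
  have h3 : ∑ j, vecMulVec (L j) (star (L j)) = vecMulVec φ.vec (star φ.vec) := by
    have h4 := h1 ()
    rw [hΛφ] at h4
    rw [show vecMulVec φ.vec (star φ.vec) = φ.density () from rfl, h4]
    refine Finset.sum_congr ?_ fun _ _ => rfl
    ext j
    simp
  obtain ⟨h4, h5⟩ := eq_smul_of_sum_vecMulVec h3 hx₀
  rw [← h5]
  refine h2 _ φ.vec _ fun j => ?_
  refine Reach.leaf (fun i => (emb (Fin.castLE (hB i)))ᴴ)
    (fun i => isContr_emb_conjTranspose (Fin.castLE_injective _)) _ _ ?_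
  rw [zext, prodOp_mulVec_mulVec]
  simp only [emb_isometry (Fin.castLE_injective _)]
  rw [prodOp_one, Matrix.one_mulVec]
  exact h4 j

theorem PureState.Converts.trans {ψ φ χ : PureState k} (h : ψ.Converts φ) (h' : φ.Converts χ) :
    ψ.Converts χ := by
  obtain ⟨Λ, hΛ, h1⟩ := h
  obtain ⟨Λ', hΛ', h2⟩ := h'
  exact ⟨_, hΛ.trans hΛ', by simp only [h1, h2]⟩

/-! ### Operations on conversions of vectors -/

section ConvLemmas

variable {α β γ δ : Fin k → Type} [∀ i, Fintype (α i)] [∀ i, Fintype (β i)]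
  [∀ i, Fintype (γ i)] [∀ i, Fintype (δ i)]

theorem Conv.of_reach {v : (∀ i, α i) → ℂ} {w : (∀ i, β i) → ℂ} (h : Reach w 1 v) :
    Conv v w := by
  classical
  refine ⟨α, inferInstance, fun i => 1, fun i => isContr_one, ?_⟩
  rwa [prodOp_one, Matrix.one_mulVec]

theorem Conv.of_prodOp {v : (∀ i, α i) → ℂ} {w : (∀ i, β i) → ℂ} {U : ∀ i, Matrix (β i) (α i) ℂ}
    (hU : ∀ i, IsContr (U i)) (h : prodOp U *ᵥ v = w) : Conv v w := by
  have := Reach.leaf U hU 1 v (by rw [h, one_smul])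
  simp only [norm_one, one_pow] at this
  exact Conv.of_reach this

theorem Conv.precomp {v : (∀ i, α i) → ℂ} {w : (∀ i, β i) → ℂ} {u : (∀ i, γ i) → ℂ}
    {U : ∀ i, Matrix (α i) (γ i) ℂ} (hU : ∀ i, IsContr (U i)) (hu : prodOp U *ᵥ u = v)
    (h : Conv v w) : Conv u w := by
  obtain ⟨ι, _, W, hW, hr⟩ := h
  refine ⟨ι, inferInstance, fun i => W i * U i, fun i => (hW i).mul (hU i), ?_⟩
  rwa [← prodOp_mulVec_mulVec, hu]

theorem Conv.postcomp {v : (∀ i, α i) → ℂ} {w : (∀ i, β i) → ℂ} {u : (∀ i, γ i) → ℂ}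
    {U : ∀ i, Matrix (γ i) (β i) ℂ} (hU : ∀ i, IsContr (U i)) (hu : prodOp U *ᵥ w = u)
    (h : Conv v w) : Conv v u := by
  obtain ⟨ι, _, W, hW, hr⟩ := h
  refine ⟨ι, inferInstance, W, hW, ?_⟩
  rw [← hu]
  exact hr.postcomp hU

theorem Conv.tens {v : (∀ i, α i) → ℂ} {w : (∀ i, β i) → ℂ} (h : Conv v w)
    (u : (∀ i, γ i) → ℂ) : Conv (tens v u) (tens w u) := by
  classical
  obtain ⟨ι, _, W, hW, hr⟩ := h
  refine ⟨fun i => ι i × γ i, inferInstance, fun i => W i ⊗ₖ (1 : Matrix (γ i) (γ i) ℂ),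
    fun i => (hW i).kronecker_one, ?_⟩
  rw [prodOp_tens, prodOp_one, Matrix.one_mulVec]
  exact hr.tens u

theorem Conv.ds (hk : 1 ≤ k) {v : (∀ i, α i) → ℂ} {w : (∀ i, β i) → ℂ} (h : Conv v w)
    (u : (∀ i, γ i) → ℂ) : Conv (ds v u) (ds w u) := by
  classical
  obtain ⟨ι, _, W, hW, hr⟩ := h
  refine ⟨fun i => ι i ⊕ γ i, inferInstance,
    fun i => Matrix.fromBlocks (W i) 0 0 (1 : Matrix (γ i) (γ i) ℂ),
    fun i => (hW i).fromBlocks isContr_one, ?_⟩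
  rw [prodOp_ds, prodOp_one, Matrix.one_mulVec]
  simpa using hr.ds hk u

theorem isContr_emb_equiv {α β : Type} [Fintype α] [Fintype β] (e : α ≃ β) :
    IsContr (emb e) := isContr_emb e.injective

theorem Conv.nsq_le {v : (∀ i, α i) → ℂ} {w : (∀ i, β i) → ℂ} (h : Conv v w) :
    nsq w ≤ nsq v := by
  obtain ⟨ι, _, W, hW, hr⟩ := h
  have := hr.mul_nsq_le
  rw [one_mul] at this
  exact this.trans (nsq_prodOp_le hW v)

/-- A vector is measured in a product basis. -/
theorem reach_one (v : (∀ i, α i) → ℂ) :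
    Reach (fun _ => 1 : (∀ _ : Fin k, Fin 1) → ℂ) (nsq v) v := by
  classical
  -- `F` is the set of parties that have not yet measured, and `y` records the outcomes of the
  -- others. When `F` is empty, a single amplitude is left.
  suffices H : ∀ (n : ℕ) (F : Finset (Fin k)), F.card = n → ∀ (y : ∀ i, α i)
      (v : (∀ i, α i) → ℂ), (∀ x, (∃ i, i ∉ F ∧ x i ≠ y i) → v x = 0) →
      Reach (fun _ => 1 : (∀ _ : Fin k, Fin 1) → ℂ) (nsq v) v by
    by_cases hne : Nonempty (∀ i, α i)
    · obtain ⟨y⟩ := hne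
      exact H _ Finset.univ rfl y v (by simp)
    · have hv : v = (0 : ℂ) • v := by
        funext x
        exact absurd ⟨x⟩ hne
      have h0 : nsq v = 0 := by rw [hv, nsq_smul]; simp
      have := Reach.leaf (w := (fun _ => 1 : (∀ _ : Fin k, Fin 1) → ℂ))
        (fun i => (0 : Matrix (Fin 1) (α i) ℂ)) (fun i => isContr_zero) 0 v (by
          ext z
          simp only [Matrix.mulVec, dotProduct, zero_smul, Pi.zero_apply]
          exact Finset.sum_eq_zero fun x _ => absurd ⟨x⟩ hne)
      rw [h0]
      simpa using this
  intro n
  induction n with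
  | zero =>
    intro F hF y v hv
    rw [Finset.card_eq_zero] at hF
    subst hF
    have hv' : ∀ x, x ≠ y → v x = 0 := fun x hx => by
      obtain ⟨i, hi⟩ := Function.ne_iff.mp hx
      exact hv x ⟨i, by simp, hi⟩
    have hn : nsq v = ‖v y‖ ^ 2 := by
      rw [nsq, Finset.sum_eq_single y]
      · intro x _ hx
        simp [hv' x hx]
      · simp
    rw [hn]
    refine Reach.leaf (fun i => (emb fun _ : Fin 1 => y i)ᴴ)
      (fun i => isContr_emb_conjTranspose fun a b _ => Subsingleton.elim a b) _ _ ?_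
    ext z
    rw [prodOp_conj_emb]
    simp
  | succ n ih =>
    intro F hF y v hv
    obtain ⟨i, hi⟩ : F.Nonempty := Finset.card_pos.mp (by omega)
    let K : α i → Matrix (α i) (α i) ℂ := fun t => Matrix.diagonal (Pi.single t 1)
    have hKv : ∀ t (u : α i → ℂ), K t *ᵥ u = Pi.single t (u t) := by
      intro t u
      funext s
      rw [Matrix.mulVec_diagonal]
      by_cases hs : s = t
      · subst hs; simp
      · simp [hs]
    have hnK : ∀ t (u : α i → ℂ), nsq (K t *ᵥ u) = ‖u t‖ ^ 2 := by
      intro t u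
      rw [hKv, nsq, Finset.sum_eq_single t]
      · simp
      · intro s _ hs; simp [hs]
      · simp
    have hK : IsKraus K := fun u => by
      simp only [hnK]
      exact le_rfl
    have hsite : ∀ t, prodOp (site i (K t)) *ᵥ v = fun x => if x i = t then v x else 0 := by
      intro t
      ext x
      rw [prodOp_site_apply]
      have h1 : ∀ s, K t (x i) s = if s = x i then (if x i = t then 1 else 0) else 0 := by
        intro s
        simp only [K, Matrix.diagonal_apply, Pi.single_apply]
        by_cases hs : x i = s
        · simp [hs]
        · simp [hs, Ne.symm hs]
      simp [h1]
    have hsum : nsq v = ∑ t, nsq (prodOp (site i (K t)) *ᵥ v) := by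
      simp only [hsite, nsq]
      rw [Finset.sum_comm]
      refine Finset.sum_congr rfl fun x _ => ?_
      rw [Finset.sum_eq_single (x i)]
      · simp
      · intro t _ ht
        simp [Ne.symm ht]
      · simp
    rw [hsum]
    refine Reach.step i (α i) K hK _ v fun t => ?_
    refine ih (F.erase i) (by rw [Finset.card_erase_of_mem hi, hF]; rfl)
      (Function.update y i t) _ fun x hx => ?_
    rw [hsite]
    simp only
    obtain ⟨j, hj, hxj⟩ := hx
    by_cases hji : j = i
    · subst hji
      rw [Function.update_self] at hxj
      rw [if_neg hxj]
    · rw [Function.update_of_ne hji] at hxj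
      rw [hv x ⟨j, fun hjF => hj (Finset.mem_erase.mpr ⟨hji, hjF⟩), hxj⟩]
      simp

end ConvLemmas
end LOCC

namespace LOCC

variable {k : ℕ}

/-! ### The order on the semiring of states -/

open PureState

theorem VecEquiv.conv {d d' : Fin k → ℕ} {v : Vec d} {w : Vec d'} (h : VecEquiv v w) :
    Conv v w := by
  obtain ⟨U, hU, h1, -⟩ := h
  exact Conv.of_prodOp (fun i => (hU i).isContr) h1.symm

theorem VecEquiv.symm {d d' : Fin k → ℕ} {v : Vec d} {w : Vec d'} (h : VecEquiv v w) :
    VecEquiv w v := by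
  obtain ⟨U, hU, h1, h2⟩ := h
  exact ⟨fun j => (U j)ᴴ, fun j => (hU j).conjTranspose, h2, by simpa using h1⟩

theorem PureState.LUEquiv.converts {ψ φ : PureState k} (h : ψ.LUEquiv φ) : ψ.Converts φ :=
  (VecEquiv.conv h).converts

theorem PureState.LUEquiv.symm {ψ φ : PureState k} (h : ψ.LUEquiv φ) : φ.LUEquiv ψ :=
  VecEquiv.symm h

theorem Reach.smul_right {ι κ : Fin k → Type} [∀ i, Fintype (ι i)] [∀ i, Fintype (κ i)]
    {w : (∀ i, κ i) → ℂ} {p : ℝ} {v : (∀ i, ι i) → ℂ} (h : Reach w p v) {c : ℂ} (hc : c ≠ 0) :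
    Reach (c • w) (p / ‖c‖ ^ 2) v := by
  induction h with
  | leaf U hU c' v h =>
    rw [← div_pow, ← norm_div]
    exact Reach.leaf U hU _ _ (by rw [h, smul_smul, div_mul_cancel₀ _ hc])
  | step i J K hK p v h ih =>
    rw [Finset.sum_div]
    exact Reach.step i J K hK _ _ ih

namespace S

/-- `x ≤ y` if `y` is converted to `x` by LOCC. -/
def le : S k → S k → Prop :=
  Quot.lift₂ (fun ψ φ => φ.Converts ψ)
    (fun _ _ _ h => propext ⟨fun h1 => h.symm.converts.trans h1, fun h1 => h.converts.trans h1⟩)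
    (fun _ _ _ h => propext ⟨fun h1 => h1.trans h.converts, fun h1 => h1.trans h.symm.converts⟩)

theorem le_cls {ψ φ : PureState k} : le (cls ψ) (cls φ) ↔ φ.Converts ψ := Iff.rfl

theorem le_refl (a : S k) : le a a := by
  induction a using ind with | h ψ => exact ⟨_, IsLOCC.refl, rfl⟩

theorem le_trans {a b c : S k} (h : le a b) (h' : le b c) : le a c := by
  induction a using ind with | h ψ => induction b using ind with | h φ =>
  induction c using ind with | h χ =>
  exact Converts.trans (le_cls.mp h') (le_cls.mp h)

theorem le_of_eq {a b : S k} (h : a = b) : le a b := h ▸ le_refl a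

theorem tensorVec_eq {d d' : Fin k → ℕ} (v : Vec d) (w : Vec d') :
    tensorVec v w = prodOp (fun _ => emb finProdFinEquiv) *ᵥ tens v w := by
  ext y
  rw [prodOp_emb_equiv]
  rfl

theorem tens_eq {d d' : Fin k → ℕ} (v : Vec d) (w : Vec d') :
    prodOp (fun _ => emb finProdFinEquiv.symm) *ᵥ tensorVec v w = tens v w := by
  ext y
  rw [prodOp_emb_equiv]
  simp [tensorVec, tens]

theorem dsumVec_eq {d d' : Fin k → ℕ} (v : Vec d) (w : Vec d') :
    dsumVec v w = prodOp (fun _ => emb finSumFinEquiv) *ᵥ ds v w := by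
  simp only [ds, dsumVec, Matrix.mulVec_add, prodOp_mulVec_mulVec, emb_mul_emb,
    finSumFinEquiv_apply_left, finSumFinEquiv_apply_right]

theorem ds_eq {d d' : Fin k → ℕ} (v : Vec d) (w : Vec d') :
    prodOp (fun _ => emb finSumFinEquiv.symm) *ᵥ dsumVec v w = ds v w := by
  simp only [ds, dsumVec, Matrix.mulVec_add, prodOp_mulVec_mulVec, emb_mul_emb,
    finSumFinEquiv_symm_apply_castAdd, finSumFinEquiv_symm_apply_natAdd]

theorem mul_le_mul_right (hk : 1 ≤ k) {a b : S k} (c : S k) (h : le a b) :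
    le (a * c) (b * c) := by
  induction a using ind with | h ψ => induction b using ind with | h φ =>
  induction c using ind with | h χ =>
  refine Conv.converts (ψ := φ.tensor χ) (φ := ψ.tensor χ) ?_
  exact (((le_cls.mp h).conv hk).tens χ.vec).precomp (fun _ => isContr_emb_equiv _)
    (tens_eq φ.vec χ.vec) |>.postcomp (fun _ => isContr_emb_equiv _)
      (tensorVec_eq ψ.vec χ.vec).symm

theorem add_le_add_right (hk : 1 ≤ k) {a b : S k} (c : S k) (h : le a b) :
    le (a + c) (b + c) := by
  induction a using ind with | h ψ => induction b using ind with | h φ =>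
  induction c using ind with | h χ =>
  refine Conv.converts (ψ := φ.dsum χ) (φ := ψ.dsum χ) ?_
  exact (((le_cls.mp h).conv hk).ds hk χ.vec).precomp (fun _ => isContr_emb_equiv _)
    (ds_eq φ.vec χ.vec) |>.postcomp (fun _ => isContr_emb_equiv _)
      (dsumVec_eq ψ.vec χ.vec).symm

theorem mul_le_mul (hk : 1 ≤ k) {a b c d : S k} (h : le a b) (h' : le c d) :
    le (a * c) (b * d) := by
  refine le_trans (mul_le_mul_right hk c h) ?_
  rw [mul_comm b, mul_comm b]
  exact mul_le_mul_right hk b h'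

theorem zero_le (hk : 1 ≤ k) (a : S k) : le 0 a := by
  induction a using ind with | h ψ =>
  refine Conv.converts (ψ := ψ) (φ := PureState.zero k) ?_
  exact Conv.of_reach (reach_zero hk zero_le_one _)

/-! ### Scalars -/

/-- The class of `c|0…0⟩`. -/
def sc (k : ℕ) (c : ℝ) : S k := cls ((PureState.one k).scale c)

theorem one_tensorVec' {d : Fin k → ℕ} (c : ℂ) (v : Vec d) :
    VecEquiv (tensorVec (fun _ => c : Vec (fun _ : Fin k => 1)) v) (c • v) := by
  refine vecEquiv_of_equiv (fun i => finProdFinEquiv.symm.trans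
    (Equiv.uniqueProd (Fin (d i)) (Fin 1))) (fun y => ?_)
  simp only [tensorVec, Equiv.symm_trans_apply, Equiv.symm_symm, Equiv.symm_apply_apply,
    Equiv.uniqueProd_symm_apply, Pi.smul_apply, smul_eq_mul]

theorem sc_mul_cls (c : ℝ) (ψ : PureState k) : sc k c * cls ψ = cls (ψ.scale c) := by
  have h : ((PureState.one k).scale c).vec = fun _ => (c : ℂ) := by
    ext x
    simp [PureState.scale, PureState.one]
  have h1 : sc k c * cls ψ = cls ⟨_, tensorVec ((PureState.one k).scale c).vec ψ.vec⟩ := rfl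
  rw [h1, h]
  exact sound (one_tensorVec' (c : ℂ) ψ.vec)

theorem sc_mul (a b : ℝ) : sc k (a * b) = sc k a * sc k b := by
  rw [show sc k b = cls ((PureState.one k).scale b) from rfl, sc_mul_cls, sc]
  congr 1
  simp [PureState.scale, mul_assoc]

theorem sc_one : sc k 1 = 1 := by
  rw [sc]
  have : (PureState.one k).scale 1 = PureState.one k := by
    simp [PureState.scale]
  rw [this]
  rfl

theorem sc_pow (a : ℝ) (n : ℕ) : sc k (a ^ n) = sc k a ^ n := by
  induction n with
  | zero => simp [sc_one]
  | succ n ih => rw [pow_succ, sc_mul, ih, pow_succ]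

theorem conv_smul (hk : 1 ≤ k) {α : Fin k → Type} [∀ i, Fintype (α i)] (v : (∀ i, α i) → ℂ)
    {c : ℂ} (hc : ‖c‖ ≤ 1) : Conv v (c • v) := by
  classical
  refine Conv.of_prodOp (U := site ⟨0, hk⟩ (c • emb fun x => x)) (fun i => ?_)
    (prodOp_site_smul_one _ _ _)
  by_cases hi : i = ⟨0, hk⟩
  · subst hi
    rw [site_same, emb_id]
    exact isContr_one.smul hc
  · rw [site_of_ne hi, emb_id]
    exact isContr_one

theorem sc_le_one (hk : 1 ≤ k) {c : ℝ} (h0 : 0 ≤ c) (h1 : c ≤ 1) : le (sc k c) 1 := by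
  refine Conv.converts (ψ := PureState.one k) (φ := (PureState.one k).scale c) ?_
  exact conv_smul hk _ (c := (c : ℂ)) (by simpa [abs_of_nonneg h0] using h1)

theorem sc_mono (hk : 1 ≤ k) {a b : ℝ} (ha : 0 ≤ a) (hab : a ≤ b) : le (sc k a) (sc k b) := by
  rcases eq_or_lt_of_le (ha.trans hab) with hb | hb
  · obtain rfl : a = b := by linarith
    exact le_refl _
  · have h := mul_le_mul_right hk (sc k b) (sc_le_one hk (c := a / b) (by positivity)
      (by rwa [div_le_one hb]))
    rwa [← sc_mul, one_mul, div_mul_cancel₀ _ hb.ne'] at h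

/-- A product basis measurement ends in multiples of |0…0⟩ of total weight equal to the squared
norm; taking the norm as a factor of the target makes this weight 1. -/
theorem sc_sqrt_normSq_le (ψ : PureState k) : le (sc k (Real.sqrt ψ.normSq)) (cls ψ) := by
  refine Conv.converts (ψ := ψ) (φ := (PureState.one k).scale (Real.sqrt ψ.normSq)) ?_
  by_cases h0 : nsq ψ.vec = 0
  · have h1 : ψ.normSq = 0 := h0
    refine Conv.of_prodOp (U := fun i => 0) (fun i => isContr_zero) ?_
    have h2 : ψ.vec = 0 := nsq_eq_zero h0
    rw [h2, h1, Matrix.mulVec_zero]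
    ext x
    simp [PureState.scale]
  · have hpos : 0 < nsq ψ.vec := lt_of_le_of_ne (nsq_nonneg _) (Ne.symm h0)
    have hr := (reach_one ψ.vec).smul_right (c := ((Real.sqrt (nsq ψ.vec) : ℝ) : ℂ))
      (by simpa using (Real.sqrt_pos.mpr hpos).ne')
    rw [Complex.norm_real, Real.norm_eq_abs, sq_abs, Real.sq_sqrt hpos.le, div_self h0] at hr
    exact Conv.of_reach hr

theorem nsq_mulVec_le {α β : Type} [Fintype α] [Fintype β] (K : Matrix β α ℂ) (v : α → ℂ) :
    nsq (K *ᵥ v) ≤ (∑ y, ∑ x, ‖K y x‖ ^ 2) * nsq v := by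
  rw [nsq, Finset.sum_mul]
  refine Finset.sum_le_sum fun y _ => ?_
  have h1 : ‖(K *ᵥ v) y‖ ≤ ∑ x, ‖K y x‖ * ‖v x‖ := by
    simp only [Matrix.mulVec, dotProduct]
    exact (norm_sum_le _ _).trans (by simp)
  refine (pow_le_pow_left₀ (norm_nonneg _) h1 2).trans ?_
  exact Finset.sum_mul_sq_le_sq_mul_sq _ _ _

theorem isContr_smul_of_bound {α β : Type} [Fintype α] [Fintype β] (K : Matrix β α ℂ) :
    ∃ M : ℝ, 1 ≤ M ∧ IsContr (((M⁻¹ : ℝ) : ℂ) • K) := by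
  set B := ∑ y, ∑ x, ‖K y x‖ ^ 2 with hB
  have hB0 : 0 ≤ B := by positivity
  -- The choice 1 + B works because B ≤ (1 + B)², where B is the squared Hilbert–Schmidt norm.
  refine ⟨1 + B, by linarith, fun v => ?_⟩
  rw [Matrix.smul_mulVec, nsq_smul, Complex.norm_real, Real.norm_eq_abs, sq_abs, inv_pow]
  rw [inv_mul_le_iff₀ (by positivity)]
  refine (nsq_mulVec_le K v).trans (mul_le_mul_of_nonneg_right ?_ (nsq_nonneg v))
  nlinarith

theorem prodOp_smul {α β : Fin k → Type} (c : Fin k → ℂ) (K : ∀ i, Matrix (β i) (α i) ℂ) :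
    prodOp (fun i => c i • K i) = (∏ i, c i) • prodOp K := by
  ext y x
  simp [prodOp, Finset.prod_mul_distrib]

theorem conv_smul_of_prodOp {α β : Fin k → Type} [∀ i, Fintype (α i)] [∀ i, Fintype (β i)]
    {v : (∀ i, α i) → ℂ} {w : (∀ i, β i) → ℂ} (K : ∀ i, Matrix (β i) (α i) ℂ)
    (h : prodOp K *ᵥ v = w) : ∃ c : ℝ, 1 ≤ c ∧ Conv ((c : ℂ) • v) w := by
  choose M hM hK using fun i => isContr_smul_of_bound (K i)
  have hpos : 0 < ∏ i, M i := Finset.prod_pos fun i _ => one_pos.trans_le (hM i)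
  refine ⟨∏ i, M i, ?_, Conv.of_prodOp hK ?_⟩
  · have := Finset.prod_le_prod (s := Finset.univ) (f := fun _ : Fin k => (1 : ℝ)) (g := M)
      (fun _ _ => zero_le_one) (fun i _ => hM i)
    simpa using this
  · rw [prodOp_smul, Matrix.smul_mulVec, Matrix.mulVec_smul, h, smul_smul,
      ← Complex.ofReal_prod, ← Complex.ofReal_mul, Finset.prod_inv_distrib,
      inv_mul_cancel₀ hpos.ne']
    simp

/-- A vector is obtained from a multiple of any vector that a product operator maps to it. -/
theorem cls_le_of_prodOp {ψ φ : PureState k}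
    (K : ∀ i, Matrix (Fin (φ.dim i)) (Fin (ψ.dim i)) ℂ) (h : prodOp K *ᵥ ψ.vec = φ.vec) :
    ∃ c : ℝ, 1 ≤ c ∧ le (cls φ) (sc k c * cls ψ) := by
  obtain ⟨c, hc, h1⟩ := conv_smul_of_prodOp K h
  refine ⟨c, hc, ?_⟩
  rw [sc_mul_cls]
  exact Conv.converts (ψ := ψ.scale c) (φ := φ) h1

end S

/-! ### GHZ states and natural numbers -/

/-- The unnormalized vector `∑ t, |t…t⟩` on the parties in `T`, with `∑ t, |t⟩` at each other
party. -/
def gvec (T : Finset (Fin k)) (n : ℕ) : (Fin k → Fin n) → ℂ :=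
  fun x => open Classical in if ∀ i ∈ T, ∀ j ∈ T, x i = x j then 1 else 0

/-- The state of the vector `gvec`. -/
def ghz (T : Finset (Fin k)) (n : ℕ) : PureState k := ⟨fun _ => n, gvec T n⟩

theorem gvec_univ_const (n : ℕ) (t : Fin n) : gvec (k := k) Finset.univ n (fun _ => t) = 1 :=
  if_pos (by simp)

theorem gvec_univ_eq_zero (hk : 1 ≤ k) (n : ℕ) (x : Fin k → Fin n) (hx : ∀ t, x ≠ fun _ => t) :
    gvec Finset.univ n x = 0 := by
  refine if_neg fun h => hx (x ⟨0, hk⟩) ?_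
  funext i
  exact h i (by simp) _ (by simp)

theorem sum_gvec_univ (hk : 1 ≤ k) {M : Type} [AddCommMonoid M] (n : ℕ) (F : (Fin k → Fin n) → M)
    (hF : ∀ x, gvec Finset.univ n x = 0 → F x = 0) : ∑ x, F x = ∑ t, F (fun _ => t) := by
  symm
  refine Fintype.sum_of_injective (fun (t : Fin n) (_ : Fin k) => t) ?_ _ _ ?_ fun t => rfl
  · intro s t h
    exact congrFun h ⟨0, hk⟩
  · intro x hx
    exact hF x (gvec_univ_eq_zero hk n x fun t ht => hx ⟨t, ht.symm⟩)

theorem nsq_gvec_univ (hk : 1 ≤ k) (n : ℕ) : nsq (gvec (k := k) Finset.univ n) = n := by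
  rw [nsq, sum_gvec_univ hk n _ (fun x hx => by simp [hx])]
  simp [gvec_univ_const]

theorem prodOp_gvec_univ (hk : 1 ≤ k) (n : ℕ) {β : Fin k → Type}
    (K : ∀ i, Matrix (β i) (Fin n) ℂ) (y : ∀ i, β i) :
    (prodOp K *ᵥ gvec Finset.univ n) y = ∑ t, ∏ i, K i (y i) t := by
  simp only [Matrix.mulVec, dotProduct]
  rw [sum_gvec_univ hk n _ (fun x hx => by rw [hx, mul_zero])]
  simp [gvec_univ_const, prodOp]

theorem gvec_univ_succ (hk : 1 ≤ k) (n : ℕ) :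
    gvec (k := k) Finset.univ (n + 1) =
      dsumVec (d := fun _ => n) (d' := fun _ => 1) (gvec Finset.univ n) (fun _ => 1) := by
  classical
  let i₀ : Fin k := ⟨0, hk⟩
  have hl : ∀ t : Fin n, Fin.castAdd 1 t ∉ Set.range (Fin.natAdd n : Fin 1 → Fin (n + 1)) := by
    rintro t ⟨s, hs⟩
    exact castAdd_ne_natAdd t s hs.symm
  have hr : ∀ s : Fin 1, Fin.natAdd n s ∉ Set.range (Fin.castAdd 1 : Fin n → Fin (n + 1)) := by
    rintro s ⟨t, ht⟩
    exact castAdd_ne_natAdd t s ht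
  have hcast : Function.Injective (Fin.castAdd 1 : Fin n → Fin (n + 1)) :=
    Fin.castAdd_injective n 1
  funext y
  rw [dsumVec, Pi.add_apply]
  by_cases h1 : ∃ x : Fin k → Fin n, y = fun i => Fin.castAdd 1 (x i)
  · obtain ⟨x, rfl⟩ := h1
    rw [prodOp_emb_apply (ι := fun _ => Fin n) (κ := fun _ => Fin (n + 1))
      (e := fun _ => Fin.castAdd 1) (fun i => hcast),
      prodOp_emb_apply_eq_zero (ι := fun _ => Fin 1) (κ := fun _ => Fin (n + 1))
      (e := fun _ => Fin.natAdd n) _ (i := i₀) (hl (x i₀)), add_zero]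
    simp only [gvec, hcast.eq_iff]
  · obtain ⟨i, hi⟩ : ∃ i, ∀ t, y i ≠ Fin.castAdd 1 t := by
      by_contra! hcon
      choose x hx using hcon
      exact h1 ⟨x, funext hx⟩
    rw [prodOp_emb_apply_eq_zero (ι := fun _ => Fin n) (κ := fun _ => Fin (n + 1))
      (e := fun _ => Fin.castAdd 1) _ (i := i) (fun ⟨t, ht⟩ => hi t ht.symm), zero_add]
    by_cases h2 : ∃ x : Fin k → Fin 1, y = fun i => Fin.natAdd n (x i)
    · obtain ⟨x, rfl⟩ := h2
      rw [prodOp_emb_apply (ι := fun _ => Fin 1) (κ := fun _ => Fin (n + 1))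
        (e := fun _ => Fin.natAdd n) (fun i => Fin.natAdd_injective _ _)]
      refine if_pos fun i _ j _ => ?_
      exact congrArg (Fin.natAdd n) (Subsingleton.elim (x i) (x j))
    · obtain ⟨j, hj⟩ : ∃ j, ∀ t, y j ≠ Fin.natAdd n t := by
        by_contra! hcon
        choose x hx using hcon
        exact h2 ⟨x, funext hx⟩
      rw [prodOp_emb_apply_eq_zero (ι := fun _ => Fin 1) (κ := fun _ => Fin (n + 1))
        (e := fun _ => Fin.natAdd n) _ (i := j) (fun ⟨t, ht⟩ => hj t ht.symm)]
      refine if_neg fun h => ?_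
      have hij := h i (by simp) j (by simp)
      rcases Fin.addCases (motive := fun z : Fin (n + 1) => (∃ t, z = Fin.castAdd 1 t) ∨
        ∃ t : Fin 1, z = Fin.natAdd n t) (fun t => Or.inl ⟨t, rfl⟩) (fun t => Or.inr ⟨t, rfl⟩)
        (y i) with ⟨t, ht⟩ | ⟨t, ht⟩
      · exact hi t ht
      · exact hj t (hij ▸ ht)

/-- Adding |0…0⟩ as a direct summand adds one level to a GHZ vector. This is what makes the natural
numbers of the abstract duality an entanglement resource. -/
theorem natCast_eq_cls (hk : 1 ≤ k) (n : ℕ) : (n : S k) = cls (ghz Finset.univ n) := by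
  induction n with
  | zero =>
    rw [Nat.cast_zero]
    have h0 : gvec (k := k) Finset.univ 0 = 0 := by
      funext x
      exact (x ⟨0, hk⟩).elim0
    have : VecEquiv (PureState.zero k).vec (ghz Finset.univ 0).vec := by
      rw [show (ghz (k := k) Finset.univ 0).vec = 0 from h0]
      exact vecEquiv_zero
    exact S.sound this
  | succ n ih =>
    rw [Nat.cast_succ, ih]
    have h1 : cls (ghz (k := k) Finset.univ n) + 1 =
      cls ⟨_, dsumVec (d := fun _ => n) (d' := fun _ => 1) (gvec Finset.univ n) (fun _ => 1)⟩ := rfl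
    rw [h1, ← gvec_univ_succ hk]
    rfl

namespace S

/-- The squared norm of the GHZ vector is its number of levels, and conversion cannot increase the
norm. -/
theorem natCast_le (hk : 1 ≤ k) {m n : ℕ} (h : le (m : S k) n) : m ≤ n := by
  rw [natCast_eq_cls hk, natCast_eq_cls hk] at h
  have h1 := ((le_cls.mp h).conv hk).nsq_le
  rw [show (ghz (k := k) Finset.univ m).vec = gvec Finset.univ m from rfl,
    show (ghz (k := k) Finset.univ n).vec = gvec Finset.univ n from rfl] at h1
  erw [nsq_gvec_univ hk, nsq_gvec_univ hk] at h1
  exact_mod_cast h1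

theorem sc_sqrt_le_natCast (hk : 1 ≤ k) (n : ℕ) : le (sc k (Real.sqrt n)) n := by
  rw [natCast_eq_cls hk]
  have h := sc_sqrt_normSq_le (ghz (k := k) Finset.univ n)
  have e : (ghz (k := k) Finset.univ n).normSq = n := nsq_gvec_univ hk n
  rwa [e] at h

theorem exists_sc_le_natCast (hk : 1 ≤ k) (c : ℝ) (hc : 0 ≤ c) : ∃ n : ℕ, le (sc k c) n := by
  obtain ⟨n, hn⟩ := exists_nat_ge (c ^ 2)
  exact ⟨n, le_trans (sc_mono hk hc (Real.le_sqrt_of_sq_le hn)) (sc_sqrt_le_natCast hk n)⟩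

/-- Take one GHZ level for each product basis vector. Every party maps a level to its own component
of that basis vector, and party `i₀` also inserts the amplitude. The scalar needed to turn these
maps into contractions is bounded by a natural number. -/
theorem exists_le_natCast (hk : 1 ≤ k) (a : S k) : ∃ n : ℕ, le a n := by
  classical
  induction a using ind with | h ψ =>
  let i₀ : Fin k := ⟨0, hk⟩
  let N := Fintype.card (∀ i, Fin (ψ.dim i))
  let e : (∀ i, Fin (ψ.dim i)) ≃ Fin N := Fintype.equivFin _
  let K : ∀ i, Matrix (Fin (ψ.dim i)) (Fin N) ℂ := fun i y t =>
    if y = e.symm t i then (if i = i₀ then ψ.vec (e.symm t) else 1) else 0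
  have h1 : prodOp K *ᵥ gvec Finset.univ N = ψ.vec := by
    ext y
    rw [prodOp_gvec_univ hk, Fintype.sum_eq_single (e y)]
    · simp [K, Finset.prod_ite_eq']
    · intro t ht
      obtain ⟨i, hi⟩ : ∃ i, y i ≠ e.symm t i := by
        by_contra! hcon
        exact ht (by rw [show y = e.symm t from funext hcon, Equiv.apply_symm_apply])
      exact Finset.prod_eq_zero (Finset.mem_univ i) (if_neg hi)
  obtain ⟨c, hc, h2⟩ := cls_le_of_prodOp (ψ := ghz Finset.univ N) (φ := ψ) K h1
  obtain ⟨m, hm⟩ := exists_sc_le_natCast hk c (zero_le_one.trans hc)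
  refine ⟨m * N, le_trans h2 ?_⟩
  rw [← natCast_eq_cls hk, Nat.cast_mul]
  exact mul_le_mul_right hk _ hm

theorem cls_eq_zero {ψ : PureState k} (h : ψ.normSq = 0) : cls ψ = 0 := by
  have h1 : ψ.vec = 0 := nsq_eq_zero h
  have : VecEquiv ψ.vec (PureState.zero k).vec := by
    rw [h1]
    exact vecEquiv_zero
  exact sound this

/-- Measuring both factors turns n and ψ into the scalars √n and ‖ψ‖, so any n ≥ 1/‖ψ‖² will do. -/
theorem exists_one_le (hk : 1 ≤ k) {a : S k} (ha : a ≠ 0) : ∃ n : ℕ, le 1 ((n : S k) * a) := by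
  induction a using ind with | h ψ =>
  have h0 : ψ.normSq ≠ 0 := fun h => ha (cls_eq_zero h)
  have hpos : 0 < ψ.normSq := lt_of_le_of_ne (nsq_nonneg ψ.vec) (Ne.symm h0)
  obtain ⟨n, hn⟩ := exists_nat_ge (1 / ψ.normSq)
  refine ⟨n, le_trans ?_ (mul_le_mul hk (sc_sqrt_le_natCast hk n) (sc_sqrt_normSq_le ψ))⟩
  rw [← sc_mul, ← sc_one, ← Real.sqrt_mul (Nat.cast_nonneg n)]
  refine sc_mono hk zero_le_one (Real.le_sqrt_of_sq_le ?_)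
  rw [div_le_iff₀ hpos] at hn
  linarith

theorem isStrassen (hk : 1 ≤ k) : IsStrassen (le (k := k)) where
  refl := le_refl
  trans := le_trans
  add_right c h := add_le_add_right hk c h
  mul_right c h := mul_le_mul_right hk c h
  zero_le := zero_le hk
  nat_le := natCast_le hk
  le_nat := exists_le_natCast hk
  one_le _ ha := exists_one_le hk ha

/-- Asymptotic conversion with the assistance of `O(n)` GHZ states. -/
theorem pow_le_of_spectrum (hk : 1 ≤ k) {a b : S k} (hb : b ≠ 0)
    (h : ∀ f : Spectrum k, (f : S k →+* ℝ≥0) a ≤ (f : S k →+* ℝ≥0) b) :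
    ∃ C : ℕ, ∀ n : ℕ, le (a ^ n) ((C : S k) * 4 ^ n * b ^ n) :=
  (isStrassen hk).pow_le_of_forall_hom hb fun f hf => h ⟨f, fun _ _ h1 => hf _ _ h1⟩

end S
end LOCC

namespace LOCC

variable {k : ℕ}

/-! ### A balanced factorization of a sum of product vectors -/

section Spanner

variable {T X Y : Type} [Fintype T] [Fintype X] [Fintype Y]

/-- The linear combinations of `a` with coefficients in the unit polydisc. -/
def polydiscSpan (a : T → X → ℂ) : Set (X → ℂ) :=
  (fun l : T → ℂ => ∑ t, l t • a t) '' Metric.closedBall 0 1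

theorem isCompact_polydiscSpan (a : T → X → ℂ) : IsCompact (polydiscSpan a) :=
  (isCompact_closedBall _ _).image (by fun_prop)

theorem convex_polydiscSpan (a : T → X → ℂ) : Convex ℝ (polydiscSpan a) := by
  refine (convex_closedBall _ _).is_linear_image ⟨fun l m => ?_, fun c l => ?_⟩
  · simp [add_smul, Finset.sum_add_distrib]
  · rw [Finset.smul_sum]
    exact Finset.sum_congr rfl fun t _ => smul_assoc c (l t) (a t)

/-- Hahn–Banach separation from a compact convex set. On this set the real part of f reaches the sum
of the |f(a_t)|, at the coefficients conjugate to the phases of the f(a_t). -/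
theorem exists_dual_of_notMem {a : T → X → ℂ} {v : X → ℂ} (h : v ∉ polydiscSpan a) :
    ∃ f : (X → ℂ) →L[ℂ] ℂ, ∑ t, ‖f (a t)‖ < ‖f v‖ := by
  obtain ⟨f, u, h1, h2⟩ := RCLike.geometric_hahn_banach_closed_point (𝕜 := ℂ)
    (convex_polydiscSpan a) (isCompact_polydiscSpan a).isClosed h
  refine ⟨f, ?_⟩
  let l : T → ℂ := fun t => star (f (a t)) / (‖f (a t)‖ : ℂ)
  have hl : ∀ t, l t * f (a t) = (‖f (a t)‖ : ℂ) := by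
    intro t
    by_cases h0 : f (a t) = 0
    · simp [l, h0]
    · have h3 : (‖f (a t)‖ : ℂ) ≠ 0 := by simpa using h0
      simp only [l]
      rw [div_mul_eq_mul_div, div_eq_iff h3, RCLike.star_def, Complex.conj_mul', sq]
  have hmem : ∑ t, l t • a t ∈ polydiscSpan a := by
    refine ⟨l, ?_, rfl⟩
    rw [mem_closedBall_zero_iff, pi_norm_le_iff_of_nonneg zero_le_one]
    intro t
    simp only [l, norm_div, norm_star, Complex.norm_real, norm_norm]
    exact div_self_le_one _
  have h3 := (h1 _ hmem).trans h2
  rw [map_sum] at h3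
  simp only [map_smul, smul_eq_mul, hl] at h3
  rw [← Complex.ofReal_sum] at h3
  refine lt_of_lt_of_le h3 ?_
  exact Complex.re_le_norm _

/-- The coefficient bound 1 on both sides at once is the point: one side alone could be solved with
large coefficients. The bounds are balanced by moving a scalar s between the factors, and the loss
of 1/2 comes from searching s among powers of 2 only. -/
theorem exists_balanced_factorization {a : T → X → ℂ} {b : T → Y → ℂ} {α : X → ℂ} {β : Y → ℂ}
    {c : ℂ} (h : ∀ x y, ∑ t, a t x * b t y = c * (α x * β y)) :
    ∃ l m : T → ℂ, (∀ t, ‖l t‖ ≤ 1) ∧ (∀ t, ‖m t‖ ≤ 1) ∧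
      ∀ x y, (∑ t, l t * a t x) * (∑ t, m t * b t y) = c / 2 * (α x * β y) := by
  by_cases hdeg : ∀ x y, c * (α x * β y) = 0
  · refine ⟨0, 0, by simp, by simp, fun x y => ?_⟩
    rw [div_mul_eq_mul_div, hdeg x y]
    simp
  push Not at hdeg
  obtain ⟨x₀, y₀, h0⟩ := hdeg
  have hc : c ≠ 0 := left_ne_zero_of_mul h0
  have hα : α x₀ ≠ 0 := left_ne_zero_of_mul (right_ne_zero_of_mul h0)
  have hβ : β y₀ ≠ 0 := right_ne_zero_of_mul (right_ne_zero_of_mul h0)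
  -- If both memberships failed, separating functionals f and g would give |∑ f(a_t)g(b_t)| <
  -- s·s'·|f(α)g(β)|, whereas the hypothesis makes the sum equal to c·f(α)g(β).
  have dual : ∀ s s' : ℝ, 0 < s → 0 < s' → s * s' = ‖c‖ →
      (s : ℂ) • α ∈ polydiscSpan a ∨ (s' : ℂ) • β ∈ polydiscSpan b := by
    intro s s' hs hs' hss
    by_contra! hcon
    obtain ⟨f, hf⟩ := exists_dual_of_notMem hcon.1
    obtain ⟨g, hg⟩ := exists_dual_of_notMem hcon.2
    have h1 : ∀ y, ∑ t, f (a t) * b t y = c * f α * β y := by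
      intro y
      have h2 : ∑ t, b t y • a t = (c * β y) • α := by
        funext x
        simp only [Finset.sum_apply, Pi.smul_apply, smul_eq_mul]
        rw [mul_assoc, mul_comm (β y), ← h x y]
        exact Finset.sum_congr rfl fun t _ => mul_comm _ _
      have h3 := congrArg f h2
      rw [map_sum] at h3
      simp only [map_smul, smul_eq_mul] at h3
      rw [mul_right_comm, ← h3]
      exact Finset.sum_congr rfl fun t _ => mul_comm _ _
    have h2 : ∑ t, f (a t) • b t = (c * f α) • β := by
      funext y
      simpa using h1 y
    have h3 := congrArg g h2
    rw [map_sum] at h3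
    simp only [map_smul, smul_eq_mul] at h3 hf hg
    have h4 : ‖∑ t, f (a t) * g (b t)‖ ≤ (∑ t, ‖f (a t)‖) * ∑ t, ‖g (b t)‖ := by
      refine (norm_sum_le _ _).trans ?_
      rw [Finset.sum_mul]
      refine Finset.sum_le_sum fun t _ => ?_
      rw [norm_mul]
      exact mul_le_mul_of_nonneg_left
        (Finset.single_le_sum (f := fun t => ‖g (b t)‖) (fun _ _ => norm_nonneg _)
          (Finset.mem_univ t)) (norm_nonneg _)
    have h5 : (∑ t, ‖f (a t)‖) * ∑ t, ‖g (b t)‖ < ‖(s : ℂ) * f α‖ * ‖(s' : ℂ) * g β‖ :=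
      mul_lt_mul'' hf hg (Finset.sum_nonneg fun _ _ => norm_nonneg _)
        (Finset.sum_nonneg fun _ _ => norm_nonneg _)
    rw [h3] at h4
    simp only [norm_mul, Complex.norm_real, Real.norm_eq_abs, abs_of_pos hs, abs_of_pos hs']
      at h4 h5
    have h6 : s * ‖f α‖ * (s' * ‖g β‖) = ‖c‖ * ‖f α‖ * ‖g β‖ := by rw [← hss]; ring
    linarith
  obtain ⟨s₀, hs₀, hmem₀⟩ : ∃ s : ℝ, 0 < s ∧ (s : ℂ) • α ∈ polydiscSpan a := by
    let l : T → ℂ := fun t => b t y₀ / (c * β y₀)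
    have hl : ∑ t, l t • a t = α := by
      funext x
      have h1 : c * β y₀ ≠ 0 := mul_ne_zero hc hβ
      simp only [Finset.sum_apply, Pi.smul_apply, smul_eq_mul, l, div_mul_eq_mul_div]
      rw [← Finset.sum_div, div_eq_iff h1]
      rw [show α x * (c * β y₀) = c * (α x * β y₀) by ring, ← h x y₀]
      exact Finset.sum_congr rfl fun t _ => mul_comm _ _
    refine ⟨(1 + ‖l‖)⁻¹, by positivity, ((1 + ‖l‖)⁻¹ : ℝ) • l, ?_, ?_⟩
    · rw [mem_closedBall_zero_iff, norm_smul, Real.norm_of_nonneg (by positivity),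
        inv_mul_le_iff₀ (by positivity)]
      linarith
    · simp only
      rw [← hl, Finset.smul_sum]
      refine Finset.sum_congr rfl fun t _ => ?_
      rw [smul_smul]
      rfl
  -- Doubling must leave the compact set. At the last scale s inside it, 2s fails for α, so duality
  -- gives the scale |c|/(2s) for β; the product of the two scales is |c|/2.
  have hunb : ∃ j : ℕ, ((2 ^ j * s₀ : ℝ) : ℂ) • α ∉ polydiscSpan a := by
    obtain ⟨B, hB⟩ := (isCompact_polydiscSpan a).isBounded.exists_norm_le
    have hαn : 0 < ‖α‖ := norm_pos_iff.mpr fun h => hα (by rw [h]; rfl)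
    obtain ⟨j, hj⟩ := pow_unbounded_of_one_lt (B / (s₀ * ‖α‖)) (one_lt_two)
    refine ⟨j, fun hmem => ?_⟩
    have h1 := hB _ hmem
    rw [norm_smul, Complex.norm_real, Real.norm_of_nonneg (by positivity)] at h1
    rw [div_lt_iff₀ (by positivity)] at hj
    linarith
  classical
  have hj := Nat.find_spec hunb
  have hj0 : Nat.find hunb ≠ 0 := by
    intro h1
    rw [h1, pow_zero, one_mul] at hj
    exact hj hmem₀
  obtain ⟨j, hj1⟩ := Nat.exists_eq_succ_of_ne_zero hj0
  have hmem : ((2 ^ j * s₀ : ℝ) : ℂ) • α ∈ polydiscSpan a := by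
    by_contra hcon
    exact Nat.find_min hunb (m := j) (by omega) hcon
  set s : ℝ := 2 ^ j * s₀ with hs
  have hspos : 0 < s := by positivity
  rw [hj1, pow_succ, mul_right_comm, ← hs] at hj
  have hcpos : 0 < ‖c‖ := norm_pos_iff.mpr hc
  have hmem' := (dual (s * 2) (‖c‖ / (s * 2)) (by positivity) (by positivity)
    (by field_simp)).resolve_left hj
  obtain ⟨l, hl, hl'⟩ := hmem
  obtain ⟨m, hm, hm'⟩ := hmem'
  rw [mem_closedBall_zero_iff] at hl hm
  refine ⟨fun t => c / ‖c‖ * l t, m, fun t => ?_, fun t => (norm_le_pi_norm m t).trans hm,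
    fun x y => ?_⟩
  · rw [norm_mul, norm_div, Complex.norm_real, norm_norm, div_self hcpos.ne', one_mul]
    exact (norm_le_pi_norm l t).trans hl
  · have h1 : ∑ t, l t * a t x = s * α x := by simpa using congrFun hl' x
    have h2 : ∑ t, m t * b t y = ((‖c‖ / (s * 2) : ℝ) : ℂ) * β y := by
      simpa using congrFun hm' y
    simp only [mul_assoc]
    rw [← Finset.mul_sum, h1, h2]
    push_cast
    have h3 : (s : ℂ) ≠ 0 := by exact_mod_cast hspos.ne'
    have h4 : (‖c‖ : ℂ) ≠ 0 := by exact_mod_cast hcpos.ne'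
    field_simp

end Spanner

/-! ### Vectors that are products across a bipartition -/

section Split

variable {ι κ μ : Fin k → Type} [∀ i, Fintype (ι i)] [∀ i, Fintype (κ i)] [∀ i, Fintype (μ i)]

/-- The product of a vector of the parties in `A` and a vector of the other parties. -/
def box (A : Finset (Fin k)) (a : (∀ i : {i // i ∈ A}, ι i) → ℂ)
    (b : (∀ i : {i // i ∉ A}, ι i) → ℂ) : (∀ i, ι i) → ℂ :=
  fun x => a (fun i => x i) * b (fun i => x i)

/-- The image of a vector of a family `e` of parties under a product operator. -/
def subOp {σ : Type} [Fintype σ] [DecidableEq σ] (e : σ → Fin k)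
    (U : ∀ i, Matrix (κ i) (ι i) ℂ) (a : (∀ s, ι (e s)) → ℂ) : (∀ s, κ (e s)) → ℂ :=
  fun y => ∑ x, (∏ s, U (e s) (y s) (x s)) * a x

/-- A vector that is a product across the bipartition into `A` and its complement. -/
def Split (A : Finset (Fin k)) (v : (∀ i, ι i) → ℂ) : Prop := ∃ a b, v = box A a b

theorem prodOp_box (A : Finset (Fin k)) (U : ∀ i, Matrix (κ i) (ι i) ℂ)
    (a : (∀ i : {i // i ∈ A}, ι i) → ℂ) (b : (∀ i : {i // i ∉ A}, ι i) → ℂ) :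
    prodOp U *ᵥ box A a b = box A (subOp Subtype.val U a) (subOp Subtype.val U b) := by
  ext y
  simp only [Matrix.mulVec, dotProduct, box, subOp]
  rw [Finset.sum_mul_sum, ← Fintype.sum_prod_type']
  refine Fintype.sum_equiv (Equiv.piEquivPiSubtypeProd (· ∈ A) ι) _ _ fun x => ?_
  simp only [prodOp, Equiv.piEquivPiSubtypeProd]
  have h := Fintype.prod_subtype_mul_prod_subtype (· ∈ A) (fun i => U i (y i) (x i))
  rw [← h]
  simp only [Equiv.coe_fn_mk]
  rw [mul_mul_mul_comm]
  congr!

theorem Split.prodOp {A : Finset (Fin k)} {v : (∀ i, ι i) → ℂ} (h : Split A v)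
    (U : ∀ i, Matrix (κ i) (ι i) ℂ) : Split A (prodOp U *ᵥ v) := by
  obtain ⟨a, b, rfl⟩ := h
  exact ⟨_, _, prodOp_box A U a b⟩

theorem Split.smul {A : Finset (Fin k)} {v : (∀ i, ι i) → ℂ} (h : Split A v) (c : ℂ) :
    Split A (c • v) := by
  obtain ⟨a, b, rfl⟩ := h
  refine ⟨c • a, b, ?_⟩
  ext x
  simp [box, mul_assoc]

theorem Split.tens {A : Finset (Fin k)} {v : (∀ i, ι i) → ℂ} {w : (∀ i, κ i) → ℂ}
    (h : Split A v) (h' : Split A w) : Split A (tens v w) := by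
  obtain ⟨a, b, rfl⟩ := h
  obtain ⟨a', b', rfl⟩ := h'
  refine ⟨fun x => a (fun i => (x i).1) * a' (fun i => (x i).2),
    fun x => b (fun i => (x i).1) * b' (fun i => (x i).2), ?_⟩
  ext x
  simp only [box, LOCC.tens]
  ring

theorem Split.tpow {A : Finset (Fin k)} {ψ : PureState k} (h : Split A ψ.vec) (n : ℕ) :
    Split A (ψ.tpow n).vec := by
  induction n with
  | zero => exact ⟨fun _ => 1, fun _ => 1, by ext x; simp [box, PureState.tpow, PureState.one]⟩
  | succ n ih =>
    have e : (ψ.tpow (n + 1)).vec = tensorVec (ψ.tpow n).vec ψ.vec := rfl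
    rw [e, S.tensorVec_eq]
    exact (ih.tens h).prodOp _

/-! ### Separating an index shared across a bipartition -/

variable {T : Type} [Fintype T] [DecidableEq T]

/-- The register contents in which `p` holds `t`, `q` holds `t'`, and the others hold `z`. -/
def marks (p q : Fin k) (z t t' : T) : Fin k → T :=
  fun r => if r = p then t else if r = q then t' else z

/-- The vector `∑ t t', |t⟩_p |t'⟩_q ⊗ a_t ⊗ b_t'`. -/
def copyVec (A : Finset (Fin k)) (p q : Fin k) (z : T) (a : T → (∀ i : {i // i ∈ A}, ι i) → ℂ)
    (b : T → (∀ i : {i // i ∉ A}, ι i) → ℂ) : (∀ i, ι i × T) → ℂ :=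
  ∑ t, ∑ t', tens (box A (a t) (b t')) (Pi.single (M := fun _ => ℂ) (marks p q z t t') 1)

theorem prodOp_copyVec (A : Finset (Fin k)) (p q : Fin k) (z : T)
    (U : ∀ i, Matrix (κ i) (ι i) ℂ)
    (a : T → (∀ i : {i // i ∈ A}, ι i) → ℂ) (b : T → (∀ i : {i // i ∉ A}, ι i) → ℂ) :
    prodOp (fun i => U i ⊗ₖ (1 : Matrix T T ℂ)) *ᵥ copyVec A p q z a b =
      copyVec A p q z (fun t => subOp Subtype.val U (a t))
        (fun t => subOp Subtype.val U (b t)) := by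
  simp only [copyVec, Matrix.mulVec_sum, prodOp_tens, prodOp_box]
  rw [prodOp_one]
  simp only [Matrix.one_mulVec]

theorem prodOp_site_copyVec (A : Finset (Fin k)) (p q : Fin k) (z : T) (i : Fin k)
    (K : Matrix (ι i) (ι i) ℂ)
    (a : T → (∀ i : {i // i ∈ A}, ι i) → ℂ) (b : T → (∀ i : {i // i ∉ A}, ι i) → ℂ) :
    prodOp (site (ι := fun i => ι i × T) i (K ⊗ₖ (1 : Matrix T T ℂ))) *ᵥ copyVec A p q z a b =
      copyVec A p q z (fun t => subOp Subtype.val (site i K) (a t))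
        (fun t => subOp Subtype.val (site i K) (b t)) := by
  simp only [copyVec, Matrix.mulVec_sum]
  refine Finset.sum_congr rfl fun t _ => Finset.sum_congr rfl fun t' _ => ?_
  rw [← prodOp_box]
  exact prodOp_site_kronecker_one (κ := fun _ => T) i K _ _

/-- Contracting the register against `g` is a contraction by Cauchy–Schwarz. -/
theorem IsContr.mul_vec {α β : Type} [Fintype α] [Fintype β] {U : Matrix β α ℂ}
    (hU : IsContr U) {g : T → ℂ} (hg : nsq g ≤ 1) :
    IsContr (fun y (x : α × T) => U y x.1 * g x.2 : Matrix β (α × T) ℂ) := by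
  classical
  intro v
  have h1 : ((fun y (x : α × T) => U y x.1 * g x.2 : Matrix β (α × T) ℂ) *ᵥ v) =
      U *ᵥ (fun x => ∑ s, g s * v (x, s)) := by
    ext y
    simp only [Matrix.mulVec, dotProduct, Fintype.sum_prod_type, Finset.mul_sum, mul_assoc]
  rw [h1]
  refine (hU _).trans ?_
  have h2 : ∀ x, ‖∑ s, g s * v (x, s)‖ ^ 2 ≤ ∑ s, ‖v (x, s)‖ ^ 2 := by
    intro x
    have h3 := S.nsq_mulVec_le (fun (_ : Unit) s => g s) (fun s => v (x, s))
    simp only [nsq, Matrix.mulVec, dotProduct, Finset.univ_unique, Finset.sum_singleton] at h3 hg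
    refine h3.trans ?_
    exact mul_le_of_le_one_left (by positivity) hg
  refine (Finset.sum_le_sum fun x _ => h2 x).trans (le_of_eq ?_)
  rw [nsq, Fintype.sum_prod_type]

theorem prodOp_mul_vec_single (U : ∀ i, Matrix (κ i) (ι i) ℂ) (g : Fin k → T → ℂ)
    (v : (∀ i, ι i) → ℂ) (m : Fin k → T) :
    LOCC.prodOp (fun i => (fun y (x : ι i × T) => U i y x.1 * g i x.2 :
        Matrix (κ i) (ι i × T) ℂ)) *ᵥ LOCC.tens v (Pi.single (M := fun _ => ℂ) m 1) =
      (∏ i, g i (m i)) • (LOCC.prodOp U *ᵥ v) := by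
  ext y
  simp only [Matrix.mulVec, dotProduct, Pi.smul_apply, smul_eq_mul, Finset.mul_sum]
  symm
  refine Fintype.sum_of_injective (fun x i => (x i, m i)) ?_ _ _ ?_ ?_
  · intro x x' h
    funext i
    exact congrArg Prod.fst (congrFun h i)
  · intro x hx
    have : (fun i => (x i).2) ≠ m := by
      rintro rfl
      exact hx ⟨fun i => (x i).1, rfl⟩
    simp [LOCC.tens, this]
  · intro x
    simp only [LOCC.prodOp, LOCC.tens, Pi.single_eq_same, Finset.prod_mul_distrib]
    ring

theorem box_sum (A : Finset (Fin k)) (l m : T → ℂ) (a : T → (∀ i : {i // i ∈ A}, ι i) → ℂ)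
    (b : T → (∀ i : {i // i ∉ A}, ι i) → ℂ) (y : ∀ i, ι i) :
    ∑ t, ∑ t', l t * m t' * box A (a t) (b t') y =
      (∑ t, l t * a t (fun i => y i)) * (∑ t, m t * b t (fun i => y i)) := by
  rw [Finset.sum_mul_sum]
  refine Finset.sum_congr rfl fun t _ => Finset.sum_congr rfl fun t' _ => ?_
  simp only [box]
  ring

/-- A coherent sum of vectors that are products across a bipartition can be replaced by independent
sums on the two sides, provided that both sides keep a copy of the index. -/
theorem Reach.copyVec {A : Finset (Fin k)} {p q : Fin k} (hp : p ∈ A) (hq : q ∉ A) (z : T)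
    {w : (∀ i, κ i) → ℂ} {P : ℝ} {v : (∀ i, ι i) → ℂ} (h : Reach w P v)
    {wA : (∀ i : {i // i ∈ A}, κ i) → ℂ} {wB : (∀ i : {i // i ∉ A}, κ i) → ℂ}
    (hw : w = box A wA wB)
    (a : T → (∀ i : {i // i ∈ A}, ι i) → ℂ) (b : T → (∀ i : {i // i ∉ A}, ι i) → ℂ)
    (hv : v = ∑ t, box A (a t) (b t)) :
    Reach w (P / (2 * Fintype.card T) ^ 2) (copyVec A p q z a b) := by
  induction h generalizing a b with
  | leaf U hU c v h =>
    set D : ℝ := (Fintype.card T : ℝ) with hD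
    have hD0 : 0 < D := by
      have : 0 < Fintype.card T := Fintype.card_pos_iff.mpr ⟨z⟩
      rw [hD]
      exact_mod_cast this
    set a' := fun t => subOp Subtype.val U (a t) with ha'
    set b' := fun t => subOp Subtype.val U (b t) with hb'
    have h1 : ∑ t, box A (a' t) (b' t) = c • box A wA wB := by
      rw [← hw, ← h, hv, Matrix.mulVec_sum]
      simp only [prodOp_box, ha', hb']
    have h2 : ∀ x y, ∑ t, a' t x * b' t y = c * (wA x * wB y) := by
      intro x y
      have h3 := congrFun h1 (fun i => if hi : i ∈ A then x ⟨i, hi⟩ else y ⟨i, hi⟩)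
      simp only [Finset.sum_apply, box, Pi.smul_apply, smul_eq_mul] at h3
      have e1 : (fun i : {i // i ∈ A} => if hi : (i : Fin k) ∈ A then x ⟨i, hi⟩ else y ⟨i, hi⟩)
          = x := by
        funext i
        simp [i.2]
      have e2 : (fun i : {i // i ∉ A} => if hi : (i : Fin k) ∈ A then x ⟨i, hi⟩ else y ⟨i, hi⟩)
          = y := by
        funext i
        simp [i.2]
      rw [e1, e2] at h3
      exact h3
    -- Parties `p` and `q` contract their registers against l/√D and m/√D, vectors of norm at most 1
    -- since the coefficients are bounded by 1; the others read off `z`. The amplitude becomes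
    -- c/(2D), which is the source of the divisor (2D)².
    obtain ⟨l, m, hl, hm, hlm⟩ := exists_balanced_factorization h2
    let r : ℂ := ((Real.sqrt D)⁻¹ : ℝ)
    let g : Fin k → T → ℂ := fun i => if i = p then r • l else if i = q then r • m
      else Pi.single z 1
    have hr : ‖r‖ ^ 2 = D⁻¹ := by
      simp only [r]
      rw [Complex.norm_real, Real.norm_eq_abs, sq_abs, inv_pow, Real.sq_sqrt hD0.le]
    have hr' : r * r = ((D⁻¹ : ℝ) : ℂ) := by
      simp only [r]
      rw [← Complex.ofReal_mul, ← mul_inv, Real.mul_self_sqrt hD0.le]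
    have hbound : ∀ l : T → ℂ, (∀ t, ‖l t‖ ≤ 1) → nsq (r • l) ≤ 1 := by
      intro l hl
      rw [nsq_smul, hr, inv_mul_le_iff₀ hD0, mul_one, hD, nsq]
      refine (Finset.sum_le_sum fun t _ => pow_le_one₀ (n := 2) (norm_nonneg _) (hl t)).trans ?_
      simp
    have hg : ∀ i, nsq (g i) ≤ 1 := by
      intro i
      simp only [g]
      split_ifs
      · exact hbound l hl
      · exact hbound m hm
      · rw [nsq, Finset.sum_eq_single z]
        · simp
        · intro t _ ht; simp [ht]
        · simp
    have hpq : p ≠ q := fun h => hq (h ▸ hp)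
    have hprod : ∀ t t', ∏ i, g i (marks p q z t t' i) = r * r * (l t * m t') := by
      intro t t'
      rw [Finset.prod_eq_mul p q hpq]
      · simp only [g, marks, if_true, hpq.symm, if_false, Pi.smul_apply, smul_eq_mul]
        ring
      · intro i _ hi
        simp [g, marks, hi.1, hi.2]
      · simp
      · simp
    have hcn : ‖c * ((D⁻¹ : ℝ) : ℂ) / 2‖ ^ 2 = ‖c‖ ^ 2 / (2 * D) ^ 2 := by
      rw [norm_div, norm_mul, Complex.norm_real, Real.norm_of_nonneg (inv_nonneg.mpr hD0.le)]
      simp only [RCLike.norm_ofNat]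
      field_simp
    rw [← hcn]
    refine Reach.leaf (fun i => fun y (x : ι i × T) => U i y x.1 * g i x.2)
      (fun i => (hU i).mul_vec (hg i)) _ _ ?_
    ext y
    simp only [LOCC.copyVec, Matrix.mulVec_sum, prodOp_mul_vec_single, hprod, prodOp_box,
      Finset.sum_apply, Pi.smul_apply, smul_eq_mul]
    have e : ∀ t t', r * r * (l t * m t') * box A (subOp Subtype.val U (a t))
        (subOp Subtype.val U (b t')) y = r * r * (l t * m t' * box A (a' t) (b' t') y) :=
      fun t t' => mul_assoc _ _ _
    simp only [e, ← Finset.mul_sum]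
    rw [box_sum, hlm, hr', hw]
    simp only [box]
    ring
  -- The same local measurement serves both vectors: it acts termwise on the products and leaves the
  -- copies of the index alone.
  | step i J K hK P v h ih =>
    rw [Finset.sum_div]
    refine Reach.step (ι := fun i => ι i × T) i J (fun j => K j ⊗ₖ (1 : Matrix T T ℂ))
      hK.kronecker_one _ _ fun j => ?_
    rw [prodOp_site_copyVec]
    refine ih j _ _ ?_
    rw [hv, Matrix.mulVec_sum]
    simp only [prodOp_box]

theorem Conv.copyVec {A : Finset (Fin k)} {p q : Fin k} (hp : p ∈ A) (hq : q ∉ A) (z : T)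
    {w : (∀ i, κ i) → ℂ} {v : (∀ i, ι i) → ℂ} (h : Conv v w) (hw : Split A w)
    (a : T → (∀ i : {i // i ∈ A}, ι i) → ℂ) (b : T → (∀ i : {i // i ∉ A}, ι i) → ℂ)
    (hv : v = ∑ t, box A (a t) (b t)) :
    Conv (((2 * Fintype.card T : ℝ) : ℂ) • copyVec A p q z a b) w := by
  obtain ⟨ν, _, W, hW, hr⟩ := h
  obtain ⟨wA, wB, hw⟩ := hw
  have hD : (0 : ℝ) < 2 * Fintype.card T := by
    have : 0 < Fintype.card T := Fintype.card_pos_iff.mpr ⟨z⟩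
    positivity
  have h1 := hr.copyVec hp hq z hw (fun t => subOp Subtype.val W (a t))
    (fun t => subOp Subtype.val W (b t)) (by
      rw [hv, Matrix.mulVec_sum]
      simp only [prodOp_box])
  have h2 := h1.smul ((2 * Fintype.card T : ℝ) : ℂ)
  rw [Complex.norm_real, Real.norm_eq_abs, sq_abs, mul_one_div_cancel (by positivity)] at h2
  refine ⟨fun i => ν i × T, inferInstance, fun i => W i ⊗ₖ (1 : Matrix T T ℂ),
    fun i => (hW i).kronecker_one, ?_⟩
  rwa [Matrix.mulVec_smul, prodOp_copyVec]

end Split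

end LOCC

namespace LOCC

variable {k : ℕ}

/-! ### Splitting a GHZ state into GHZ states of two groups of parties -/

theorem gvec_of_mem {T : Finset (Fin k)} {p : Fin k} (hp : p ∈ T) (n : ℕ) (x : Fin k → Fin n) :
    gvec T n x = open Classical in if ∀ i ∈ T, x i = x p then 1 else 0 := by
  classical
  simp only [gvec]
  congr 1
  exact propext ⟨fun h i hi => h i hi p hp, fun h i hi j hj => (h i hi).trans (h j hj).symm⟩

theorem gvec_congr {T : Finset (Fin k)} {n : ℕ} {x y : Fin k → Fin n} (h : ∀ i ∈ T, x i = y i) :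
    gvec T n x = gvec T n y := by
  classical
  simp only [gvec]
  congr 1
  refine propext ⟨fun h' i hi j hj => ?_, fun h' i hi j hj => ?_⟩
  · rw [← h i hi, ← h j hj]; exact h' i hi j hj
  · rw [h i hi, h j hj]; exact h' i hi j hj

section Peel

variable {κ : Fin k → Type} {D : ℕ} {A T : Finset (Fin k)}

/-- The part on `A` of a term of the product of a GHZ vector with a product vector. -/
def termIn (A : Finset (Fin k)) (vA : (∀ i : {i // i ∈ A}, κ i) → ℂ) (t : Fin D) :
    (∀ i : {i // i ∈ A}, Fin D × κ i) → ℂ :=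
  fun x => (open Classical in if ∀ i, (x i).1 = t then 1 else 0) * vA fun i => (x i).2

/-- The part off `A` of a term of the product of a GHZ vector of `T` with a product vector. -/
def termOut (A T : Finset (Fin k)) (vB : (∀ i : {i // i ∉ A}, κ i) → ℂ) (t : Fin D) :
    (∀ i : {i // i ∉ A}, Fin D × κ i) → ℂ :=
  fun x => (open Classical in if ∀ i, i.1 ∈ T → (x i).1 = t then 1 else 0) * vB fun i => (x i).2

theorem tens_gvec_box {p : Fin k} (hp : p ∈ A) (hA : A ⊆ T)
    (vA : (∀ i : {i // i ∈ A}, κ i) → ℂ) (vB : (∀ i : {i // i ∉ A}, κ i) → ℂ) :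
    tens (gvec T D) (box A vA vB) = ∑ t, box A (termIn A vA t) (termOut A T vB t) := by
  classical
  ext x
  rw [Finset.sum_apply, Fintype.sum_eq_single (x p).1]
  · simp only [tens, box, termIn, termOut, gvec_of_mem (hA hp)]
    have : (∀ i ∈ T, (x i).1 = (x p).1) ↔ (∀ i : {i // i ∈ A}, (x i).1 = (x p).1) ∧
        ∀ i : {i // i ∉ A}, i.1 ∈ T → (x i).1 = (x p).1 := by
      refine ⟨fun h => ⟨fun i => h i (hA i.2), fun i hi => h i hi⟩, fun h i hi => ?_⟩
      by_cases hiA : i ∈ A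
      · exact h.1 ⟨i, hiA⟩
      · exact h.2 ⟨i, hiA⟩ hi
    simp only [this]
    by_cases h1 : ∀ i : {i // i ∈ A}, (x i).1 = (x p).1
    · by_cases h2 : ∀ i : {i // i ∉ A}, i.1 ∈ T → (x i).1 = (x p).1
      · rw [if_pos ⟨h1, h2⟩, if_pos h1, if_pos h2]; ring
      · rw [if_neg (fun h => h2 h.2), if_neg h2]; ring
    · rw [if_neg (fun h => h1 h.1), if_neg h1]; ring
  · intro t ht
    have : ¬ ∀ i : {i // i ∈ A}, (x i).1 = t := fun h => ht (h ⟨p, hp⟩).symm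
    simp only [box, termIn, if_neg this]
    ring

/-- With the index of each side read off independently, at `p` and at `q`, the GHZ vector of `T`
falls apart into GHZ vectors of `A` and of `T \ A`. -/
theorem box_term {p q : Fin k} (hp : p ∈ A) (hq : q ∉ A) (hqT : q ∈ T)
    (vA : (∀ i : {i // i ∈ A}, κ i) → ℂ) (vB : (∀ i : {i // i ∉ A}, κ i) → ℂ)
    (x : ∀ i, Fin D × κ i) :
    box A (termIn A vA (x p).1) (termOut A T vB (x q).1) x =
      gvec A D (fun i => (x i).1) * gvec (T \ A) D (fun i => (x i).1) *
        box A vA vB (fun i => (x i).2) := by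
  classical
  have e1 : (∀ i : {i // i ∈ A}, (x i).1 = (x p).1) ↔ ∀ i ∈ A, (x i).1 = (x p).1 :=
    ⟨fun h i hi => h ⟨i, hi⟩, fun h i => h i i.2⟩
  have e2 : (∀ i : {i // i ∉ A}, i.1 ∈ T → (x i).1 = (x q).1) ↔
      ∀ i ∈ T \ A, (x i).1 = (x q).1 :=
    ⟨fun h i hi => h ⟨i, (Finset.mem_sdiff.mp hi).2⟩ (Finset.mem_sdiff.mp hi).1,
      fun h i hi => h i (Finset.mem_sdiff.mpr ⟨hi, i.2⟩)⟩
  rw [gvec_of_mem hp, gvec_of_mem (Finset.mem_sdiff.mpr ⟨hqT, hq⟩)]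
  simp only [box, termIn, termOut, e1, e2]
  ring

/-- The marks held by `p` and `q` are local copies of their GHZ index and all other marks are
constant, so the marked vector is prepared by local isometries. -/
theorem copyVec_term [∀ i, Fintype (κ i)] {p q : Fin k} (hp : p ∈ A) (hq : q ∉ A) (hqT : q ∈ T)
    (z : Fin D) (vA : (∀ i : {i // i ∈ A}, κ i) → ℂ) (vB : (∀ i : {i // i ∉ A}, κ i) → ℂ) :
    copyVec A p q z (termIn A vA) (termOut A T vB) =
      prodOp (fun r => emb fun x : Fin D × κ r => (x, if r = p ∨ r = q then x.1 else z)) *ᵥ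
        fun x : ∀ i, Fin D × κ i => gvec A D (fun i => (x i).1) *
          gvec (T \ A) D (fun i => (x i).1) * box A vA vB (fun i => (x i).2) := by
  classical
  have hpq : p ≠ q := fun h => hq (h ▸ hp)
  ext y
  have hy : copyVec A p q z (termIn A vA) (termOut A T vB) y =
      ∑ t, ∑ t', box A (termIn A vA t) (termOut A T vB t') (fun i => (y i).1) *
        (if (fun i => (y i).2) = marks p q z t t' then 1 else 0) := by
    simp only [copyVec, Finset.sum_apply, tens, Pi.single_apply]
  rw [hy]
  by_cases h : ∀ r, (y r).2 = if r = p ∨ r = q then (y r).1.1 else z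
  · have e : y = fun r => ((y r).1, if r = p ∨ r = q then (y r).1.1 else z) := by
      funext r
      exact Prod.ext rfl (h r)
    conv_rhs => rw [e]
    rw [prodOp_emb_apply (e := fun r (x : Fin D × κ r) => (x, if r = p ∨ r = q then x.1 else z))
      (fun r x x' hx => congrArg Prod.fst hx) _ (fun i => (y i).1),
      Fintype.sum_eq_single (y p).1.1, Fintype.sum_eq_single (y q).1.1]
    · rw [box_term (x := fun i => (y i).1) hp hq hqT, if_pos, mul_one]
      funext r
      rw [h r, marks]
      by_cases h1 : r = p
      · subst h1; simp
      · by_cases h2 : r = q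
        · subst h2; simp [hpq.symm]
        · simp [h1, h2]
    · intro t' ht'
      rw [if_neg, mul_zero]
      intro hm
      have := congrFun hm q
      rw [h q] at this
      simp [marks, hpq.symm] at this
      exact ht' this.symm
    · intro t ht
      refine Finset.sum_eq_zero fun t' _ => ?_
      rw [if_neg, mul_zero]
      intro hm
      have := congrFun hm p
      rw [h p] at this
      simp [marks] at this
      exact ht this.symm
  · push Not at h
    obtain ⟨r, hr⟩ := h
    rw [prodOp_emb_apply_eq_zero
      (e := fun r (x : Fin D × κ r) => (x, if r = p ∨ r = q then x.1 else z)) (i := r)]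
    · refine Finset.sum_eq_zero fun t _ => Finset.sum_eq_zero fun t' _ => ?_
      by_cases hm : (fun i => (y i).2) = marks p q z t t'
      · have h1 := congrFun hm r
        simp only [marks] at h1
        by_cases hrp : r = p
        · subst hrp
          simp only [true_or, if_true] at hr h1
          have : ¬ ∀ i : {i // i ∈ A}, (y i).1.1 = t := fun h2 => hr (by rw [h1, h2 ⟨r, hp⟩])
          simp only [box, termIn, if_neg this]
          ring
        · by_cases hrq : r = q
          · subst hrq
            simp only [or_true, if_true, hrp, if_false] at hr h1
            have : ¬ ∀ i : {i // i ∉ A}, i.1 ∈ T → (y i).1.1 = t' :=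
              fun h2 => hr (by rw [h1, h2 ⟨r, hq⟩ hqT])
            simp only [box, termOut, if_neg this]
            ring
          · simp only [hrp, hrq, or_self, if_false] at hr h1
            exact absurd h1 hr
      · rw [if_neg hm, mul_zero]
    · rintro ⟨x, hx⟩
      refine hr ?_
      rw [← hx]

end Peel

namespace S

open PureState

/-- A GHZ state shared by two groups of parties can be replaced by a GHZ state for each group, if
the other states are products across the groups. -/
theorem le_ghz_mul_ghz (hk : 1 ≤ k) {A T : Finset (Fin k)} {p q : Fin k} (hp : p ∈ A)
    (hA : A ⊆ T) (hq : q ∈ T \ A) {D : ℕ} (hD : 1 ≤ D) {φ χ : PureState k}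
    (hφ : Split A φ.vec) (hχ : Split A χ.vec) (h : le (cls φ) (cls (ghz T D) * cls χ)) :
    le (cls φ) (sc k (2 * D) * (cls (ghz A D) * cls (ghz (T \ A) D) * cls χ)) := by
  classical
  obtain ⟨vA, vB, hv⟩ := hχ
  obtain ⟨hqT, hqA⟩ := Finset.mem_sdiff.mp hq
  let z : Fin D := ⟨0, hD⟩
  have h1 : Conv (tens (gvec T D) χ.vec) φ.vec :=
    (Converts.conv hk (ψ := (ghz T D).tensor χ) (φ := φ) h).precomp
      (fun _ => isContr_emb_equiv _) (tensorVec_eq (gvec T D) χ.vec).symm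
  have h2 := h1.copyVec hp hqA z hφ _ _ (by rw [hv, tens_gvec_box hp hA])
  rw [copyVec_term hp hqA hqT, Fintype.card_fin] at h2
  -- Each party is in only one of the two groups. Its register for the other GHZ state is projected
  -- onto `z`, where that vector has amplitude 1 because it is constant in the index of an outside
  -- party.
  let F : ∀ r, Fin D × Fin (χ.dim r) → Fin (D * D * χ.dim r) := fun r x =>
    finProdFinEquiv (finProdFinEquiv (if r ∈ A then (x.1, z) else (z, x.1)), x.2)
  have hF : ∀ r, Function.Injective (F r) := by
    intro r x x' hx
    simp only [F, EmbeddingLike.apply_eq_iff_eq, Prod.mk.injEq] at hx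
    obtain ⟨h3, h4⟩ := hx
    refine Prod.ext ?_ h4
    split_ifs at h3 <;> simpa using h3
  have h3 : prodOp (fun r => (emb (F r))ᴴ) *ᵥ
      tensorVec (tensorVec (gvec A D) (gvec (T \ A) D)) χ.vec =
      fun x : ∀ i, Fin D × Fin (χ.dim i) => gvec A D (fun i => (x i).1) *
          gvec (T \ A) D (fun i => (x i).1) * box A vA vB (fun i => (x i).2) := by
    ext x
    rw [prodOp_conj_emb]
    simp only [tensorVec, F, Equiv.symm_apply_apply]
    rw [hv, gvec_congr (T := A) (y := fun i => (x i).1) (fun i hi => by simp [hi]),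
      gvec_congr (T := T \ A) (y := fun i => (x i).1)
        (fun i hi => by simp [(Finset.mem_sdiff.mp hi).2])]
  rw [← h3, prodOp_mulVec_mulVec, ← Matrix.mulVec_smul] at h2
  have h4 := h2.precomp (u := (((2 * D : ℝ) : ℂ) •
    tensorVec (tensorVec (gvec A D) (gvec (T \ A) D)) χ.vec)) (fun r => ?_) rfl
  · have e : cls (ghz A D) * cls (ghz (T \ A) D) * cls χ =
      cls (((ghz A D).tensor (ghz (T \ A) D)).tensor χ) := rfl
    rw [e, sc_mul_cls]
    exact Conv.converts
      (ψ := (((ghz A D).tensor (ghz (T \ A) D)).tensor χ).scale (2 * D)) h4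
  · refine IsContr.mul (isContr_emb fun x x' hx => congrArg Prod.fst hx)
      (isContr_emb_conjTranspose (hF r))

end S

end LOCC

namespace LOCC

variable {k : ℕ}

/-! ### Entanglement between two parties -/

section Minor

variable {ι : Fin k → Type} {A : Finset (Fin k)}

/-- The index that agrees with `x` on `A` and with `y` off `A`. -/
def mix (A : Finset (Fin k)) (x y : ∀ i, ι i) : ∀ i, ι i := fun i => if i ∈ A then x i else y i

theorem mix_mix_left (x y z : ∀ i, ι i) : mix A (mix A x y) z = mix A x z := by
  funext i
  simp only [mix]
  split_ifs <;> rfl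

theorem mix_mix_right (x y z : ∀ i, ι i) : mix A x (mix A y z) = mix A x z := by
  funext i
  simp only [mix]
  split_ifs <;> rfl

theorem mix_self (x : ∀ i, ι i) : mix A x x = x := by
  funext i
  simp [mix]

theorem eq_mix {x y z : ∀ i, ι i} (h : ∀ i ∈ A, z i = x i) (h' : ∀ i ∉ A, z i = y i) :
    z = mix A x y := by
  funext i
  simp only [mix]
  split_ifs with hi
  exacts [h i hi, h' i hi]

/-- Vanishing 2×2 minors mean rank at most one: a nonzero entry `x₀` gives v(y) as the product of
the entries with one half of y replaced by that of `x₀`, divided by v(x₀). -/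
theorem split_of_minors {v : (∀ i, ι i) → ℂ}
    (h : ∀ x y, v x * v y = v (mix A x y) * v (mix A y x)) : Split A v := by
  classical
  by_cases h0 : v = 0
  · exact ⟨0, 0, by rw [h0]; ext x; simp [box]⟩
  obtain ⟨x₀, hx₀⟩ := Function.ne_iff.mp h0
  rw [Pi.zero_apply] at hx₀
  refine ⟨fun u => v fun i => if hi : i ∈ A then u ⟨i, hi⟩ else x₀ i,
    fun u => v (fun i => if hi : i ∈ A then x₀ i else u ⟨i, hi⟩) / v x₀, ?_⟩
  ext y
  have h1 := h x₀ y
  simp only [box, dite_eq_ite]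
  rw [← mul_div_assoc, eq_div_iff hx₀, mul_comm, h1, mul_comm]
  rfl

/-- The number of parties at which two indices differ. -/
def diffCard (x y : ∀ i, ι i) : ℕ :=
  open Classical in (Finset.univ.filter fun i => x i ≠ y i).card

theorem diffCard_lt {x y x' y' : ∀ i, ι i} (h : ∀ i, x' i ≠ y' i → x i ≠ y i) {i : Fin k}
    (hi : x i ≠ y i) (hi' : x' i = y' i) : diffCard x' y' < diffCard x y := by
  classical
  refine Finset.card_lt_card (Finset.ssubset_iff_of_subset ?_ |>.mpr ⟨i, ?_, ?_⟩)
  · intro j hj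
    simp only [Finset.mem_filter, Finset.mem_univ, true_and] at hj ⊢
    exact h j hj
  · simpa using hi
  · simpa using hi'

/-- In the cube spanned by a closest pair of indices with a nonzero minor, a vector is supported on
the four corners of the minor. -/
theorem eq_zero_of_closest_minor {v : (∀ i, ι i) → ℂ} {x y : ∀ i, ι i}
    (hxy : v x * v y ≠ v (mix A x y) * v (mix A y x))
    (hmin : ∀ x' y', diffCard x' y' < diffCard x y →
      v x' * v y' = v (mix A x' y') * v (mix A y' x'))
    {z : ∀ i, ι i} (hz : ∀ i, z i = x i ∨ z i = y i) (h1 : z ≠ x) (h2 : z ≠ y)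
    (h3 : z ≠ mix A x y) (h4 : z ≠ mix A y x) : v z = 0 := by
  have hdet : v x * v y - v (mix A x y) * v (mix A y x) ≠ 0 := sub_ne_zero.mpr hxy
  have same : ∀ r, x r = y r → z r = y r := fun r h => (hz r).elim (·.trans h) id
  -- If z lies strictly between x and y on `A`, the two pairs used here are closer than (x, y), so
  -- their minors vanish. This is a homogeneous linear system for the two mixed values whose
  -- determinant is the nonzero minor.
  have inner : (∃ i ∈ A, z i ≠ x i) → (∃ i ∈ A, z i ≠ y i) →
      v (mix A z x) = 0 ∧ v (mix A z y) = 0 := by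
    rintro ⟨i, hi, hix⟩ ⟨j, hj, hjy⟩
    have hzi : z i = y i := (hz i).resolve_left hix
    have hzj : z j = x j := (hz j).resolve_right hjy
    have e1 := hmin x (mix A z y) (diffCard_lt (i := j)
      (fun r hr h => hr (by simp [mix, same r h, h])) (hzj ▸ hjy) (by simp [mix, hj, hzj]))
    have e2 := hmin (mix A z x) y (diffCard_lt (i := i)
      (fun r hr h => hr (by simp [mix, same r h, h])) (fun h => hix (hzi.trans h.symm))
      (by simp [mix, hi, hzi]))
    simp only [mix_mix_left, mix_mix_right] at e1 e2
    constructor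
    · refine (mul_eq_zero.mp ?_).resolve_right hdet
      linear_combination v x * e2 + v (mix A y x) * e1
    · refine (mul_eq_zero.mp ?_).resolve_right hdet
      linear_combination v y * e1 + v (mix A x y) * e2
  have outer : (∃ i ∉ A, z i ≠ x i) → (∃ i ∉ A, z i ≠ y i) →
      v (mix A x z) = 0 ∧ v (mix A y z) = 0 := by
    rintro ⟨i, hi, hix⟩ ⟨j, hj, hjy⟩
    have hzi : z i = y i := (hz i).resolve_left hix
    have hzj : z j = x j := (hz j).resolve_right hjy
    have e1 := hmin x (mix A y z) (diffCard_lt (i := j)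
      (fun r hr h => hr (by simp [mix, same r h, h])) (hzj ▸ hjy) (by simp [mix, hj, hzj]))
    have e2 := hmin (mix A x z) y (diffCard_lt (i := i)
      (fun r hr h => hr (by simp [mix, same r h, h])) (fun h => hix (hzi.trans h.symm))
      (by simp [mix, hi, hzi]))
    simp only [mix_mix_left, mix_mix_right] at e1 e2
    constructor
    · refine (mul_eq_zero.mp ?_).resolve_right hdet
      linear_combination v x * e2 + v (mix A x y) * e1
    · refine (mul_eq_zero.mp ?_).resolve_right hdet
      linear_combination v y * e1 + v (mix A y x) * e2
  by_cases hin : (∃ i ∈ A, z i ≠ x i) ∧ ∃ i ∈ A, z i ≠ y i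
  · have g1 := inner hin.1 hin.2
    by_cases hout : (∃ i ∉ A, z i ≠ x i) ∧ ∃ i ∉ A, z i ≠ y i
    · obtain ⟨-, j, hj, hjy⟩ := hin
      have hzj : z j = x j := (hz j).resolve_right hjy
      have e1 := hmin x z (diffCard_lt (i := j)
        (fun r hr h => hr (by rw [same r h, h])) (hzj ▸ hjy) hzj.symm)
      have e2 := hmin (mix A x y) z (diffCard_lt (i := j)
        (fun r hr h => hr (by simp [mix, same r h, h])) (hzj ▸ hjy) (by simp [mix, hj, hzj]))
      simp only [mix_mix_left, mix_mix_right] at e1 e2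
      rw [g1.1, mul_zero] at e1
      rw [g1.2, mul_zero] at e2
      refine (mul_eq_zero.mp ?_).resolve_right hdet
      linear_combination v y * e1 - v (mix A y x) * e2
    · rw [not_and_or] at hout
      push Not at hout
      rcases hout with hout | hout
      · rw [eq_mix (fun _ _ => rfl) hout]
        exact g1.1
      · rw [eq_mix (fun _ _ => rfl) hout]
        exact g1.2
  · rw [not_and_or] at hin
    push Not at hin
    by_cases hout : (∃ i ∉ A, z i ≠ x i) ∧ ∃ i ∉ A, z i ≠ y i
    · have g1 := outer hout.1 hout.2
      rcases hin with hin | hin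
      · rw [eq_mix hin fun _ _ => rfl]
        exact g1.1
      · rw [eq_mix hin fun _ _ => rfl]
        exact g1.2
    · rw [not_and_or] at hout
      push Not at hout
      rcases hin with hin | hin <;> rcases hout with hout | hout
      · exact absurd ((eq_mix hin hout).trans (mix_self x)) h1
      · exact absurd (eq_mix hin hout) h3
      · exact absurd (eq_mix hin hout) h4
      · exact absurd ((eq_mix hin hout).trans (mix_self y)) h2

/-- A vector that is not a product across a bipartition can be projected by a product operator to a
pair of entangled qubits shared across the bipartition. -/
theorem exists_prodOp_eq_gvec_pair [∀ i, Fintype (ι i)] {v : (∀ i, ι i) → ℂ} (h : ¬ Split A v) :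
    ∃ i ∈ A, ∃ j ∉ A, ∃ K : ∀ r, Matrix (Fin 2) (ι r) ℂ, prodOp K *ᵥ v = gvec {i, j} 2 := by
  classical
  -- Among all nonzero minors one is taken whose two indices differ at the fewest parties;
  -- `eq_zero_of_closest_minor` then controls the whole cube between them.
  have hex : ∃ d : ℕ, ∃ x y : ∀ i, ι i, diffCard x y = d ∧
      v x * v y ≠ v (mix A x y) * v (mix A y x) := by
    by_contra! hcon
    exact h (split_of_minors fun x y => hcon _ x y rfl)
  obtain ⟨x, y, hd, hxy⟩ := Nat.find_spec hex
  have hmin : ∀ x' y', diffCard x' y' < diffCard x y →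
      v x' * v y' = v (mix A x' y') * v (mix A y' x') := by
    intro x' y' hlt
    by_contra hne
    exact Nat.find_min hex (hd ▸ hlt) ⟨x', y', rfl, hne⟩
  obtain ⟨i, hi, hix⟩ : ∃ i ∈ A, x i ≠ y i := by
    by_contra! hcon
    refine hxy ?_
    rw [← eq_mix (fun i hi => (hcon i hi).symm) fun _ _ => rfl,
      ← eq_mix hcon fun _ _ => rfl, mul_comm]
  obtain ⟨j, hj, hjx⟩ : ∃ j ∉ A, x j ≠ y j := by
    by_contra! hcon
    refine hxy ?_
    rw [← eq_mix (fun _ _ => rfl) hcon, ← eq_mix (fun _ _ => rfl) fun i hi => (hcon i hi).symm]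
  have hij : i ≠ j := fun h => hj (h ▸ hi)
  let c : Fin 2 → ∀ r, ι r := ![x, y]
  have hc : ∀ r, x r ≠ y r → ∀ a b, c a r = c b r → a = b := by
    intro r hr a b hab
    fin_cases a <;> fin_cases b <;> simp [c] at hab ⊢
    · exact hr hab
    · exact hr hab.symm
  let N : Matrix (Fin 2) (Fin 2) ℂ := fun a b => v (mix A (c a) (c b))
  have hN : N⁻¹ * N = 1 := by
    refine Matrix.nonsing_inv_mul _ ?_
    rw [isUnit_iff_ne_zero, Matrix.det_fin_two]
    simp only [N, c, Matrix.cons_val_zero, Matrix.cons_val_one, mix_self]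
    exact sub_ne_zero.mpr hxy
  -- Every party keeps only its two corner values. Party j records which one it has, party i does so
  -- and applies the inverse of the corner matrix `N`, and the rest map both values to ∑ |t⟩. What
  -- remains between i and j is the identity matrix.
  let K : ∀ r, Matrix (Fin 2) (ι r) ℂ := fun r t s =>
    if r = i then ∑ a, N⁻¹ t a * (if s = c a r then 1 else 0)
    else if r = j then (if s = c t r then 1 else 0) else (if s = x r ∨ s = y r then 1 else 0)
  refine ⟨i, hi, j, hj, K, ?_⟩
  ext t
  have hKi : ∀ s, K i (t i) s = ∑ a, N⁻¹ (t i) a * (if s = c a i then 1 else 0) :=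
    fun s => if_pos rfl
  have hKj : ∀ s, K j (t j) s = if s = c (t j) j then 1 else 0 := fun s => by
    simp only [K, if_neg hij.symm, if_true]
  have hKr : ∀ r, r ≠ i → r ≠ j → ∀ s, K r (t r) s = if s = x r ∨ s = y r then 1 else 0 :=
    fun r h1 h2 s => by simp only [K, if_neg h1, if_neg h2]
  have hcor : ∀ a b r, mix A (c a) (c b) r = x r ∨ mix A (c a) (c b) r = y r := by
    intro a b r
    fin_cases a <;> fin_cases b <;> simp only [mix, c] <;> split_ifs <;> simp
  have hval : (prodOp K *ᵥ v) t = ∑ a, N⁻¹ (t i) a * N a (t j) := by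
    simp only [Matrix.mulVec, dotProduct, prodOp]
    symm
    refine Fintype.sum_of_injective (fun a => mix A (c a) (c (t j))) ?_ _ _ ?_ ?_
    · intro a b hab
      have := congrFun hab i
      simp only [mix, if_pos hi] at this
      exact hc i hix _ _ this
    · intro z hz
      by_contra hne
      have hKz : ∀ r, K r (t r) (z r) ≠ 0 := fun r h0 =>
        hne (by rw [Finset.prod_eq_zero (Finset.mem_univ r) h0, zero_mul])
      have hzj : z j = c (t j) j := by
        have := hKz j
        rw [hKj] at this
        by_contra h0
        exact this (if_neg h0)
      have hzi : z i = x i ∨ z i = y i := by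
        by_contra! h0
        refine hKz i ?_
        rw [hKi, Fin.sum_univ_two]
        simp [c, h0.1, h0.2]
      have hzr : ∀ r, z r = x r ∨ z r = y r := by
        intro r
        by_cases h1 : r = i
        · exact h1 ▸ hzi
        by_cases h2 : r = j
        · subst h2
          rw [hzj]
          generalize t r = b
          fin_cases b <;> simp [c]
        · by_contra h0
          exact hKz r (by rw [hKr r h1 h2, if_neg h0])
      have key : ∃ a b, z = mix A (c a) (c b) := by
        by_contra! hcon
        refine hne ?_
        rw [eq_zero_of_closest_minor hxy hmin hzr, mul_zero]
        · simpa [c, mix_self] using hcon 0 0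
        · simpa [c, mix_self] using hcon 1 1
        · simpa [c] using hcon 0 1
        · simpa [c] using hcon 1 0
      obtain ⟨a, b, hab⟩ := key
      refine hz ⟨a, ?_⟩
      have : b = t j := by
        refine hc j hjx _ _ ?_
        rw [← hzj, hab]
        simp only [mix, if_neg hj]
      rw [hab, this]
    · intro a
      have : ∏ r, K r (t r) (mix A (c a) (c (t j)) r) = N⁻¹ (t i) a := by
        rw [Finset.prod_eq_single i]
        · rw [hKi, Finset.sum_eq_single a]
          · simp [mix, hi]
          · intro b _ hb
            rw [if_neg, mul_zero]
            simp only [mix, if_pos hi]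
            exact fun h0 => hb (hc i hix _ _ h0).symm
          · simp
        · intro r _ hr
          by_cases h2 : r = j
          · subst h2
            rw [hKj]
            simp [mix, hj]
          · rw [hKr r hr h2, if_pos (hcor _ _ _)]
        · simp
      rw [this]
  rw [hval, ← Matrix.mul_apply, hN, Matrix.one_apply, gvec_of_mem (p := i) (by simp)]
  simp only [Finset.mem_insert, Finset.mem_singleton, forall_eq_or_imp, forall_eq, true_and,
    eq_comm (a := t i)]

end Minor

end LOCC

namespace LOCC

variable {k : ℕ}

open PureState

/-! ### GHZ states obtainable from a state -/

namespace S

theorem cls_ghz_pow (T : Finset (Fin k)) (l : ℕ) : cls (ghz T (2 ^ l)) = cls (ghz T 2) ^ l := by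
  induction l with
  | zero =>
    rw [pow_zero]
    refine congrArg cls ?_
    change (⟨fun _ => 1, gvec T 1⟩ : PureState k) = ⟨fun _ => 1, fun _ => 1⟩
    congr 1
    funext x
    exact if_pos fun i _ j _ => Subsingleton.elim (x i) (x j)
  | succ l ih =>
    rw [pow_succ (cls _), ← ih]
    change _ = cls ⟨fun _ => 2 ^ l * 2, tensorVec (gvec T (2 ^ l)) (gvec T 2)⟩
    refine congrArg cls ?_
    change (⟨fun _ => 2 ^ l * 2, gvec T (2 ^ l * 2)⟩ : PureState k) = _
    congr 1
    funext x
    simp only [tensorVec, gvec, mul_ite, mul_one, mul_zero, ← ite_and]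
    congr 1
    refine propext ⟨fun h => ⟨fun i hi j hj => by rw [h i hi j hj], fun i hi j hj => by
      rw [h i hi j hj]⟩, fun h i hi j hj => ?_⟩
    exact finProdFinEquiv.symm.injective (Prod.ext (h.2 i hi j hj) (h.1 i hi j hj))

theorem pow_le_pow (hk : 1 ≤ k) {a b : S k} (h : le a b) (n : ℕ) : le (a ^ n) (b ^ n) :=
  (isStrassen hk).pow h n

theorem le_sc_mul (hk : 1 ≤ k) {c : ℝ} (hc : 1 ≤ c) (a : S k) : le a (sc k c * a) := by
  have := mul_le_mul_right hk a (sc_mono hk zero_le_one hc)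
  rwa [sc_one, one_mul] at this

/-- A GHZ state of the parties in `Q` can be obtained from some power of `a`, up to a factor. -/
def Obtainable (a : S k) (Q : Finset (Fin k)) : Prop :=
  ∃ c : ℝ, 1 ≤ c ∧ ∃ m : ℕ, le (cls (ghz Q 2)) (sc k c * a ^ m)

/-- With at most one party in `Q` the GHZ vector is a product, so no copy of the state is used. -/
theorem obtainable_of_card_le_one (a : S k) {Q : Finset (Fin k)} (hQ : Q.card ≤ 1) :
    Obtainable a Q := by
  obtain ⟨c, hc, h⟩ := cls_le_of_prodOp (ψ := PureState.one k) (φ := ghz Q 2)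
    (fun _ => fun _ _ => (1 : ℂ)) (by
      ext y
      have : gvec Q 2 y = 1 := if_pos fun i hi j hj => by
        rw [Finset.card_le_one.mp hQ i hi j hj]
      change _ = gvec Q 2 y
      rw [this]
      simp only [Matrix.mulVec, dotProduct, prodOp, PureState.one, Finset.prod_const_one, mul_one,
        Finset.sum_const, nsmul_eq_mul, Nat.cast_eq_one]
      exact Fintype.card_unique (α := Fin k → Fin 1))
  refine ⟨c, hc, 0, ?_⟩
  rw [pow_zero]
  exact h

/-- Parties in both sets project onto equal indices, and the others fix their idle register at 0.
The shared party `p` synchronizes the two GHZ states. -/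
theorem ghz_union_le {Q R : Finset (Fin k)} {p : Fin k} (hQ : p ∈ Q) (hR : p ∈ R) :
    le (cls (ghz (Q ∪ R) 2)) (cls (ghz Q 2) * cls (ghz R 2)) := by
  classical
  let h : Fin k → Fin 2 → Fin (2 * 2) := fun r y => finProdFinEquiv
    (if r ∈ Q then (if r ∈ R then (y, y) else (y, 0)) else (0, y))
  have hinj : ∀ r, Function.Injective (h r) := by
    intro r y y' hy
    simp only [h, EmbeddingLike.apply_eq_iff_eq] at hy
    split_ifs at hy <;> simpa using hy
  refine Conv.converts (ψ := (ghz Q 2).tensor (ghz R 2)) (φ := ghz (Q ∪ R) 2) ?_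
  refine Conv.of_prodOp (U := fun r => (emb (h r))ᴴ)
    (fun r => isContr_emb_conjTranspose (hinj r)) ?_
  refine funext fun (y : Fin k → Fin 2) => (prodOp_conj_emb h _ y).trans ?_
  change gvec Q 2 (fun i => (finProdFinEquiv.symm (h i (y i))).1) *
    gvec R 2 (fun i => (finProdFinEquiv.symm (h i (y i))).2) = gvec (Q ∪ R) 2 y
  have e1 : gvec Q 2 (fun i => (finProdFinEquiv.symm (h i (y i))).1) = gvec Q 2 y :=
    gvec_congr fun i hi => by simp only [h, Equiv.symm_apply_apply, if_pos hi]; split_ifs <;> rfl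
  have e2 : gvec R 2 (fun i => (finProdFinEquiv.symm (h i (y i))).2) = gvec R 2 y :=
    gvec_congr fun i hi => by simp only [h, Equiv.symm_apply_apply, if_pos hi]; split_ifs <;> rfl
  rw [e1, e2, gvec_of_mem hQ, gvec_of_mem hR, gvec_of_mem (Finset.mem_union_left R hQ)]
  simp only [mul_ite, mul_one, mul_zero, ← ite_and]
  congr 1
  simp only [Finset.mem_union]
  refine propext ⟨fun h i hi => hi.elim (h.2 i) (h.1 i), fun h =>
    ⟨fun i hi => h i (Or.inr hi), fun i hi => h i (Or.inl hi)⟩⟩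

theorem Obtainable.union (hk : 1 ≤ k) {a : S k} {Q R : Finset (Fin k)} {p : Fin k} (hQ : p ∈ Q)
    (hR : p ∈ R) (h : Obtainable a Q) (h' : Obtainable a R) : Obtainable a (Q ∪ R) := by
  obtain ⟨c, hc, m, h⟩ := h
  obtain ⟨c', hc', m', h'⟩ := h'
  refine ⟨c * c', one_le_mul_of_one_le_of_one_le hc hc', m + m', ?_⟩
  refine le_trans (ghz_union_le hQ hR) (le_trans (mul_le_mul hk h h') (le_of_eq ?_))
  rw [sc_mul, pow_add]
  ring

theorem obtainable_pair {ψ : PureState k} {A : Finset (Fin k)} (h : ¬ Split A ψ.vec) :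
    ∃ i ∈ A, ∃ j ∉ A, Obtainable (cls ψ) {i, j} := by
  obtain ⟨i, hi, j, hj, K, hK⟩ := exists_prodOp_eq_gvec_pair h
  obtain ⟨c, hc, h1⟩ := cls_le_of_prodOp (ψ := ψ) (φ := ghz {i, j} 2) K hK
  exact ⟨i, hi, j, hj, c, hc, 1, by rwa [pow_one]⟩

/-- A partition of the parties, given by the class `B i` of each party `i`, such that a state is a
product across the partition and GHZ states of the classes can be obtained from it. -/
structure IsPartition (ψ : PureState k) (B : Fin k → Finset (Fin k)) : Prop where
  mem : ∀ i, i ∈ B i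
  eq : ∀ i j, j ∈ B i → B j = B i
  split : ∀ i, Split (B i) ψ.vec
  obtainable : ∀ i, Obtainable (cls ψ) (B i)

/-- The class of i is an obtainable set containing i of maximal size. Overlapping obtainable sets
can be merged, so it absorbs every obtainable set that meets it. If ψ were not a product across it,
an entangled pair crossing the boundary would be obtainable, a contradiction. -/
theorem exists_isPartition (hk : 1 ≤ k) (ψ : PureState k) : ∃ B, IsPartition ψ B := by
  classical
  have hex : ∀ i : Fin k, ∃ Q : Finset (Fin k), i ∈ Q ∧ Obtainable (cls ψ) Q ∧
      ∀ R, Obtainable (cls ψ) R → (∃ p, p ∈ Q ∧ p ∈ R) → R ⊆ Q := by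
    intro i
    obtain ⟨Q, hQ, hmax⟩ := Finset.exists_max_image
      (Finset.univ.filter fun Q : Finset (Fin k) => i ∈ Q ∧ Obtainable (cls ψ) Q) Finset.card
      ⟨{i}, by simp [obtainable_of_card_le_one]⟩
    simp only [Finset.mem_filter, Finset.mem_univ, true_and] at hQ hmax
    refine ⟨Q, hQ.1, hQ.2, fun R hR => ?_⟩
    rintro ⟨p, hpQ, hpR⟩
    have h1 := hmax (Q ∪ R) ⟨Finset.mem_union_left _ hQ.1, hQ.2.union hk hpQ hpR hR⟩
    have h2 := Finset.eq_of_subset_of_card_le Finset.subset_union_left h1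
    rw [h2]
    exact Finset.subset_union_right
  choose B hmem hobt hmax using hex
  refine ⟨B, hmem, fun i j hj => ?_, fun i => ?_, hobt⟩
  · exact (hmax i (B j) (hobt j) ⟨j, hj, hmem j⟩).antisymm
      (hmax j (B i) (hobt i) ⟨j, hmem j, hj⟩)
  · by_contra h
    obtain ⟨p, hp, q, hq, hpq⟩ := obtainable_pair h
    exact hq (hmax i _ hpq ⟨p, hp, by simp⟩ (by simp))

theorem Obtainable.pow (hk : 1 ≤ k) {a : S k} {Q : Finset (Fin k)} (h : Obtainable a Q) :
    ∃ c : ℝ, 1 ≤ c ∧ ∃ m : ℕ, ∀ l, le (cls (ghz Q (2 ^ l))) (sc k (c ^ l) * a ^ (m * l)) := by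
  obtain ⟨c, hc, m, h⟩ := h
  refine ⟨c, hc, m, fun l => ?_⟩
  rw [cls_ghz_pow, sc_pow, pow_mul, ← mul_pow]
  exact pow_le_pow hk h l

theorem cls_tpow (ψ : PureState k) (n : ℕ) : cls (ψ.tpow n) = cls ψ ^ n := by
  induction n with
  | zero => rfl
  | succ n ih => rw [pow_succ, ← ih]; rfl

theorem sc_mul_cls_pow (s : ℝ) (ψ : PureState k) (n : ℕ) :
    sc k s * cls ψ ^ n = cls ((ψ.tpow n).scale s) := by
  rw [← cls_tpow, sc_mul_cls]

/-- GHZ assistance can be replaced by copies of the source state. -/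
theorem le_of_le_ghz_mul (hk : 1 ≤ k) {ψ : PureState k} {B : Fin k → Finset (Fin k)}
    (hB : IsPartition ψ B) (T : Finset (Fin k)) (hT : ∀ i ∈ T, B i ⊆ T) :
    ∃ C : ℝ, 1 ≤ C ∧ ∃ m : ℕ, ∀ (φ : PureState k), (∀ i, Split (B i) φ.vec) →
      ∀ (l n : ℕ) (s : ℝ), 0 ≤ s →
      le (cls φ) (cls (ghz T (2 ^ l)) * (sc k s * cls ψ ^ n)) →
      le (cls φ) (sc k (C ^ (l + 1) * s) * cls ψ ^ (n + m * l)) := by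
  classical
  induction T using Finset.strongInduction with
  | H T ih =>
  -- If GHZ states of `T` itself are obtainable, they replace the assistance directly. Otherwise one
  -- class `B i` is peeled off `T`, and the induction hypothesis handles the rest.
  have direct : Obtainable (cls ψ) T → ∃ C : ℝ, 1 ≤ C ∧ ∃ m : ℕ, ∀ (φ : PureState k),
      (∀ i, Split (B i) φ.vec) → ∀ (l n : ℕ) (s : ℝ), 0 ≤ s →
      le (cls φ) (cls (ghz T (2 ^ l)) * (sc k s * cls ψ ^ n)) →
      le (cls φ) (sc k (C ^ (l + 1) * s) * cls ψ ^ (n + m * l)) := by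
    intro h
    obtain ⟨c, hc, m, h⟩ := h.pow hk
    refine ⟨c, hc, m, fun φ _ l n s hs h1 => ?_⟩
    refine le_trans h1 (le_trans (mul_le_mul_right hk _ (h l)) ?_)
    rw [show sc k (c ^ l) * cls ψ ^ (m * l) * (sc k s * cls ψ ^ n) =
      sc k (c ^ l * s) * cls ψ ^ (n + m * l) by rw [sc_mul, pow_add]; ring]
    refine mul_le_mul_right hk _ (sc_mono hk (by positivity) ?_)
    exact mul_le_mul_of_nonneg_right (pow_le_pow_right₀ hc (Nat.le_succ l)) hs
  rcases T.eq_empty_or_nonempty with rfl | ⟨i, hi⟩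
  · exact direct (obtainable_of_card_le_one _ (by simp))
  rcases (T \ B i).eq_empty_or_nonempty with h0 | ⟨q, hq⟩
  · have : T = B i := (Finset.sdiff_eq_empty_iff_subset.mp h0).antisymm (hT i hi)
    rw [this] at direct ⊢
    exact direct (hB.obtainable i)
  have hlt : T \ B i ⊂ T :=
    Finset.sdiff_ssubset (hT i hi) ⟨i, hB.mem i⟩
  obtain ⟨C, hC, m, key⟩ := ih (T \ B i) hlt (by
    intro j hj
    obtain ⟨hjT, hjB⟩ := Finset.mem_sdiff.mp hj
    intro x hx
    refine Finset.mem_sdiff.mpr ⟨hT j hjT hx, fun hxi => hjB ?_⟩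
    rw [← hB.eq i x hxi, hB.eq j x hx]
    exact hB.mem j)
  obtain ⟨c, hc, m', hobt⟩ := (hB.obtainable i).pow hk
  have hC0 : 0 ≤ C := zero_le_one.trans hC
  have hc0 : 0 ≤ c := zero_le_one.trans hc
  -- The three factors pay for the remaining classes, for the splitting scalar 2·2^l = 2^(l+1), and
  -- for the GHZ states of the class peeled off. The exponent l + 1 rather than l absorbs the extra
  -- 2.
  refine ⟨C * 2 * c, one_le_mul_of_one_le_of_one_le (by linarith) hc, m + m',
    fun φ hφ l n s hs h => ?_⟩
  rw [sc_mul_cls_pow] at h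
  have h1 := le_ghz_mul_ghz hk (hB.mem i) (hT i hi) hq Nat.one_le_two_pow (hφ i)
    (((hB.split i).tpow n).smul (s : ℂ)) h
  rw [← sc_mul_cls_pow] at h1
  have h2 : le (cls φ) (cls (ghz (T \ B i) (2 ^ l)) *
      (sc k (2 * (2 : ℝ) ^ l * c ^ l * s) * cls ψ ^ (n + m' * l))) := by
    refine le_trans h1 ?_
    have h3 := mul_le_mul_right hk (sc k (2 * ((2 ^ l : ℕ) : ℝ)) *
      (cls (ghz (T \ B i) (2 ^ l)) * (sc k s * cls ψ ^ n))) (hobt l)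
    refine le_trans (le_of_eq ?_) (le_trans h3 (le_of_eq ?_))
    · ring
    · push_cast
      rw [sc_mul (2 * 2 ^ l * c ^ l) s, sc_mul (2 * 2 ^ l) (c ^ l), pow_add]
      ring
  have h3 := key φ hφ l (n + m' * l) _ (by positivity) h2
  rw [show n + m' * l + m * l = n + (m + m') * l by ring] at h3
  refine le_trans h3 (mul_le_mul_right hk _ (sc_mono hk (by positivity) ?_))
  rw [← mul_assoc]
  refine mul_le_mul_of_nonneg_right ?_ hs
  rw [mul_pow, mul_pow]
  have h4 : c ^ l ≤ c ^ (l + 1) := pow_le_pow_right₀ hc (Nat.le_succ l)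
  calc C ^ (l + 1) * (2 * 2 ^ l * c ^ l) = C ^ (l + 1) * 2 ^ (l + 1) * c ^ l := by ring
    _ ≤ _ := mul_le_mul_of_nonneg_left h4 (by positivity)

end S

/-! ### The number of product vectors across a bipartition -/

section SchmidtRank

variable {ι κ : Fin k → Type} [∀ i, Fintype (ι i)] [∀ i, Fintype (κ i)] {A : Finset (Fin k)}

/-- A vector that is a sum of `D` products across a bipartition. -/
def SplitSum (A : Finset (Fin k)) (D : ℕ) (v : (∀ i, ι i) → ℂ) : Prop :=
  ∃ (a : Fin D → (∀ i : {i // i ∈ A}, ι i) → ℂ) (b : Fin D → (∀ i : {i // i ∉ A}, ι i) → ℂ),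
    v = ∑ t, box A (a t) (b t)

theorem SplitSum.prodOp {D : ℕ} {v : (∀ i, ι i) → ℂ} (h : SplitSum A D v)
    (U : ∀ i, Matrix (κ i) (ι i) ℂ) : SplitSum A D (prodOp U *ᵥ v) := by
  obtain ⟨a, b, rfl⟩ := h
  refine ⟨fun t => subOp Subtype.val U (a t), fun t => subOp Subtype.val U (b t), ?_⟩
  rw [Matrix.mulVec_sum]
  exact Finset.sum_congr rfl fun t _ => prodOp_box A U (a t) (b t)

theorem SplitSum.of_smul {D : ℕ} {v : (∀ i, ι i) → ℂ} {c : ℂ} (hc : c ≠ 0)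
    (h : SplitSum A D (c • v)) : SplitSum A D v := by
  obtain ⟨a, b, h⟩ := h
  refine ⟨fun t => c⁻¹ • a t, b, ?_⟩
  rw [← inv_smul_smul₀ hc v, h, Finset.smul_sum]
  refine Finset.sum_congr rfl fun t _ => ?_
  ext x
  simp [box, mul_assoc]

/-- Positive total weight leaves a branch with a nonzero coefficient, and product operators never
increase the number of product terms. This is monotonicity of the Schmidt rank. -/
theorem SplitSum.of_reach {D : ℕ} {w : (∀ i, κ i) → ℂ} {P : ℝ} {v : (∀ i, ι i) → ℂ}
    (h : Reach w P v) (hP : P ≠ 0) (hv : SplitSum A D v) : SplitSum A D w := by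
  induction h with
  | leaf U hU c v h =>
    refine SplitSum.of_smul (c := c) (fun hc => hP (by simp [hc])) ?_
    rw [← h]
    exact hv.prodOp U
  | step i J K hK P v h ih =>
    obtain ⟨j, -, hj⟩ := Finset.exists_ne_zero_of_sum_ne_zero hP
    exact ih j hj (hv.prodOp _)

theorem SplitSum.of_conv {D : ℕ} {w : (∀ i, κ i) → ℂ} {v : (∀ i, ι i) → ℂ}
    (h : Conv v w) (hv : SplitSum A D v) : SplitSum A D w := by
  obtain ⟨ν, _, W, hW, hr⟩ := h
  exact SplitSum.of_reach hr one_ne_zero (hv.prodOp W)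

/-- With all parties but i and j frozen at one index, the decomposition factors the N×N identity
matrix through dimension D. -/
theorem le_of_splitSum_gvec_pair {D N : ℕ} {i j : Fin k} (hi : i ∈ A) (hj : j ∉ A)
    (h : SplitSum A D (gvec {i, j} N)) : N ≤ D := by
  classical
  obtain ⟨a, b, h⟩ := h
  rcases Nat.eq_zero_or_pos N with rfl | hN
  · exact Nat.zero_le _
  let z : Fin N := ⟨0, hN⟩
  have hij : j ≠ i := fun h => hj (h ▸ hi)
  let M : Matrix (Fin N) (Fin D) ℂ := fun s t => a t fun r => if r.1 = i then s else z
  let L : Matrix (Fin D) (Fin N) ℂ := fun t s => b t fun r => if r.1 = j then s else z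
  have h1 : M * L = 1 := by
    ext s s'
    have h2 := congrFun h (fun r => if r ∈ A then (if r = i then s else z) else
      (if r = j then s' else z))
    rw [gvec_of_mem (p := i) (by simp), Finset.sum_apply] at h2
    rw [Matrix.mul_apply, Matrix.one_apply]
    simp only [Finset.mem_insert, Finset.mem_singleton, forall_eq_or_imp, forall_eq, true_and,
      if_pos hi, if_neg hj, if_true] at h2
    simp only [eq_comm (a := s)]
    rw [h2]
    refine Finset.sum_congr rfl fun t _ => ?_
    simp only [box, M, L]
    congr 2
    · funext r; simp [r.2]
    · funext r; simp [r.2]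
  have h2 := Matrix.rank_mul_le_left M L
  rw [h1, Matrix.rank_one, Fintype.card_fin] at h2
  refine h2.trans ((Matrix.rank_le_card_width M).trans ?_)
  rw [Fintype.card_fin]

end SchmidtRank

namespace S

/-- A GHZ state of two separated parties obtained with the help of a GHZ state of all parties and
a product state is no larger than the former. -/
theorem le_of_ghz_pair_le (hk : 1 ≤ k) {A : Finset (Fin k)} {i j : Fin k} (hi : i ∈ A)
    (hj : j ∉ A) {N D : ℕ} {χ : PureState k} (hχ : Split A χ.vec)
    (h : le (cls (ghz {i, j} N)) (D * cls χ)) : N ≤ D := by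
  rw [natCast_eq_cls hk] at h
  have h1 : Conv (tens (gvec Finset.univ D) χ.vec) (gvec {i, j} N) :=
    (Converts.conv hk (ψ := (ghz Finset.univ D).tensor χ) (φ := ghz {i, j} N) h).precomp
      (fun _ => isContr_emb_equiv _) (tensorVec_eq (gvec Finset.univ D) χ.vec).symm
  obtain ⟨vA, vB, hv⟩ := hχ
  rw [hv, tens_gvec_box hi (Finset.subset_univ A)] at h1
  exact le_of_splitSum_gvec_pair hi hj (SplitSum.of_conv h1 ⟨_, _, rfl⟩)

/-- A target state is a product across the partition of the source if its powers can be obtained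
at a sufficient rate with GHZ assistance. -/
theorem split_of_pow_le (hk : 1 ≤ k) {ψ φ : PureState k} {B : Fin k → Finset (Fin k)}
    (hB : IsPartition ψ B) {h m C : ℕ} (hh : 3 ≤ h) {s : ℝ}
    (hle : ∀ n, le ((cls φ ^ h) ^ n) ((C : S k) * 4 ^ n * (sc k s * cls ψ ^ m) ^ n)) (i : Fin k) :
    Split (B i) φ.vec := by
  by_contra hcon
  obtain ⟨p, hp, q, hq, K, hK⟩ := exists_prodOp_eq_gvec_pair hcon
  obtain ⟨c, hc, h1⟩ := cls_le_of_prodOp (ψ := φ) (φ := ghz {p, q} 2) K hK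
  -- If φ were entangled across `B i`, its powers would give pairs with 2^(h·n) levels, while ψ
  -- contributes nothing across this cut and the assistance only C·4^n levels. For h ≥ 3 this
  -- already fails at n = C.
  have h2 : ∀ n, 2 ^ (h * n) ≤ C * 4 ^ n := by
    intro n
    have h3 := pow_le_pow hk h1 (h * n)
    rw [← cls_ghz_pow, mul_pow, pow_mul (cls φ)] at h3
    have h4 : (sc k s * cls ψ ^ m) ^ n = sc k (s ^ n) * cls ψ ^ (m * n) := by
      rw [mul_pow, sc_pow, pow_mul]
    have h5 := hle n
    rw [h4] at h5
    have h6 := le_trans h3 (mul_le_mul hk (le_refl _) h5)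
    have h7 : sc k c ^ (h * n) * ((C : S k) * 4 ^ n * (sc k (s ^ n) * cls ψ ^ (m * n))) =
        ((C * 4 ^ n : ℕ) : S k) * cls ((ψ.tpow (m * n)).scale (c ^ (h * n) * s ^ n)) := by
      rw [← sc_mul_cls_pow, sc_mul (c ^ (h * n)), sc_pow c]
      push_cast
      ring
    rw [h7] at h6
    exact le_of_ghz_pair_le hk hp hq (((hB.split i).tpow _).smul _) h6
  have h3 := h2 C
  have h4 : C * 4 ^ C < 2 ^ (h * C) := by
    calc C * 4 ^ C < 2 ^ C * 4 ^ C :=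
          Nat.mul_lt_mul_of_pos_right Nat.lt_two_pow_self (by positivity)
      _ = 2 ^ (3 * C) := by
          rw [show (4 : ℕ) = 2 ^ 2 by norm_num, ← pow_mul, ← pow_add]; congr 1; ring
      _ ≤ 2 ^ (h * C) := Nat.pow_le_pow_right (by norm_num) (Nat.mul_le_mul_right C hh)
  omega

end S

end LOCC

namespace LOCC

variable {k : ℕ}

open PureState

/-! ### Values of the spectral points -/

namespace Spectrum

theorem mono (f : Spectrum k) {a b : S k} (h : S.le a b) :
    (f : S k →+* ℝ≥0) a ≤ (f : S k →+* ℝ≥0) b := by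
  induction a using S.ind with | h ψ => induction b using S.ind with | h φ =>
  exact f.2 _ _ (S.le_cls.mp h)

theorem one_le_eval (f : Spectrum k) {ψ : PureState k} (h : ψ.normSq = 1) : 1 ≤ eval f ψ := by
  have h1 := mono f (S.sc_sqrt_normSq_le ψ)
  rw [h, Real.sqrt_one, S.sc_one, map_one] at h1
  exact_mod_cast h1

theorem eval_sc_pos (f : Spectrum k) {c : ℝ} (hc : 0 < c) :
    0 < ((f : S k →+* ℝ≥0) (S.sc k c) : ℝ) := by
  have h : (f : S k →+* ℝ≥0) (S.sc k c) * (f : S k →+* ℝ≥0) (S.sc k c⁻¹) = 1 := by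
    rw [← map_mul, ← S.sc_mul, mul_inv_cancel₀ hc.ne', S.sc_one, map_one]
  exact NNReal.coe_pos.mpr (pos_of_ne_zero (left_ne_zero_of_mul_eq_one h))

/-- The function x ↦ log f(2^x|0…0⟩) is additive and monotone, hence measurable, continuous and
linear; its value at 1/2 is α(f). -/
theorem logb_eval_sc (hk : 1 ≤ k) (f : Spectrum k) (x : ℝ) :
    Real.logb 2 ((f : S k →+* ℝ≥0) (S.sc k ((2 : ℝ) ^ x))) = 2 * alpha f * x := by
  have hpos : ∀ x : ℝ, (0 : ℝ) < 2 ^ x := fun x => Real.rpow_pos_of_pos two_pos x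
  let g : ℝ →+ ℝ := AddMonoidHom.mk'
      (fun x => Real.logb 2 ((f : S k →+* ℝ≥0) (S.sc k ((2 : ℝ) ^ x))))
    fun x y => by
      rw [Real.rpow_add two_pos, S.sc_mul, map_mul, NNReal.coe_mul,
        Real.logb_mul (eval_sc_pos f (hpos x)).ne' (eval_sc_pos f (hpos y)).ne']
  have hg : Monotone g := by
    intro x y hxy
    refine (Real.logb_le_logb one_lt_two (eval_sc_pos f (hpos x)) (eval_sc_pos f (hpos y))).mpr ?_
    exact_mod_cast mono f (S.sc_mono hk (hpos x).le
      (Real.rpow_le_rpow_of_exponent_le one_le_two hxy))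
  have hcont : Continuous g :=
    MeasureTheory.Measure.AddMonoidHom.continuous_of_measurable g hg.measurable
  have h1 : g (1 / 2) = alpha f := by
    change Real.logb 2 ((f : S k →+* ℝ≥0) (S.sc k ((2 : ℝ) ^ (1 / 2 : ℝ)))) = _
    rw [← Real.sqrt_eq_rpow]
    rfl
  have h2 := map_real_smul g hcont (2 * x) (1 / 2)
  rw [h1, smul_eq_mul, smul_eq_mul, show 2 * x * (1 / 2) = x by ring] at h2
  change g x = _
  rw [h2]
  ring

theorem alpha_nonneg (hk : 1 ≤ k) (f : Spectrum k) : 0 ≤ alpha f := by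
  refine Real.logb_nonneg one_lt_two ?_
  have h := mono f (S.sc_mono hk zero_le_one (Real.one_le_sqrt.mpr one_le_two))
  rw [S.sc_one, map_one] at h
  exact_mod_cast h

theorem logb_eval_scale (hk : 1 ≤ k) (f : Spectrum k) {ψ : PureState k} (h : ψ.normSq = 1) (x : ℝ) :
    Real.logb 2 (eval f (ψ.scale ((2 : ℝ) ^ x))) = 2 * alpha f * x + Real.logb 2 (eval f ψ) := by
  rw [eval, ← S.sc_mul_cls, map_mul, NNReal.coe_mul, Real.logb_mul, logb_eval_sc hk f]
  · rfl
  · exact (eval_sc_pos f (Real.rpow_pos_of_pos two_pos x)).ne'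
  · exact (zero_lt_one.trans_le (one_le_eval f h)).ne'

theorem eval_scale_pos (f : Spectrum k) {ψ : PureState k} (h : ψ.normSq = 1) (x : ℝ) :
    0 < eval f (ψ.scale ((2 : ℝ) ^ x)) := by
  rw [eval, ← S.sc_mul_cls, map_mul, NNReal.coe_mul]
  exact mul_pos (eval_sc_pos f (Real.rpow_pos_of_pos two_pos x))
    (zero_lt_one.trans_le (one_le_eval f h))

theorem eval_tpow (f : Spectrum k) (ψ : PureState k) (n : ℕ) :
    eval f (ψ.tpow n) = eval f ψ ^ n := by
  rw [eval, S.cls_tpow, map_pow, NNReal.coe_pow]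
  rfl

theorem logb_eval_nonneg (f : Spectrum k) {ψ : PureState k} (h : ψ.normSq = 1) :
    0 ≤ Real.logb 2 (eval f ψ) :=
  Real.logb_nonneg one_lt_two (one_le_eval f h)

theorem rpow_eval_le_iff (hk : 1 ≤ k) (f : Spectrum k) {ψ φ : PureState k} (hψ : ψ.normSq = 1)
    (hφ : φ.normSq = 1) (r τ : ℝ) :
    eval f φ ^ τ ≤ eval f (ψ.scale ((2 : ℝ) ^ (r / 2))) ↔
      τ * Real.logb 2 (eval f φ) ≤ r * alpha f + Real.logb 2 (eval f ψ) := by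
  have h0 : 0 < eval f φ := zero_lt_one.trans_le (one_le_eval f hφ)
  rw [← Real.logb_le_logb one_lt_two (Real.rpow_pos_of_pos h0 _) (eval_scale_pos f hψ _),
    Real.logb_rpow_eq_mul_logb_of_pos h0, logb_eval_scale hk f hψ,
    show 2 * alpha f * (r / 2) = r * alpha f by ring]

end Spectrum

/-! ### Achievable rates -/

/-- Logarithms of f on both sides of the conversion are divided by n; ⌊τn⌋/n tends to τ and e_n/n to
0. -/
theorem Achievable.le_of_spectrum (hk : 1 ≤ k) {ψ φ : PureState k} (hψ : ψ.normSq = 1)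
    (hφ : φ.normSq = 1) {r τ : ℝ} (hτ : 0 ≤ τ) (h : Achievable r ψ φ τ) (f : Spectrum k) :
    τ * Real.logb 2 (Spectrum.eval f φ) ≤
      r * Spectrum.alpha f + Real.logb 2 (Spectrum.eval f ψ) := by
  obtain ⟨e, he, h⟩ := h
  have hφ0 : 0 < Spectrum.eval f φ := zero_lt_one.trans_le (Spectrum.one_le_eval f hφ)
  set Lφ := Real.logb 2 (Spectrum.eval f φ)
  set Lψ := Real.logb 2 (Spectrum.eval f ψ) with hLψ
  have hψ0 : 0 < Spectrum.eval f ψ := zero_lt_one.trans_le (Spectrum.one_le_eval f hψ)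
  have h1 : ∀ᶠ n : ℕ in atTop, (⌊τ * n⌋₊ : ℝ) / n * Lφ ≤
      Spectrum.alpha f * (r + 2 * (e n / n)) + Lψ := by
    filter_upwards [h, eventually_gt_atTop 0] with n hn hn0
    have h2 : Spectrum.eval f (φ.tpow ⌊τ * n⌋₊) ≤
        Spectrum.eval f ((ψ.tpow n).scale ((2 : ℝ) ^ ((n : ℝ) * r / 2 + e n))) := by
      exact_mod_cast f.2 _ _ hn
    have h3 : Spectrum.eval f ((ψ.tpow n).scale ((2 : ℝ) ^ ((n : ℝ) * r / 2 + e n))) =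
        (f : S k →+* ℝ≥0) (S.sc k ((2 : ℝ) ^ ((n : ℝ) * r / 2 + e n))) *
          Spectrum.eval f ψ ^ n := by
      rw [Spectrum.eval, ← S.sc_mul_cls, map_mul, NNReal.coe_mul, ← Spectrum.eval_tpow f]
      rfl
    have h4 := Spectrum.eval_sc_pos f (Real.rpow_pos_of_pos two_pos ((n : ℝ) * r / 2 + e n))
    rw [h3, Spectrum.eval_tpow f, ← Real.logb_le_logb one_lt_two (by positivity) (by positivity),
      Real.logb_mul h4.ne' (by positivity), Real.logb_pow, Real.logb_pow,
      Spectrum.logb_eval_sc hk f] at h2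
    have hn0' : (0 : ℝ) < n := by exact_mod_cast hn0
    rw [div_mul_eq_mul_div, div_le_iff₀ hn0']
    refine h2.trans (le_of_eq ?_)
    field_simp
    ring
  have h2 : Tendsto (fun n : ℕ => (⌊τ * n⌋₊ : ℝ) / n * Lφ) atTop (nhds (τ * Lφ)) :=
    ((tendsto_nat_floor_mul_div_atTop hτ).comp tendsto_natCast_atTop_atTop).mul_const _
  have h3 : Tendsto (fun n : ℕ => Spectrum.alpha f * (r + 2 * (e n / n)) + Lψ) atTop
      (nhds (Spectrum.alpha f * (r + 2 * 0) + Lψ)) :=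
    (((he.tendsto_div_nhds_zero.const_mul 2).const_add r).const_mul _).add_const _
  have h4 := le_of_tendsto_of_tendsto h2 h3 h1
  linarith

end LOCC

namespace LOCC

variable {k : ℕ}

open PureState

/-! ### Protocols for rates below the spectral bound -/

namespace S

theorem one_le_cls {ψ : PureState k} (h : ψ.normSq = 1) : le 1 (cls ψ) := by
  have := sc_sqrt_normSq_le ψ
  rwa [h, Real.sqrt_one, sc_one] at this

theorem pow_le_pow_right (hk : 1 ≤ k) {a : S k} (ha : le 1 a) {m n : ℕ} (h : m ≤ n) :
    le (a ^ m) (a ^ n) := by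
  obtain ⟨d, rfl⟩ := Nat.exists_eq_add_of_le h
  have h1 := mul_le_mul hk (le_refl (a ^ m)) (pow_le_pow hk ha d)
  rwa [one_pow, mul_one, ← pow_add] at h1

theorem ne_zero_of_one_le (hk : 1 ≤ k) {a : S k} (ha : le 1 a) : a ≠ 0 := by
  rintro rfl
  have := natCast_le hk (m := 1) (n := 0) (by simpa using ha)
  omega

/-- Blocks of copies of the source state are converted with exponentially small overhead. -/
theorem exists_block_le (hk : 1 ≤ k) {ψ φ : PureState k} (hψ : ψ.normSq = 1) (hφ : φ.normSq = 1)
    {r τ : ℝ} (hr : 0 ≤ r) (hτ : 0 < τ)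
    (h : ∀ f : Spectrum k, τ * Real.logb 2 (Spectrum.eval f φ) ≤
      r * Spectrum.alpha f + Real.logb 2 (Spectrum.eval f ψ)) :
    ∃ C : ℝ, 1 ≤ C ∧ ∃ q : ℕ, ∀ m : ℕ, 3 ≤ ⌊τ * m⌋₊ → ∃ c : ℕ, ∀ n,
      le (cls φ ^ (⌊τ * m⌋₊ * n)) (sc k (C ^ (2 * n + c + 1) * ((2 : ℝ) ^ ((m : ℝ) * r / 2)) ^ n) *
        cls ψ ^ ((m + 2 * q) * n + q * c)) := by
  classical
  obtain ⟨B, hB⟩ := exists_isPartition hk ψ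
  obtain ⟨C, hC, q, key⟩ := le_of_le_ghz_mul hk hB Finset.univ fun i _ => Finset.subset_univ _
  refine ⟨C, hC, q, fun m hm => ?_⟩
  set s : ℝ := (2 : ℝ) ^ ((m : ℝ) * r / 2) with hs
  have hs0 : 0 ≤ s := by positivity
  have hs1 : 1 ≤ s := Real.one_le_rpow one_le_two (by positivity)
  have hb1 : le 1 (sc k s * cls ψ ^ m) :=
    le_trans (pow_le_pow_right hk (one_le_cls hψ) (Nat.zero_le m)) (le_sc_mul hk hs1 _)
  -- Duality is applied to a whole block of m copies, so that the factor 4 is charged once per block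
  -- and not once per copy.
  obtain ⟨c, hc⟩ := pow_le_of_spectrum hk (a := cls φ ^ ⌊τ * m⌋₊) (ne_zero_of_one_le hk hb1) (by
    intro f
    have h0 : 0 < Spectrum.eval f φ := zero_lt_one.trans_le (Spectrum.one_le_eval f hφ)
    have h0' : 0 < Spectrum.eval f ψ := zero_lt_one.trans_le (Spectrum.one_le_eval f hψ)
    have h1 := Spectrum.eval_sc_pos f (Real.rpow_pos_of_pos two_pos ((m : ℝ) * r / 2))
    rw [map_pow, map_mul, map_pow, ← NNReal.coe_le_coe, NNReal.coe_pow, NNReal.coe_mul,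
      NNReal.coe_pow]
    change Spectrum.eval f φ ^ _ ≤ _ * Spectrum.eval f ψ ^ m
    rw [← Real.logb_le_logb one_lt_two (by positivity) (by positivity),
      Real.logb_mul h1.ne' (by positivity), Real.logb_pow, Real.logb_pow,
      Spectrum.logb_eval_sc hk f]
    have h2 : (⌊τ * m⌋₊ : ℝ) ≤ τ * m := Nat.floor_le (by positivity)
    have h3 := mul_le_mul_of_nonneg_right h2 (Spectrum.logb_eval_nonneg f hφ)
    have h4 := mul_le_mul_of_nonneg_left (h f) (Nat.cast_nonneg (α := ℝ) m)
    linarith)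
  have hsplit := split_of_pow_le hk hB hm hc
  refine ⟨c, fun n => ?_⟩
  -- The assistance is rounded up to 2n + c two-level GHZ states, each replaced by q copies of ψ and
  -- a scalar C, with one additional factor C.
  have h1 : le ((c : S k) * 4 ^ n) (cls (ghz Finset.univ (2 ^ (2 * n + c)))) := by
    rw [← natCast_eq_cls hk]
    have : c * 4 ^ n ≤ 2 ^ (2 * n + c) := by
      rw [pow_add, pow_mul, mul_comm]
      exact Nat.mul_le_mul_left _ Nat.lt_two_pow_self.le
    have h2 := (isStrassen hk).natCast_mono this
    rwa [Nat.cast_mul, Nat.cast_pow, Nat.cast_ofNat] at h2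
  have h2 := le_trans (hc n) (mul_le_mul hk h1 (le_refl _))
  rw [mul_pow, ← sc_pow, ← pow_mul, ← pow_mul, ← cls_tpow φ] at h2
  have h3 := key _ (fun i => (hsplit i).tpow _) _ _ _ (by positivity) h2
  rw [cls_tpow] at h3
  rwa [show (m + 2 * q) * n + q * c = m * n + q * (2 * n + c) by ring]

/-- Conversion at any rate below the bound given by the spectrum, with arbitrarily small exponential
overhead. -/
theorem eventually_pow_le (hk : 1 ≤ k) {ψ φ : PureState k} (hψ : ψ.normSq = 1)
    (hφ : φ.normSq = 1) {r τ τ' δ : ℝ} (hr : 0 ≤ r) (hτ' : 0 ≤ τ') (hlt : τ' < τ) (hδ : 0 < δ)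
    (h : ∀ f : Spectrum k, τ * Real.logb 2 (Spectrum.eval f φ) ≤
      r * Spectrum.alpha f + Real.logb 2 (Spectrum.eval f ψ)) :
    ∀ᶠ M : ℕ in atTop, le (cls φ ^ ⌊τ' * M⌋₊)
      (sc k ((2 : ℝ) ^ ((M : ℝ) * r / 2 + δ * M)) * cls ψ ^ M) := by
  have hτ : 0 < τ := hτ'.trans_lt hlt
  obtain ⟨C, hC, q, key⟩ := exists_block_le hk hψ hφ hr hτ h
  set γ := Real.logb 2 C with hγ
  have hγ0 : 0 ≤ γ := Real.logb_nonneg one_lt_two hC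
  have hC2 : C = (2 : ℝ) ^ γ := (Real.rpow_logb two_pos (by norm_num) (by linarith)).symm
  -- The block length is large enough to have at least three output copies, to let the gap τ - τ'
  -- absorb both the 2q extra copies per block and the rounding of τm, and to keep the scalar C^(2n)
  -- below 2^(δM/2).
  obtain ⟨m, hm1, hm2, hm3, hm0⟩ : ∃ m : ℕ, 4 ≤ τ * m ∧ τ' * (m + 2 * q) + 1 < τ * m ∧
      4 * γ ≤ δ * m ∧ 0 < m := by
    obtain ⟨m, hm⟩ := exists_nat_gt (4 / τ + (2 * q * τ' + 1) / (τ - τ') + 4 * γ / δ)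
    have hd : 0 < τ - τ' := sub_pos.mpr hlt
    have e1 : 0 ≤ 4 / τ := by positivity
    have e2 : 0 ≤ (2 * q * τ' + 1) / (τ - τ') := by positivity
    have e3 : 0 ≤ 4 * γ / δ := by positivity
    have g1 : 4 / τ < m := by linarith
    have g2 : (2 * q * τ' + 1) / (τ - τ') < m := by linarith
    have g3 : 4 * γ / δ < m := by linarith
    rw [div_lt_iff₀ hτ] at g1
    rw [div_lt_iff₀ hd] at g2
    rw [div_lt_iff₀ hδ] at g3
    refine ⟨m, by linarith, by linarith, by linarith, ?_⟩
    have : (0 : ℝ) < m := by linarith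
    exact_mod_cast this
  have hfloor : τ * m - 1 < ⌊τ * m⌋₊ := Nat.sub_one_lt_floor _
  obtain ⟨c, hc⟩ := key m (Nat.le_floor (by norm_num; linarith))
  set H := ⌊τ * m⌋₊ with hH
  have hHd : 0 < (H : ℝ) - τ' * (m + 2 * q) := by linarith
  -- For large M the costs independent of M are negligible: the reserved q·c copies, the incomplete
  -- last block, and the scalar C^(c+1), which uses up the other half of δM.
  have hev : ∀ᶠ M : ℕ in atTop, (q * c + (m + 2 * q) : ℝ) * H <
      ((H : ℝ) - τ' * (m + 2 * q)) * M ∧ 2 * (c + 1) * γ ≤ δ * M ∧ q * c ≤ M := by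
    have t := tendsto_natCast_atTop_atTop (R := ℝ)
    exact ((t.const_mul_atTop hHd).eventually_gt_atTop _).and
      (((t.const_mul_atTop hδ).eventually_ge_atTop _).and (eventually_ge_atTop _))
  filter_upwards [hev] with M hM
  obtain ⟨hM1, hM2, hM3⟩ := hM
  set n := (M - q * c) / (m + 2 * q) with hn
  have hpos : 0 < m + 2 * q := by omega
  have hn1 : (m + 2 * q) * n + q * c ≤ M := by
    have := Nat.mul_div_le (M - q * c) (m + 2 * q)
    rw [← hn] at this
    omega
  have hn2 : M < (m + 2 * q) * (n + 1) + q * c := by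
    have := Nat.lt_mul_div_succ (M - q * c) hpos
    rw [← hn] at this
    omega
  have hn1' : ((m : ℝ) + 2 * q) * n + q * c ≤ M := by exact_mod_cast hn1
  have hn2' : (M : ℝ) < ((m : ℝ) + 2 * q) * (n + 1) + q * c := by exact_mod_cast hn2
  have hm0' : (0 : ℝ) < m := by exact_mod_cast hm0
  have hpos' : (0 : ℝ) < (m : ℝ) + 2 * q := by positivity
  have hmn : (m : ℝ) * n ≤ M := by
    have : (0 : ℝ) ≤ 2 * q * n + q * c := by positivity
    linarith
  have hcount : ⌊τ' * M⌋₊ ≤ H * n := by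
    refine Nat.floor_le_of_le ?_
    push_cast
    have h1 : (H : ℝ) * M ≤ H * (((m : ℝ) + 2 * q) * (n + 1) + q * c) :=
      mul_le_mul_of_nonneg_left hn2'.le (Nat.cast_nonneg _)
    have h2 : τ' * M * ((m : ℝ) + 2 * q) ≤ H * n * ((m : ℝ) + 2 * q) := by linarith
    exact le_of_mul_le_mul_right h2 hpos'
  refine le_trans (pow_le_pow_right hk (one_le_cls hφ) hcount) (le_trans (hc n) ?_)
  refine mul_le_mul hk (sc_mono hk (by positivity) ?_) (pow_le_pow_right hk (one_le_cls hψ) hn1)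
  rw [hC2, ← Real.rpow_natCast, ← Real.rpow_natCast, ← Real.rpow_mul two_pos.le,
    ← Real.rpow_mul two_pos.le, ← Real.rpow_add two_pos]
  refine Real.rpow_le_rpow_of_exponent_le one_le_two ?_
  push_cast
  have h1 : (m : ℝ) * r / 2 * n ≤ M * r / 2 := by
    have := mul_le_mul_of_nonneg_right hmn hr
    linarith
  have h2 : γ * (2 * n) ≤ δ / 2 * M := by
    have h3 := mul_le_mul_of_nonneg_right hm3 (Nat.cast_nonneg (α := ℝ) n)
    have h4 := mul_le_mul_of_nonneg_left hmn hδ.le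
    linarith
  linarith

end S

/-- A sublinear sequence that satisfies a family of monotone conditions eventually, if every linear
sequence of positive slope does. -/
theorem exists_isLittleO_of_forall_pos {Q : ℕ → ℝ → Prop} (hQ : ∀ n e e', e ≤ e' → Q n e → Q n e')
    (h : ∀ δ : ℝ, 0 < δ → ∀ᶠ n : ℕ in atTop, Q n (δ * n)) :
    ∃ e : ℕ → ℝ, e =o[atTop] (fun n : ℕ => (n : ℝ)) ∧ ∀ᶠ n : ℕ in atTop, Q n (e n) := by
  have hbdd : ∀ n, BddBelow {e : ℝ | 0 ≤ e ∧ Q n e} := fun n => ⟨0, fun e he => he.1⟩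
  have hnn : ∀ n, 0 ≤ sInf {e : ℝ | 0 ≤ e ∧ Q n e} := fun n => Real.sInf_nonneg fun e he => he.1
  -- The least admissible overhead is sublinear because every positive slope works eventually. The
  -- infimum need not be attained, so 1 is added. Where the set is empty the infimum is 0 by
  -- convention, which affects finitely many n only.
  refine ⟨fun n => sInf {e : ℝ | 0 ≤ e ∧ Q n e} + 1, ?_, ?_⟩
  · rw [isLittleO_iff]
    intro c hc
    filter_upwards [h (c / 2) (by positivity),
      tendsto_natCast_atTop_atTop.eventually_ge_atTop (2 / c)] with n hn hn'
    have h1 : sInf {e : ℝ | 0 ≤ e ∧ Q n e} ≤ c / 2 * n := csInf_le (hbdd n) ⟨by positivity, hn⟩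
    rw [div_le_iff₀ hc] at hn'
    rw [Real.norm_of_nonneg (by linarith [hnn n]), Real.norm_of_nonneg (Nat.cast_nonneg n)]
    linarith
  · filter_upwards [h 1 one_pos] with n hn
    obtain ⟨e, he, hlt⟩ := exists_lt_of_csInf_lt (s := {e : ℝ | 0 ≤ e ∧ Q n e})
      ⟨1 * n, by positivity, hn⟩ (lt_add_one _)
    exact hQ n e _ hlt.le he.2

theorem converts_tpow_iff {ψ φ : PureState k} {c : ℝ} {m n : ℕ} :
    ((ψ.tpow m).scale c).Converts (φ.tpow n) ↔ S.le (cls φ ^ n) (S.sc k c * cls ψ ^ m) := by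
  rw [S.sc_mul_cls_pow, ← S.cls_tpow]
  rfl

theorem achievable_of_lt (hk : 1 ≤ k) {ψ φ : PureState k} (hψ : ψ.normSq = 1)
    (hφ : φ.normSq = 1) {r τ τ' : ℝ} (hr : 0 ≤ r) (hτ' : 0 ≤ τ') (hlt : τ' < τ)
    (h : ∀ f : Spectrum k, τ * Real.logb 2 (Spectrum.eval f φ) ≤
      r * Spectrum.alpha f + Real.logb 2 (Spectrum.eval f ψ)) :
    Achievable r ψ φ τ' := by
  refine exists_isLittleO_of_forall_pos (Q := fun n e =>
    ((ψ.tpow n).scale ((2 : ℝ) ^ ((n : ℝ) * r / 2 + e))).Converts (φ.tpow ⌊τ' * n⌋₊))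
    (fun n e e' hee h => ?_) fun δ hδ => ?_
  · rw [converts_tpow_iff] at h ⊢
    refine S.le_trans h (S.mul_le_mul_right hk _ (S.sc_mono hk (by positivity) ?_))
    exact Real.rpow_le_rpow_of_exponent_le one_le_two (by linarith)
  · filter_upwards [S.eventually_pow_le hk hψ hφ hr hτ' hlt hδ h] with n hn
    rwa [converts_tpow_iff]

theorem achievable_zero (hk : 1 ≤ k) {ψ : PureState k} (hψ : ψ.normSq = 1) (φ : PureState k)
    {r : ℝ} (hr : 0 ≤ r) : Achievable r ψ φ 0 := by
  refine ⟨fun _ => 0, isLittleO_zero _ _, Eventually.of_forall fun n => ?_⟩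
  rw [converts_tpow_iff, zero_mul, Nat.floor_zero, pow_zero, add_zero]
  have h1 := S.pow_le_pow_right hk (S.one_le_cls hψ) (Nat.zero_le n)
  rw [pow_zero] at h1
  exact S.le_trans h1 (S.le_sc_mul hk (Real.one_le_rpow one_le_two (by positivity)) _)

/-! ### Comparison of the formulas for the optimal rate -/

theorem supRate_congr {P Q : ℝ → Prop} (h : ∀ τ, P τ ↔ Q τ) : supRate P = supRate Q := by
  rw [show P = Q from funext fun τ => propext (h τ)]

theorem le_supRate {P : ℝ → Prop} {τ : ℝ} (h0 : 0 ≤ τ) (h : P τ) : (τ : EReal) ≤ supRate P :=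
  le_sSup ⟨τ, ⟨h0, h⟩, rfl⟩

/-- A rate allowed by the spectrum need not be shown achievable itself: all smaller nonnegative
rates are, and the supremum is the same. Negative bounds are exceeded by the achievable rate 0. -/
theorem extractionRate_eq_supRate (hk : 1 ≤ k) {ψ φ : PureState k} (hψ : ψ.normSq = 1)
    (hφ : φ.normSq = 1) {r : ℝ} (hr : 0 ≤ r) :
    extractionRate r ψ φ = supRate (fun τ => ∀ f : Spectrum k,
      τ * Real.logb 2 (Spectrum.eval f φ) ≤
        r * Spectrum.alpha f + Real.logb 2 (Spectrum.eval f ψ)) := by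
  refine le_antisymm (sSup_le ?_) (sSup_le ?_)
  · rintro _ ⟨τ, ⟨hτ, h⟩, rfl⟩
    exact le_supRate hτ fun f => h.le_of_spectrum hk hψ hφ hτ f
  · rintro _ ⟨τ, ⟨hτ, h⟩, rfl⟩
    have h0 : (0 : EReal) ≤ extractionRate r ψ φ := by
      have := le_supRate le_rfl (achievable_zero hk hψ φ hr)
      rwa [EReal.coe_zero] at this
    refine le_of_forall_lt fun c hc => ?_
    rcases lt_or_ge c 0 with hc0 | hc0
    · exact hc0.trans_le h0
    · obtain ⟨τ', h1, h2⟩ := EReal.lt_iff_exists_real_btwn.mp hc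
      have h3 : 0 ≤ τ' := by exact_mod_cast hc0.trans h1.le
      exact h1.trans_le (le_supRate h3
        (achievable_of_lt hk hψ hφ hr h3 (EReal.coe_lt_coe_iff.mp h2) h))

theorem supRate_eq_iInf (hk : 1 ≤ k) {ψ φ : PureState k} (hψ : ψ.normSq = 1)
    (hφ : φ.normSq = 1) {r : ℝ} (hr : 0 ≤ r) :
    supRate (fun τ => ∀ f : Spectrum k, τ * Real.logb 2 (Spectrum.eval f φ) ≤
        r * Spectrum.alpha f + Real.logb 2 (Spectrum.eval f ψ)) =
      ⨅ (f : Spectrum k) (_ : Real.logb 2 (Spectrum.eval f φ) ≠ 0),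
        (((r * Spectrum.alpha f + Real.logb 2 (Spectrum.eval f ψ)) /
          Real.logb 2 (Spectrum.eval f φ) : ℝ) : EReal) := by
  have hnn : ∀ f : Spectrum k, 0 ≤ r * Spectrum.alpha f + Real.logb 2 (Spectrum.eval f ψ) :=
    fun f => add_nonneg (mul_nonneg hr (Spectrum.alpha_nonneg hk f))
      (Spectrum.logb_eval_nonneg f hψ)
  have hpos : ∀ f : Spectrum k, Real.logb 2 (Spectrum.eval f φ) ≠ 0 →
      0 < Real.logb 2 (Spectrum.eval f φ) :=
    fun f hf => lt_of_le_of_ne (Spectrum.logb_eval_nonneg f hφ) hf.symm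
  refine le_antisymm (sSup_le ?_) (le_of_forall_lt fun c hc => ?_)
  · rintro _ ⟨τ, ⟨hτ, h⟩, rfl⟩
    refine le_iInf₂ fun f hf => ?_
    exact EReal.coe_le_coe_iff.mpr ((le_div_iff₀ (hpos f hf)).mpr (h f))
  · rcases lt_or_ge c 0 with hc0 | hc0
    · refine hc0.trans_le ?_
      simpa using le_supRate (P := fun τ => ∀ f : Spectrum k,
        τ * Real.logb 2 (Spectrum.eval f φ) ≤
          r * Spectrum.alpha f + Real.logb 2 (Spectrum.eval f ψ)) le_rfl
        (fun f => by simpa using hnn f)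
    · obtain ⟨τ, h1, h2⟩ := EReal.lt_iff_exists_real_btwn.mp hc
      have h3 : 0 ≤ τ := by exact_mod_cast hc0.trans h1.le
      refine h1.trans_le (le_supRate h3 fun f => ?_)
      -- A point with log f(φ) = 0 imposes no condition on τ, because the right-hand side is
      -- nonnegative for r ≥ 0 and unit vectors. It can therefore be left out of the infimum.
      by_cases hf : Real.logb 2 (Spectrum.eval f φ) = 0
      · rw [hf, mul_zero]
        exact hnn f
      · rw [← le_div_iff₀ (hpos f hf)]
        exact_mod_cast h2.le.trans (iInf₂_le f hf)

end LOCC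

end

theorem mainTheorem6 (k : ℕ) (hk : 1 ≤ k) (ψ φ : LOCC.PureState k)
    (hψ : ψ.normSq = 1) (hφ : φ.normSq = 1) (r : ℝ) (hr : 0 ≤ r) :
    LOCC.extractionRate r ψ φ =
        LOCC.supRate (fun τ => ∀ f : LOCC.Spectrum k,
          LOCC.Spectrum.eval f φ ^ τ ≤ LOCC.Spectrum.eval f (ψ.scale ((2 : ℝ) ^ (r / 2)))) ∧
      LOCC.extractionRate r ψ φ =
        LOCC.supRate (fun τ => ∀ f : LOCC.Spectrum k,
          τ * Real.logb 2 (LOCC.Spectrum.eval f φ) ≤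
            r * LOCC.Spectrum.alpha f + Real.logb 2 (LOCC.Spectrum.eval f ψ)) ∧
      LOCC.extractionRate r ψ φ =
        ⨅ (f : LOCC.Spectrum k) (_ : Real.logb 2 (LOCC.Spectrum.eval f φ) ≠ 0),
          (((r * LOCC.Spectrum.alpha f + Real.logb 2 (LOCC.Spectrum.eval f ψ)) /
            Real.logb 2 (LOCC.Spectrum.eval f φ) : ℝ) : EReal) := by
  have h := LOCC.extractionRate_eq_supRate hk hψ hφ hr
  refine ⟨h.trans (LOCC.supRate_congr fun τ => forall_congr' fun f => ?_), h,
    h.trans (LOCC.supRate_eq_iInf hk hψ hφ hr)⟩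
  exact (LOCC.Spectrum.rpow_eval_le_iff hk f hψ hφ r τ).symm
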